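/- **Setting.** Let $n\ge 0$ and $\pi\in S_n$. Call $\pi$ *Grassmannian* if it has at most one descent, and *inverse-Grassmannian* if $\pi^{-1}$ is Grassmannian. *ASM.* An $n\times n$ alternating sign matrix $A$ (entries in $\{0,1,-1\}$, rows and columns sum to $1$, nonzero entries alternate in sign along rows and columns) corresponds to a bumpless pipe dream (BPD): a tiling of the $n\times n$ grid by the six tiles (crossing, horizontal, vertical, elbow joining the south and east edges, elbow joining the north and west edges, blank) forming $n$ pipes from the south to the east border; the south-east elbows are the $1$s of $A$ and the north-west elbows are its $-1$s. Label the pipes $1,\dots,n$ from left to right on the south border; the permutation of the BPD is read off the east border from top to bottom, where repeated crossings of the same two pipes are ignored. Let $\mathrm{ASM}(\pi)$ be the set of $A$ whose BPD has permutation $\pi$. The weight is $\mathrm{wt}(A)=\prod x_i$ over all $(i,j)$ with $A_{ij}=0$ and $\sum_{i'\le i}A_{i'j}=\sum_{j'\le j}A_{ij'}=0$ (equivalently, over the blank tiles). A *simple droop* in a $2\times2$ square whose north-west tile is a south-east elbow and whose south-east tile is blank pushes the pipe through the north-west tile to the south-east tile: the north-west tile becomes blank, the south-east tile becomes a north-west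 elbow, the north-east tile changes from horizontal to south-east elbow or from north-west elbow to vertical, and the south-west tile changes from vertical to south-east elbow or from north-west elbow to horizontal. Let $\mathrm{droop}(\pi)$ be the poset of all BPDs obtained by sequences of simple droops from the Rothe BPD (the BPD of the matrix with $1$s at $(i,\pi(i))$), with $D\le D'$ iff $D'$ is obtained from $D$ by a sequence of simple droops. *TSSCPP.* Let $T$ be a totally symmetric self-complementary plane partition in the $2n\times2n\times2n$ box. For $1\le l\le n-1$ and $d\ge0$ let $m_l(d)=\#\{p\ge1: T_{n+p,n+p+d}\ge l\}$. The boolean triangle of $T$ has entries $b_{i,j}\in\{0,1\}$ for $1\le i\le n-1$, $n-i\le j\le n-1$, with $b_{i,j}=1$ iff $m_{n-j}(n-1-i)=m_{n-j}(n-i)$; these entries record the steps of the nest of non-intersecting lattice paths in the fundamental domain of $T$. The weight is $\mathrm{wt}(T)=\prod_{b_{i,j}=1}x_{n-i}$. The pipe dream of $T$ has a cross at $(r,c)$, for $r,c\ge1$, $r+c\le n$, iff $b_{n-r,r+c-1}=1$, and elbows (joining north with west and south with east) elsewhere. Its pipes are labelled $1,\dots,n$ from left to right on the north border, its permutation is read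 off the west border from top to bottom, and it is reduced if no two pipes cross twice. Let $\mathrm{TSSCPP}^{red}(\pi)$ be the set of $T$ whose pipe dream is reduced and has permutation $\pi$. A *simple slide* moves a cross from $(r+1,c)$ to $(r,c+1)$ when the other three tiles of this $2\times 2$ square are elbows. Let $\mathrm{slide}(\pi)$ be the poset of all pipe dreams obtained by sequences of simple slides from the bottom pipe dream of $\pi$ (crosses left-justified, with $\#\{k>i:\pi(k)<\pi(i)\}$ crosses in row $i$), ordered by reachability, so that simple slides move up. **Statement.** If $\pi$ is inverse-Grassmannian, then taking the BPD is a bijection $\mathrm{ASM}(\pi)\to\mathrm{droop}(\pi)$, taking the pipe dream is a bijection $\mathrm{TSSCPP}^{red}(\pi)\to\mathrm{slide}(\pi)$, and there is a weight-preserving bijection $\Phi:\mathrm{ASM}(\pi)\to\mathrm{TSSCPP}^{red}(\pi)$ that corresponds under these identifications to an isomorphism of posets $e:\mathrm{droop}(\pi)\to\mathrm{slide}(\pi)$. The bijection is given by matching moves: $e$ sends the Rothe BPD to the bottom pipe dream, and for all $D,D'\in\mathrm{droop}(\pi)$ and every $i$, $D'$ is obtained from $D$ by a simple droop in rows $i,i+1$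 if and only if $e(D')$ is obtained from $e(D)$ by a simple slide in rows $i,i+1$. -/

import Mathlib

namespace ASMTSSCPP

open Finset

/-! ## Permutations -/

/-- `i` is a descent of `π`: `π(i) > π(i+1)`. -/
def IsDescent {n : ℕ} (π : Equiv.Perm (Fin n)) (i : Fin n) : Prop :=
  ∃ h : i.val + 1 < n, π ⟨i.val + 1, h⟩ < π i

/-- A permutation is Grassmannian if it has at most one descent. -/
def IsGrassmannian {n : ℕ} (π : Equiv.Perm (Fin n)) : Prop :=
  ∀ i j : Fin n, IsDescent π i → IsDescent π j → i = j

/-- A permutation is inverse-Grassmannian if its inverse is Grassmannian. -/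
def IsInverseGrassmannian {n : ℕ} (π : Equiv.Perm (Fin n)) : Prop :=
  IsGrassmannian π⁻¹

/-! ## Alternating sign matrices -/

/-- The condition on a single row or column of an alternating sign matrix: entries in `{0,1,-1}`,
sum `1`, and consecutive nonzero entries have opposite signs. -/
structure IsAltLine {n : ℕ} (v : Fin n → ℤ) : Prop where
  entries : ∀ k, v k = 0 ∨ v k = 1 ∨ v k = -1
  sum_eq : ∑ k, v k = 1
  alt : ∀ k l, k < l → v k ≠ 0 → v l ≠ 0 → (∀ m, k < m → m < l → v m = 0) → v l = -v k

/-- Alternating sign matrices of size `n`. -/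
@[ext] structure ASM (n : ℕ) where
  mat : Matrix (Fin n) (Fin n) ℤ
  row : ∀ i, IsAltLine (fun j => mat i j)
  col : ∀ j, IsAltLine (fun i => mat i j)

/-- Auxiliary: partial sums of the first `k` entries. -/
def partialSum {n : ℕ} (v : Fin n → ℤ) (k : ℕ) : ℤ :=
  ∑ l ∈ univ.filter (fun l : Fin n => l.val < k), v l

theorem partialSum_succ {n : ℕ} (v : Fin n → ℤ) (k : ℕ) (hk : k < n) :
    partialSum v (k + 1) = partialSum v k + v ⟨k, hk⟩ := by
  have h : univ.filter (fun l : Fin n => l.val < k + 1)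
      = insert ⟨k, hk⟩ (univ.filter (fun l : Fin n => l.val < k)) := by
    ext l
    simp only [mem_filter, mem_univ, true_and, mem_insert, Fin.ext_iff]
    omega
  unfold partialSum
  rw [h, sum_insert (by simp)]
  ring

/-- The partial sums of a row or column of an alternating sign matrix are `0` or `1`. -/
theorem IsAltLine.partialSum_mem {n : ℕ} {v : Fin n → ℤ} (hv : IsAltLine v) (k : ℕ)
    (hk : k ≤ n) : partialSum v k = 0 ∨ partialSum v k = 1 := by
  -- `Q ε k`: the last nonzero entry before `k` is `w`, and the sum is `0` or `ε` accordingly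
  let Q : ℤ → ℕ → Prop := fun ε k => ∃ m : Fin n, m.val < k ∧
    (∀ l : Fin n, m < l → l.val < k → v l = 0) ∧
    ((partialSum v k = 0 ∧ v m = -ε) ∨ (partialSum v k = ε ∧ v m = ε))
  let Z : ℕ → Prop := fun k => (∀ l : Fin n, l.val < k → v l = 0) ∧ partialSum v k = 0
  have stepQ : ∀ ε k, (ε = 1 ∨ ε = -1) → k < n → Q ε k → Q ε (k + 1) := by
    rintro ε k hε hk ⟨m, hm, hz, hs⟩
    have hS := partialSum_succ v k hk
    by_cases h0 : v ⟨k, hk⟩ = 0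
    · refine ⟨m, by omega, ?_, ?_⟩
      · intro l hl hlk
        by_cases hlk' : l.val < k
        · exact hz l hl hlk'
        · have : l = ⟨k, hk⟩ := Fin.ext (by simp; omega)
          rw [this]; exact h0
      · rw [hS, h0, add_zero]; exact hs
    · refine ⟨⟨k, hk⟩, by simp, ?_, ?_⟩
      · intro l hl hlk
        have : k < l.val := hl
        omega
      · have hm0 : v m ≠ 0 := by
          rcases hs with ⟨_, h⟩ | ⟨_, h⟩ <;> rcases hε with e | e <;> rw [h, e] <;> norm_num
        have := hv.alt m ⟨k, hk⟩ hm hm0 h0 (fun l h1 h2 => hz l h1 h2)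
        rcases hs with ⟨h1, h2⟩ | ⟨h1, h2⟩
        · right; rw [hS, h1, this, h2]; simp
        · left; rw [hS, h1, this, h2]; simp
  have stepZ : ∀ k, k < n → Z k → Z (k + 1) ∨ Q 1 (k + 1) ∨ Q (-1) (k + 1) := by
    rintro k hk ⟨hz, hs⟩
    have hS := partialSum_succ v k hk
    have key : ∀ ε : ℤ, v ⟨k, hk⟩ = ε → Q ε (k + 1) := by
      intro ε h
      refine ⟨⟨k, hk⟩, by simp, ?_, Or.inr ⟨by rw [hS, hs, h, zero_add], h⟩⟩
      intro l hl hlk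
      have : k < l.val := hl
      omega
    rcases hv.entries ⟨k, hk⟩ with h | h | h
    · left
      refine ⟨?_, by rw [hS, h, hs, add_zero]⟩
      intro l hl
      by_cases hlk' : l.val < k
      · exact hz l hlk'
      · have : l = ⟨k, hk⟩ := Fin.ext (by simp; omega)
        rw [this]; exact h
    · exact Or.inr (Or.inl (key 1 h))
    · exact Or.inr (Or.inr (key (-1) h))
  have total : partialSum v n = 1 := by
    have h : univ.filter (fun l : Fin n => l.val < n) = univ := by
      ext l; simp
    unfold partialSum
    rw [h]; exact hv.sum_eq
  have badn : ∀ d k, k + d = n → ¬ Q (-1) k := by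
    intro d
    induction d with
    | zero =>
      rintro k hkn ⟨m, _, _, h⟩
      have hkn' : k = n := by omega
      subst hkn'
      rw [total] at h
      rcases h with ⟨h, _⟩ | ⟨h, _⟩ <;> norm_num at h
    | succ d ih =>
      intro k hkn hq
      exact ih (k + 1) (by omega) (stepQ (-1) k (Or.inr rfl) (by omega) hq)
  have main : ∀ k, k ≤ n → Z k ∨ Q 1 k := by
    intro k
    induction k with
    | zero => exact fun _ => Or.inl ⟨fun l hl => absurd hl (by omega), by simp [partialSum]⟩
    | succ k ih =>
      intro hk
      rcases ih (by omega) with h | h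
      · rcases stepZ k (by omega) h with h | h | h
        · exact Or.inl h
        · exact Or.inr h
        · exact absurd h (badn (n - (k + 1)) (k + 1) (by omega))
      · exact Or.inr (stepQ 1 k (Or.inl rfl) (by omega) h)
  rcases main k hk with ⟨_, h⟩ | ⟨_, _, _, ⟨h, _⟩ | ⟨h, _⟩⟩
  · exact Or.inl h
  · exact Or.inl h
  · exact Or.inr h

/-- The sum of the entries of row `i` in columns `≤ j`. -/
def ASM.rowSum {n : ℕ} (A : ASM n) (i j : Fin n) : ℤ :=
  partialSum (fun l => A.mat i l) (j.val + 1)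

/-- The sum of the entries of column `j` in rows `≤ i`. -/
def ASM.colSum {n : ℕ} (A : ASM n) (i j : Fin n) : ℤ :=
  partialSum (fun l => A.mat l j) (i.val + 1)

/-- The set of north-west zeros: zero entries whose row and column partial sums vanish. -/
def ASM.nw {n : ℕ} (A : ASM n) : Finset (Fin n × Fin n) :=
  univ.filter fun p => A.mat p.1 p.2 = 0 ∧ A.colSum p.1 p.2 = 0 ∧ A.rowSum p.1 p.2 = 0

/-- The weight of an alternating sign matrix, with rows numbered `1, …, n`. -/
noncomputable def ASM.wt {n : ℕ} (A : ASM n) : MvPolynomial ℕ ℤ :=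
  ∏ p ∈ A.nw, MvPolynomial.X (p.1.val + 1)

/-- The permutation matrix with `1`s at the positions `(i, π i)`. -/
def permMat {n : ℕ} (π : Equiv.Perm (Fin n)) : Matrix (Fin n) (Fin n) ℤ :=
  fun i j => if π i = j then 1 else 0

theorem isAltLine_single {n : ℕ} (a : Fin n) :
    IsAltLine (fun k : Fin n => if a = k then (1 : ℤ) else 0) where
  entries k := by by_cases h : a = k <;> simp [h]
  sum_eq := by simp
  alt k l hkl hk hl _ := by
    have h1 : a = k := by by_contra h; exact hk (by simp [h])
    have h2 : a = l := by by_contra h; exact hl (by simp [h])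
    exact absurd (h1.symm.trans h2) (ne_of_lt hkl)

/-- The alternating sign matrix of a permutation. -/
def permASM {n : ℕ} (π : Equiv.Perm (Fin n)) : ASM n where
  mat := permMat π
  row i := isAltLine_single (π i)
  col j := by
    have h : (fun i => permMat π i j) = fun i => if π.symm j = i then (1 : ℤ) else 0 := by
      funext i
      have : π i = j ↔ π.symm j = i := by
        rw [Equiv.symm_apply_eq]; exact eq_comm
      simp only [permMat, this]
    rw [h]; exact isAltLine_single _

/-! ## Bumpless pipe dreams -/

/-- The six tiles: crossing, horizontal pipe, vertical pipe, the elbow joining the south and east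
edges, the elbow joining the north and west edges, and the blank tile. -/
inductive Tile
  | cross | horiz | vert | southEast | northWest | blank
  deriving DecidableEq

/-- Does the tile have a pipe through its left edge? -/
def Tile.left : Tile → Bool
  | .cross | .horiz | .northWest => true
  | .vert | .southEast | .blank => false

/-- Does the tile have a pipe through its right edge? -/
def Tile.right : Tile → Bool
  | .cross | .horiz | .southEast => true
  | .vert | .northWest | .blank => false

/-- Does the tile have a pipe through its top edge? -/
def Tile.top : Tile → Bool
  | .cross | .vert | .northWest => true
  | .horiz | .southEast | .blank => false

/-- Does the tile have a pipe through its bottom edge? -/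
def Tile.bottom : Tile → Bool
  | .cross | .vert | .southEast => true
  | .horiz | .northWest | .blank => false

/-- Bumpless pipe dreams of size `n`: tilings such that the pipes match along the inner edges,
one pipe starts at every edge of the south border, one pipe leaves through every edge of the east
border, and no pipe touches the north or the west border. -/
@[ext] structure BPD (n : ℕ) where
  tile : Fin n → Fin n → Tile
  match_row : ∀ i j j' : Fin n, j'.val = j.val + 1 → (tile i j).right = (tile i j').left
  match_col : ∀ i i' j : Fin n, i'.val = i.val + 1 → (tile i j).bottom = (tile i' j).top
  west : ∀ i j : Fin n, j.val = 0 → (tile i j).left = false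
  north : ∀ i j : Fin n, i.val = 0 → (tile i j).top = false
  east : ∀ i j : Fin n, j.val + 1 = n → (tile i j).right = true
  south : ∀ i j : Fin n, i.val + 1 = n → (tile i j).bottom = true

/-- The tile of the bumpless pipe dream of `A` at `(i,j)`: entries `1` and `-1` are the two kinds
of elbows; at a zero entry a horizontal (vertical) pipe is present if and only if the row (column)
partial sum is `1`. -/
def ASM.tileAt {n : ℕ} (A : ASM n) (i j : Fin n) : Tile :=
  if A.mat i j = 1 then .southEast
  else if A.mat i j = -1 then .northWest
  else if A.colSum i j = 0 then (if A.rowSum i j = 0 then .blank else .horiz)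
  else (if A.rowSum i j = 0 then .vert else .cross)

theorem ASM.tileAt_row {n : ℕ} (A : ASM n) (i j : Fin n) :
    (A.tileAt i j).right = decide (partialSum (fun l => A.mat i l) (j.val + 1) = 1) ∧
    (A.tileAt i j).left = decide (partialSum (fun l => A.mat i l) j.val = 1) := by
  have h1 := (A.row i).partialSum_mem (j.val + 1) (by omega)
  have h0 := (A.row i).partialSum_mem j.val (by omega)
  have hs := partialSum_succ (fun l => A.mat i l) j.val j.isLt
  have he := (A.row i).entries j
  simp only [Fin.eta] at hs he
  unfold ASM.tileAt ASM.rowSum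
  rw [hs] at h1 ⊢
  rcases he with e | e | e <;> rcases h0 with h0 | h0 <;>
    rw [e, h0] at h1 <;> rw [e, h0] <;>
    first
      | (exfalso; revert h1; norm_num; done)
      | (norm_num [Tile.left, Tile.right]; done)
      | (norm_num; split_ifs <;> simp [Tile.left, Tile.right])

theorem ASM.tileAt_col {n : ℕ} (A : ASM n) (i j : Fin n) :
    (A.tileAt i j).bottom = decide (partialSum (fun l => A.mat l j) (i.val + 1) = 1) ∧
    (A.tileAt i j).top = decide (partialSum (fun l => A.mat l j) i.val = 1) := by
  have h1 := (A.col j).partialSum_mem (i.val + 1) (by omega)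
  have h0 := (A.col j).partialSum_mem i.val (by omega)
  have hs := partialSum_succ (fun l => A.mat l j) i.val i.isLt
  have he := (A.col j).entries i
  simp only [Fin.eta] at hs he
  unfold ASM.tileAt ASM.colSum
  rw [hs] at h1 ⊢
  rcases he with e | e | e <;> rcases h0 with h0 | h0 <;>
    rw [e, h0] at h1 <;> rw [e, h0] <;>
    first
      | (exfalso; revert h1; norm_num; done)
      | (norm_num [Tile.top, Tile.bottom]; done)
      | (norm_num; split_ifs <;> simp [Tile.top, Tile.bottom])

theorem IsAltLine.partialSum_total {n : ℕ} {v : Fin n → ℤ} (hv : IsAltLine v) :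
    partialSum v n = 1 := by
  have h : univ.filter (fun l : Fin n => l.val < n) = univ := by
    ext l; simp
  unfold partialSum
  rw [h]; exact hv.sum_eq

theorem partialSum_zero {n : ℕ} (v : Fin n → ℤ) : partialSum v 0 = 0 := by
  simp [partialSum]

/-- The bumpless pipe dream of an alternating sign matrix. -/
def ASM.toBPD {n : ℕ} (A : ASM n) : BPD n where
  tile := A.tileAt
  match_row i j j' h := by rw [(A.tileAt_row i j).1, (A.tileAt_row i j').2, h]
  match_col i i' j h := by rw [(A.tileAt_col i j).1, (A.tileAt_col i' j).2, h]
  west i j h := by rw [(A.tileAt_row i j).2, h, partialSum_zero]; simp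
  north i j h := by rw [(A.tileAt_col i j).2, h, partialSum_zero]; simp
  east i j h := by rw [(A.tileAt_row i j).1, h, (A.row i).partialSum_total]; simp
  south i j h := by rw [(A.tileAt_col i j).1, h, (A.col j).partialSum_total]; simp

/-- The tile in row `i` and column `j` (both counted from `0`), blank outside the grid. -/
def BPD.get {n : ℕ} (D : BPD n) (i j : ℕ) : Tile :=
  if h : i < n ∧ j < n then D.tile ⟨i, h.1⟩ ⟨j, h.2⟩ else .blank

/-- The label of the pipe leaving a tile through its right edge, if `a` is the label of the pipe
entering from the left and `b` that of the pipe entering from below. Pipes are labelled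
`1, …, n` from left to right along the south border, so at a crossing tile the two pipes have not
crossed before if and only if `a < b`; in that case they cross (`a` leaves to the right and `b`
through the top). If they have crossed before (`a > b`), the crossing is ignored, i.e. `a` leaves
through the top and `b` to the right. -/
def Tile.outRight (t : Tile) (a b : ℕ) : ℕ :=
  match t with
  | .cross => min a b
  | .horiz => a
  | .southEast => b
  | .vert | .northWest | .blank => 0

/-- The label of the pipe leaving a tile through its top edge; see `Tile.outRight`. -/
def Tile.outTop (t : Tile) (a b : ℕ) : ℕ :=
  match t with
  | .cross => max a b
  | .vert => b
  | .northWest => a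
  | .horiz | .southEast | .blank => 0

/-- In a row of tiles `T`, with labels `v` on the bottom edges of the tiles: the label of the pipe
on the left edge of column `j` (no pipe, encoded as `0`, on the west border). -/
def rowLabel (T : ℕ → Tile) (v : ℕ → ℕ) : ℕ → ℕ
  | 0 => 0
  | j + 1 => (T j).outRight (rowLabel T v j) (v j)

/-- The label of the pipe on the edge in column `j` that has exactly `k` rows below it. -/
def BPD.colLabel {n : ℕ} (D : BPD n) : ℕ → ℕ → ℕ
  | 0, j => j + 1
  | k + 1, j => (D.get (n - 1 - k) j).outTop
      (rowLabel (D.get (n - 1 - k)) (BPD.colLabel D k) j) (BPD.colLabel D k j)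

/-- The label of the pipe that leaves through the east border in row `i` (counted from `0`). -/
def BPD.exitLabel {n : ℕ} (D : BPD n) (i : ℕ) : ℕ :=
  rowLabel (D.get i) (D.colLabel (n - 1 - i)) n

/-- `D` has permutation `π`: reading the labels of the pipes on the east border from top to bottom
gives `π(1), …, π(n)`, where for non-reduced `D` repeated crossings of the same two pipes are
ignored (Demazure product). -/
def BPD.HasPerm {n : ℕ} (D : BPD n) (π : Equiv.Perm (Fin n)) : Prop :=
  ∀ i : Fin n, D.exitLabel i = (π i).val + 1

/-- `ASM(π)`: the alternating sign matrices whose bumpless pipe dream has permutation `π`. -/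
def ASMOf {n : ℕ} (π : Equiv.Perm (Fin n)) : Type :=
  {A : ASM n // A.toBPD.HasPerm π}

/-- The Rothe bumpless pipe dream of `π`. -/
def rothe {n : ℕ} (π : Equiv.Perm (Fin n)) : BPD n := (permASM π).toBPD

/-- `D'` is obtained from `D` by a simple droop in a `2 × 2` square with upper row `i`: the pipe
with an elbow in the north-west corner of the square, which enters the square in its south-west
tile (from below or from the left) and leaves it in its north-east tile (to the right or through
the top), is pushed to the blank tile in the south-east corner. -/
def SimpleDroop {n : ℕ} (i : Fin n) (D D' : BPD n) : Prop :=
  ∃ i' j j' : Fin n, i'.val = i.val + 1 ∧ j'.val = j.val + 1 ∧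
    (D.tile i j = .southEast ∧ D'.tile i j = .blank) ∧
    (D.tile i' j' = .blank ∧ D'.tile i' j' = .northWest) ∧
    ((D.tile i j' = .horiz ∧ D'.tile i j' = .southEast) ∨
      (D.tile i j' = .northWest ∧ D'.tile i j' = .vert)) ∧
    ((D.tile i' j = .vert ∧ D'.tile i' j = .southEast) ∨
      (D.tile i' j = .northWest ∧ D'.tile i' j = .horiz)) ∧
    ∀ a b : Fin n, ¬ ((a = i ∨ a = i') ∧ (b = j ∨ b = j')) → D'.tile a b = D.tile a b

/-- `D'` can be obtained from `D` by a sequence of simple droops. -/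
def DroopLE {n : ℕ} : BPD n → BPD n → Prop :=
  Relation.ReflTransGen fun D D' => ∃ i, SimpleDroop i D D'

theorem reflTransGen_antisymm {α : Type*} {r : α → α → Prop} (f : α → ℕ)
    (h : ∀ a b, r a b → f b < f a) {a b : α} (hab : Relation.ReflTransGen r a b)
    (hba : Relation.ReflTransGen r b a) : a = b := by
  have key : ∀ a b, Relation.ReflTransGen r a b → a = b ∨ f b < f a := by
    intro a b hab
    induction hab with
    | refl => exact Or.inl rfl
    | tail _ hr ih =>
      rcases ih with rfl | ih
      · exact Or.inr (h _ _ hr)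
      · exact Or.inr ((h _ _ hr).trans ih)
  rcases key a b hab with h1 | h1
  · exact h1
  · rcases key b a hba with h2 | h2
    · exact h2.symm
    · omega

/-- Auxiliary: the sum of the row numbers of the blank tiles. -/
def BPD.rank {n : ℕ} (D : BPD n) : ℕ :=
  ∑ p : Fin n × Fin n, if D.tile p.1 p.2 = .blank then p.1.val else 0

theorem SimpleDroop.rank_lt {n : ℕ} {i : Fin n} {D D' : BPD n} (h : SimpleDroop i D D') :
    D'.rank < D.rank := by
  obtain ⟨i', j, j', hi, hj, ⟨a1, a2⟩, ⟨b1, b2⟩, hc, hd, he⟩ := h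
  have hii : i ≠ i' := fun h => by rw [h] at hi; omega
  have hjj : j ≠ j' := fun h => by rw [h] at hj; omega
  have hne : (i, j) ≠ (i', j') := fun h => hii (Prod.mk.inj h).1
  let g : BPD n → Fin n × Fin n → ℕ := fun D p => if D.tile p.1 p.2 = .blank then p.1.val else 0
  have split : ∀ D : BPD n, D.rank
      = g D (i, j) + (g D (i', j') + ∑ p ∈ (univ.erase (i, j)).erase (i', j'), g D p) := by
    intro D
    rw [add_sum_erase _ _ (by simp [hne.symm]), add_sum_erase _ _ (mem_univ _)]
    rfl
  have rest : ∑ p ∈ (univ.erase (i, j)).erase (i', j'), g D' p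
      = ∑ p ∈ (univ.erase (i, j)).erase (i', j'), g D p := by
    refine sum_congr rfl fun p hp => ?_
    simp only [mem_erase, ne_eq, mem_univ, and_true] at hp
    obtain ⟨h2, h1⟩ := hp
    obtain ⟨a, b⟩ := p
    by_cases hab : (a = i ∨ a = i') ∧ (b = j ∨ b = j')
    · obtain ⟨rfl | rfl, rfl | rfl⟩ := hab
      · exact absurd rfl h1
      · rcases hc with ⟨c1, c2⟩ | ⟨c1, c2⟩ <;> simp [g, c1, c2]
      · rcases hd with ⟨c1, c2⟩ | ⟨c1, c2⟩ <;> simp [g, c1, c2]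
      · exact absurd rfl h2
    · simp only [g, he a b hab]
  rw [split D, split D', rest]
  simp only [g, a1, a2, b1, b2]
  simp
  omega

/-- `droop(π)`: the bumpless pipe dreams obtained from the Rothe bumpless pipe dream of `π` by
simple droops. -/
def Droop {n : ℕ} (π : Equiv.Perm (Fin n)) : Type :=
  {D : BPD n // DroopLE (rothe π) D}

/-- The order of `droop(π)`: simple droops move up. -/
instance {n : ℕ} (π : Equiv.Perm (Fin n)) : PartialOrder (Droop π) where
  le x y := DroopLE x.1 y.1
  le_refl _ := Relation.ReflTransGen.refl
  le_trans _ _ _ h h' := Relation.ReflTransGen.trans h h'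
  le_antisymm _ _ h h' := Subtype.ext
    (reflTransGen_antisymm BPD.rank (fun _ _ ⟨_, hr⟩ => hr.rank_lt) h h')

/-- The Rothe bumpless pipe dream as an element of `droop(π)`. -/
def Droop.rothe {n : ℕ} (π : Equiv.Perm (Fin n)) : Droop π :=
  ⟨ASMTSSCPP.rothe π, Relation.ReflTransGen.refl⟩

/-! ## Pipe dreams -/

/-- Pipe dreams of size `n`, given by the positions `(row, column)` of the cross tiles, with rows
and columns numbered `1, …, n`; all other tiles are elbow tiles (joining the north edge with the
west edge and the south edge with the east edge). There are no crosses on or below the main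
antidiagonal. -/
@[ext] structure PipeDream (n : ℕ) where
  crosses : Finset (ℕ × ℕ)
  valid : ∀ p ∈ crosses, 1 ≤ p.1 ∧ 1 ≤ p.2 ∧ p.1 + p.2 ≤ n

/-- In row `r`, with labels `v` on the top edges of the tiles: the label of the pipe on the edge
that has exactly `k` columns to its right (no pipe, encoded as `0`, enters from the east border).
The pipes travel to the south and to the west. -/
def PipeDream.rowLabel {n : ℕ} (P : PipeDream n) (r : ℕ) (v : ℕ → ℕ) : ℕ → ℕ
  | 0 => 0
  | k + 1 => if (r, n - k) ∈ P.crosses then PipeDream.rowLabel P r v k else v (n - k)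

/-- The label of the pipe on the bottom edge of the tile `(r,c)`; for `r = 0` this is the edge of
the north border in column `c`, where the pipes are labelled `1, …, n`. -/
def PipeDream.colLabel {n : ℕ} (P : PipeDream n) : ℕ → ℕ → ℕ
  | 0, c => c
  | r + 1, c => if (r + 1, c) ∈ P.crosses then PipeDream.colLabel P r c
      else P.rowLabel (r + 1) (PipeDream.colLabel P r) (n - c)

/-- The label of the pipe entering the tile `(r,c)` from the north. -/
def PipeDream.northLabel {n : ℕ} (P : PipeDream n) (p : ℕ × ℕ) : ℕ :=
  P.colLabel (p.1 - 1) p.2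

/-- The label of the pipe entering the tile `(r,c)` from the east. -/
def PipeDream.eastLabel {n : ℕ} (P : PipeDream n) (p : ℕ × ℕ) : ℕ :=
  P.rowLabel p.1 (P.colLabel (p.1 - 1)) (n - p.2)

/-- The label of the pipe that leaves through the west border in row `r`. -/
def PipeDream.exitLabel {n : ℕ} (P : PipeDream n) (r : ℕ) : ℕ :=
  P.rowLabel r (P.colLabel (r - 1)) n

/-- A pipe dream is reduced if no two pipes cross twice. -/
def PipeDream.IsReduced {n : ℕ} (P : PipeDream n) : Prop :=
  ∀ p ∈ P.crosses, ∀ q ∈ P.crosses,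
    s(P.northLabel p, P.eastLabel p) = s(P.northLabel q, P.eastLabel q) → p = q

/-- `P` has permutation `π`: reading the labels of the pipes on the west border from top to bottom
gives `π(1), …, π(n)`. -/
def PipeDream.HasPerm {n : ℕ} (P : PipeDream n) (π : Equiv.Perm (Fin n)) : Prop :=
  ∀ i : Fin n, P.exitLabel (i.val + 1) = (π i).val + 1

/-- The entry of the Lehmer code of `π` in row `i`. -/
def code {n : ℕ} (π : Equiv.Perm (Fin n)) (i : Fin n) : ℕ :=
  (univ.filter fun k : Fin n => i < k ∧ π k < π i).card

theorem code_le {n : ℕ} (π : Equiv.Perm (Fin n)) (i : Fin n) : i.val + 1 + code π i ≤ n := by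
  have h : code π i ≤ (Finset.Ioi i).card := by
    refine card_le_card fun k hk => ?_
    simp only [mem_filter, mem_univ, true_and] at hk
    simpa using hk.1
  rw [Fin.card_Ioi] at h
  omega

/-- The bottom pipe dream of `π`: all crosses are left-justified, with row lengths given by the
Lehmer code. -/
def bottomPD {n : ℕ} (π : Equiv.Perm (Fin n)) : PipeDream n where
  crosses := univ.biUnion fun i : Fin n =>
    (Finset.Icc 1 (code π i)).image fun c => (i.val + 1, c)
  valid p hp := by
    simp only [mem_biUnion, mem_univ, true_and, mem_image, mem_Icc] at hp
    obtain ⟨i, c, ⟨h1, h2⟩, rfl⟩ := hp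
    have := code_le π i
    exact ⟨by simp, h1, by simp only; omega⟩

/-- `P'` is obtained from `P` by a simple slide in a `2 × 2` square with upper row `r`: the cross
in the south-west corner of a square whose other tiles are elbows moves to the north-east
corner. -/
def SimpleSlide {n : ℕ} (r : ℕ) (P P' : PipeDream n) : Prop :=
  ∃ c : ℕ, (r + 1, c) ∈ P.crosses ∧ (r + 1, c + 1) ∉ P.crosses ∧ (r, c) ∉ P.crosses ∧
    (r, c + 1) ∉ P.crosses ∧ P'.crosses = insert (r, c + 1) (P.crosses.erase (r + 1, c))

/-- `P'` can be obtained from `P` by a sequence of simple slides. -/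
def SlideLE {n : ℕ} : PipeDream n → PipeDream n → Prop :=
  Relation.ReflTransGen fun P P' => ∃ r, SimpleSlide r P P'

/-- Auxiliary: the sum of the row numbers of the crosses. -/
def PipeDream.rank {n : ℕ} (P : PipeDream n) : ℕ := ∑ p ∈ P.crosses, p.1

theorem SimpleSlide.rank_lt {n : ℕ} {r : ℕ} {P P' : PipeDream n} (h : SimpleSlide r P P') :
    P'.rank < P.rank := by
  obtain ⟨c, h1, _, _, h4, h5⟩ := h
  unfold PipeDream.rank
  rw [h5, sum_insert (fun h => h4 (mem_of_mem_erase h)), ← add_sum_erase _ _ h1]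
  simp

/-- `slide(π)`: the pipe dreams obtained from the bottom pipe dream of `π` by simple slides. -/
def Slide {n : ℕ} (π : Equiv.Perm (Fin n)) : Type :=
  {P : PipeDream n // SlideLE (bottomPD π) P}

/-- The order of `slide(π)`: simple slides move up. -/
instance {n : ℕ} (π : Equiv.Perm (Fin n)) : PartialOrder (Slide π) where
  le x y := SlideLE x.1 y.1
  le_refl _ := Relation.ReflTransGen.refl
  le_trans _ _ _ h h' := Relation.ReflTransGen.trans h h'
  le_antisymm _ _ h h' := Subtype.ext
    (reflTransGen_antisymm PipeDream.rank (fun _ _ ⟨_, hr⟩ => hr.rank_lt) h h')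

/-- The bottom pipe dream as an element of `slide(π)`. -/
def Slide.bottom {n : ℕ} (π : Equiv.Perm (Fin n)) : Slide π :=
  ⟨bottomPD π, Relation.ReflTransGen.refl⟩

/-! ## Totally symmetric self-complementary plane partitions -/

/-- Plane partitions; `part i j` is the entry in row `i + 1` and column `j + 1`. -/
@[ext] structure PlanePartition where
  part : ℕ → ℕ → ℕ
  anti : ∀ i i' j j', i ≤ i' → j ≤ j' → part i' j' ≤ part i j

/-- `t` is contained in the `a × b × c` box. -/
def PlanePartition.InBox (t : PlanePartition) (a b c : ℕ) : Prop :=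
  (∀ i j, a ≤ i ∨ b ≤ j → t.part i j = 0) ∧ ∀ i j, t.part i j ≤ c

/-- The lattice point `(i + 1, j + 1, k + 1)` belongs to `t`. -/
def PlanePartition.Mem (t : PlanePartition) (i j k : ℕ) : Prop := k < t.part i j

def PlanePartition.IsSymmetric (t : PlanePartition) : Prop :=
  ∀ i j, t.part i j = t.part j i

def PlanePartition.IsCyclicallySymmetric (t : PlanePartition) : Prop :=
  ∀ i j k, t.Mem i j k → t.Mem j k i

/-- `t` equals its complement in the `a × b × c` box. -/
def PlanePartition.IsSelfComplementary (t : PlanePartition) (a b c : ℕ) : Prop :=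
  ∀ i j, i < a → j < b → t.part i j = c - t.part (a - 1 - i) (b - 1 - j)

/-- The totally symmetric self-complementary plane partitions in the `2n × 2n × 2n` box. -/
@[ext] structure TSSCPP (n : ℕ) extends PlanePartition where
  inBox : toPlanePartition.InBox (2 * n) (2 * n) (2 * n)
  symm : toPlanePartition.IsSymmetric
  cyclic : toPlanePartition.IsCyclicallySymmetric
  selfCompl : toPlanePartition.IsSelfComplementary (2 * n) (2 * n) (2 * n)

/-- A TSSCPP `T` is determined by its fundamental domain: the entries `T_{n+p,n+q}` with
`1 ≤ p ≤ q ≤ n - 1`, which satisfy `T_{n+p,n+q} ≤ n - q`. For `1 ≤ l ≤ n - 1` the cells `(p,q)`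
with `T_{n+p,n+q} ≥ l` form a shifted shape; `depth T l d` is the number of its cells on the
diagonal `q - p = d`, i.e. the row at which the boundary path of the shape meets the `d`-th
diagonal. -/
def TSSCPP.depth {n : ℕ} (T : TSSCPP n) (l d : ℕ) : ℕ :=
  ((Finset.range n).filter fun p => l ≤ T.part (n + p) (n + p + d)).card

/-- The index set `1 ≤ i ≤ n - 1`, `n - i ≤ j ≤ n - 1` of boolean triangles of order `n`. -/
def triangle (n : ℕ) : Finset (ℕ × ℕ) :=
  (Finset.Icc 1 (n - 1) ×ˢ Finset.Icc 1 (n - 1)).filter fun p => n ≤ p.1 + p.2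

/-- The positions `(i,j)` of the entries `b_{i,j} = 1` in the boolean triangle of `T`. The boundary
paths of the shapes at the levels `l = 1, …, n - 1` form a nest of non-intersecting lattice paths;
the path at level `l` runs from the diagonal `d = n - l` to the diagonal `d = 0`, and
`b_{i,n-l}` records its step from the diagonal `n - i` to the diagonal `n - 1 - i`: it is `1` if
this step is a step to the left (the depth stays the same), and `0` if it is a step down (the depth
grows by one). -/
def TSSCPP.ones {n : ℕ} (T : TSSCPP n) : Finset (ℕ × ℕ) :=
  (triangle n).filter fun p => T.depth (n - p.2) (n - 1 - p.1) = T.depth (n - p.2) (n - p.1)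

/-- The weight of a TSSCPP. -/
noncomputable def TSSCPP.wt {n : ℕ} (T : TSSCPP n) : MvPolynomial ℕ ℤ :=
  ∏ p ∈ T.ones, MvPolynomial.X (n - p.1)

/-- The pipe dream of a TSSCPP: the boolean triangle is flipped vertically and left-justified,
`y_{r,c} = b_{n-r,r+c-1}`, and there is a cross at `(r,c)` if and only if `y_{r,c} = 1`. -/
def TSSCPP.pipeDream {n : ℕ} (T : TSSCPP n) : PipeDream n where
  crosses := (Finset.Icc 1 (n - 1) ×ˢ Finset.Icc 1 (n - 1)).filter fun p =>
    p.1 + p.2 ≤ n ∧ (n - p.1, p.1 + p.2 - 1) ∈ T.ones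
  valid p hp := by
    simp only [mem_filter, mem_product, mem_Icc] at hp
    exact ⟨hp.1.1.1, hp.1.2.1, hp.2.1⟩

/-- `TSSCPP^red(π)`: the TSSCPPs whose pipe dream is reduced and has permutation `π`. -/
def TSSCPPRed {n : ℕ} (π : Equiv.Perm (Fin n)) : Type :=
  {T : TSSCPP n // T.pipeDream.IsReduced ∧ T.pipeDream.HasPerm π}

end ASMTSSCPP

/-!
Let `π` be inverse-Grassmannian. Then there is a `k` such that the values `1, …, k` ("small") occur
in increasing order in `π`, and so do the values `k + 1, …, n` ("large"); see
`IsInverseGrassmannian.exists_isShuffle`. Hence two pipes with small labels do not cross, and neither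
do two pipes with large labels, neither in a bumpless pipe dream with permutation `π` nor in a
reduced pipe dream with permutation `π`. In both cases this is proved by following the word of the
labels along a lattice path which sweeps over the grid: passing a crossing exchanges two adjacent
letters (`BPD.isSorted_word_of_succ`, `PipeDream.word_step`).

*Bumpless pipe dreams.* Large pipes start to the right of the first `k` columns, so there are no
crossings in these columns. In the other columns the row-by-row analysis `BPD.packed_row` shows that
the small pipes are horizontal and that the large pipes go up and turn right once; so there are
neither blank tiles nor north-west elbows. These facts are recorded in `BPD.IsSplit`. From a
north-west elbow one walks diagonally up along north-west elbows to a blank tile, where a simple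
droop can be undone (`BPD.IsSplit.exists_undroop`); droops do not affect the permutation. Repeating
this, one arrives at a bumpless pipe dream without north-west elbows, which is the Rothe one. Hence
the bumpless pipe dreams with permutation `π` are those in `droop(π)` (`IsShuffle.droopLE`).

*Pipe dreams.* In a reduced pipe dream with permutation `π`, small pipes pass the crosses vertically
and large pipes horizontally (`PipeDream.label_of_mem_crosses`). If a cross has an elbow tile to its
left, the tile below that elbow tile is therefore not a cross, and below such a pair a simple slide
can be undone (`PipeDream.exists_unslide`). Repeating this, one arrives at a left-justified pipe
dream; its row lengths are forced to be the Lehmer code of `π`, so it is the bottom one. Hence the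
reduced pipe dreams with permutation `π` are those in `slide(π)` (`IsShuffle.slideLE`).

*TSSCPPs.* A TSSCPP is determined by its depths, hence by its pipe dream
(`TSSCPP.pipeDream_injective`). Conversely, a pipe dream comes from a TSSCPP if the numbers of its
elbow tiles on consecutive antidiagonals satisfy the inequalities `PipeDream.IsNest` expressing that
the lattice paths do not intersect; these hold for left-justified pipe dreams and are preserved by
slides. So every element of `slide(π)` comes from a TSSCPP.

*The bijection.* A simple droop moves a blank tile one step to the north-west, a simple slide moves a
cross one step to the north-east. Reflecting the first `k` columns turns the blank tiles of the Rothe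
bumpless pipe dream into the crosses of the bottom pipe dream (`IsShuffle.corresponds_rothe`), and
matches the moves (`Corresponds.exists_slide`, `Corresponds.exists_droop`). As rows are preserved, so
are weights.
-/

namespace ASMTSSCPP

open Finset

/-! ### Inverse-Grassmannian permutations as shuffles -/

/-- `π` is a shuffle of the words `1 … k` and `k+1 … n`: the values below `k` (counted from `0`)
occur in increasing order, and so do the others. -/
def IsShuffle {n : ℕ} (π : Equiv.Perm (Fin n)) (k : ℕ) : Prop :=
  ∀ i j : Fin n, i < j → ((π i).val < k ↔ (π j).val < k) → π i < π j

theorem IsInverseGrassmannian.exists_isShuffle {n : ℕ} {π : Equiv.Perm (Fin n)}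
    (hπ : IsInverseGrassmannian π) : ∃ k ≤ n, IsShuffle π k := by
  obtain ⟨k, hk, hasc⟩ : ∃ k ≤ n, ∀ a (h : a + 1 < n), a + 1 ≠ k →
      π⁻¹ ⟨a, by omega⟩ < π⁻¹ ⟨a + 1, h⟩ := by
    have asc : ∀ a (h : a + 1 < n), ¬ IsDescent π⁻¹ ⟨a, by omega⟩ →
        π⁻¹ ⟨a, by omega⟩ < π⁻¹ ⟨a + 1, h⟩ := by
      intro a h hd
      refine lt_of_le_of_ne (not_lt.1 fun hlt => hd ⟨h, hlt⟩) fun he => ?_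
      have := congrArg Fin.val (π⁻¹.injective he)
      simp at this
    by_cases hd : ∃ d, IsDescent π⁻¹ d
    · obtain ⟨d, hd⟩ := hd
      refine ⟨d.val + 1, d.isLt, fun a h hne => asc a h fun ha => hne ?_⟩
      rw [← hπ _ _ ha hd]
    · exact ⟨0, by omega, fun a h _ => asc a h fun ha => hd ⟨_, ha⟩⟩
  have mono : ∀ d a (h : a + d + 1 < n), (a < k ↔ a + d + 1 < k) →
      π⁻¹ ⟨a, by omega⟩ < π⁻¹ ⟨a + d + 1, h⟩ := by
    intro d
    induction d with
    | zero => exact fun a h hk => hasc a h (by omega)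
    | succ d ih =>
      exact fun a h hk => (ih a (by omega) (by omega)).trans
        (hasc (a + d + 1) (by omega) (by omega))
  refine ⟨k, hk, fun i j hij hc => ?_⟩
  by_contra hlt
  have hne : (π i).val ≠ (π j).val := fun h => hij.ne (π.injective (Fin.ext h))
  have hlt' : (π j).val < (π i).val := by
    have : (π j).val ≤ (π i).val := not_lt.1 hlt
    omega
  obtain ⟨d, hd⟩ : ∃ d, (π i).val = (π j).val + d + 1 := ⟨(π i).val - (π j).val - 1, by omega⟩
  have h := mono d (π j).val (by rw [← hd]; exact (π i).isLt) (by rw [← hd]; exact hc.symm)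
  have hi : π⁻¹ (π i) = i := π.symm_apply_apply i
  have hj : π⁻¹ (π j) = j := π.symm_apply_apply j
  simp only [← hd, Fin.eta, hi, hj] at h
  exact absurd h (not_lt.2 hij.le)

/-! ### Pipe dreams: invariance under slides -/

namespace PipeDream

theorem rowLabel_congr {n : ℕ} {P P' : PipeDream n} {r : ℕ} {v v' : ℕ → ℕ} {k : ℕ}
    (h : ∀ c, n < c + k → ((r, c) ∈ P.crosses ↔ (r, c) ∈ P'.crosses))
    (hv : ∀ c, n < c + k → c ≤ n → v c = v' c) :
    ∀ l ≤ k, P.rowLabel r v l = P'.rowLabel r v' l := by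
  intro l
  induction l with
  | zero => intro _; rfl
  | succ l ih =>
    intro hl
    simp only [rowLabel]
    rw [ih (by omega), hv (n - l) (by omega) (by omega)]
    simp only [h (n - l) (by omega)]

theorem colLabel_succ {n : ℕ} (P : PipeDream n) (r c : ℕ) : P.colLabel (r + 1) c =
    if (r + 1, c) ∈ P.crosses then P.colLabel r c
      else P.rowLabel (r + 1) (P.colLabel r) (n - c) := rfl

theorem rowLabel_sub {n : ℕ} (P : PipeDream n) (r : ℕ) (v : ℕ → ℕ) {c : ℕ} (h1 : 1 ≤ c)
    (hc : c ≤ n) : P.rowLabel r v (n - (c - 1)) =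
      if (r, c) ∈ P.crosses then P.rowLabel r v (n - c) else v c := by
  obtain ⟨c, rfl⟩ : ∃ d, c = d + 1 := ⟨c - 1, by omega⟩
  have h : n - (c + 1 - 1) = (n - (c + 1)) + 1 := by omega
  rw [h, rowLabel]
  have : n - (n - (c + 1)) = c + 1 := by omega
  rw [this]

/-- Once the labels on a row agree at some vertical edge, they agree to the west of it. -/
theorem rowLabel_congr_from {n : ℕ} {P P' : PipeDream n} {r : ℕ} {v v' : ℕ → ℕ} {k : ℕ}
    (h0 : P.rowLabel r v k = P'.rowLabel r v' k)
    (h : ∀ c, c + k ≤ n → ((r, c) ∈ P.crosses ↔ (r, c) ∈ P'.crosses))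
    (hv : ∀ c, c + k ≤ n → v c = v' c) :
    ∀ l, k ≤ l → l ≤ n → P.rowLabel r v l = P'.rowLabel r v' l := by
  intro l hl
  induction l, hl using Nat.le_induction with
  | base => exact fun _ => h0
  | succ l hl ih =>
    intro hn
    simp only [rowLabel]
    rw [ih (by omega), hv (n - l) (by omega)]
    simp only [h (n - l) (by omega)]

end PipeDream

/-- A simple slide only changes the labels on the four inner edges of its square, and the moved
cross keeps its pair of pipes. -/
theorem SimpleSlide.labels {n r : ℕ} {P P' : PipeDream n} (h : SimpleSlide r P P') :
    (∀ m, P.exitLabel m = P'.exitLabel m) ∧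
    ∃ c, (r + 1, c) ∈ P.crosses ∧ (r, c + 1) ∉ P.crosses ∧
      P'.crosses = insert (r, c + 1) (P.crosses.erase (r + 1, c)) ∧
      P'.northLabel (r, c + 1) = P.northLabel (r + 1, c) ∧
      P'.eastLabel (r, c + 1) = P.eastLabel (r + 1, c) ∧
      ∀ q ∈ P.crosses, q ≠ (r + 1, c) →
        P'.northLabel q = P.northLabel q ∧ P'.eastLabel q = P.eastLabel q := by
  obtain ⟨c, h1, h2, h3, h4, h5⟩ := h
  have hmem : ∀ q, q ∈ P'.crosses ↔ q = (r, c + 1) ∨ (q ≠ (r + 1, c) ∧ q ∈ P.crosses) := by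
    intro q; rw [h5, mem_insert, mem_erase]
  have hv1 := P.valid _ h1
  have hv2 := P'.valid (r, c + 1) ((hmem _).2 (Or.inl rfl))
  simp only at hv1 hv2
  obtain ⟨s, rfl⟩ : ∃ s, r = s + 1 := ⟨r - 1, by omega⟩
  have hrow : ∀ m, m ≠ s + 1 → m ≠ s + 1 + 1 → ∀ d, ((m, d) ∈ P.crosses ↔ (m, d) ∈ P'.crosses) := by
    intro m hm1 hm2 d
    rw [hmem]; simp [hm1, hm2]
  have hcol : ∀ m d, d ≠ c → d ≠ c + 1 → ((m, d) ∈ P.crosses ↔ (m, d) ∈ P'.crosses) := by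
    intro m d hm1 hm2
    rw [hmem]; simp [hm1, hm2]
  have m1 : (s + 1, c + 1) ∈ P'.crosses := by rw [hmem]; simp
  have m2 : (s + 1, c) ∉ P'.crosses := by rw [hmem]; simp [h3]
  have m3 : (s + 1 + 1, c) ∉ P'.crosses := by rw [hmem]; simp
  have m4 : (s + 1 + 1, c + 1) ∉ P'.crosses := by rw [hmem]; simp [h2]
  -- rows above the square
  have up : ∀ m ≤ s, P.colLabel m = P'.colLabel m := by
    intro m
    induction m with
    | zero => intro _; rfl
    | succ m ih =>
      intro hm
      funext d
      simp only [PipeDream.colLabel]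
      rw [ih (by omega)]
      rw [PipeDream.rowLabel_congr (k := n - d) (fun x _ => hrow (m + 1) (by omega) (by omega) x)
        (fun _ _ _ => rfl) _ le_rfl]
      simp only [hrow (m + 1) (by omega) (by omega) d]
  -- the upper row of the square
  set v := P.colLabel s with hv
  have hv' : P'.colLabel s = v := (up s le_rfl).symm
  have a0 : ∀ l ≤ n - (c + 1), P.rowLabel (s + 1) v l = P'.rowLabel (s + 1) v l := by
    refine PipeDream.rowLabel_congr (fun d hd => hcol _ d (by omega) (by omega)) (fun _ _ _ => rfl)
  have a1 : P.rowLabel (s + 1) v (n - c) = v (c + 1) := by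
    have := P.rowLabel_sub (s + 1) v (c := c + 1) (by omega) (by omega)
    simpa [h4] using this
  have a1' : P'.rowLabel (s + 1) v (n - c) = P.rowLabel (s + 1) v (n - (c + 1)) := by
    have := P'.rowLabel_sub (s + 1) v (c := c + 1) (by omega) (by omega)
    simpa [m1, a0 _ le_rfl] using this
  have a2 : ∀ l, n - (c - 1) ≤ l → l ≤ n → P.rowLabel (s + 1) v l = P'.rowLabel (s + 1) v l := by
    refine PipeDream.rowLabel_congr_from ?_ (fun d hd => hcol _ d (by omega) (by omega))
      (fun _ _ => rfl)
    rw [P.rowLabel_sub (s + 1) v (c := c) (by omega) (by omega),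
      P'.rowLabel_sub (s + 1) v (c := c) (by omega) (by omega), if_neg h3, if_neg m2]
  have a3 : ∀ l, l ≠ n - c → l ≤ n → P.rowLabel (s + 1) v l = P'.rowLabel (s + 1) v l := by
    intro l hl hn
    rcases Nat.lt_or_ge l (n - c) with h | h
    · exact a0 l (by omega)
    · exact a2 l (by omega) hn
  set w := P.colLabel (s + 1) with hw
  set w' := P'.colLabel (s + 1) with hw'
  have w1 : ∀ d, d ≠ c → d ≠ c + 1 → w d = w' d := by
    intro d hd1 hd2
    simp only [hw, hw', PipeDream.colLabel, hv', ← hv]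
    rw [a3 (n - d) (by omega) (by omega)]
    simp only [hcol (s + 1) d hd1 hd2]
  have w2 : w c = v (c + 1) ∧ w' c = P.rowLabel (s + 1) v (n - (c + 1)) := by
    simp only [hw, hw', PipeDream.colLabel, hv', ← hv, if_neg h3, if_neg m2]
    exact ⟨a1, a1'⟩
  have w3 : w (c + 1) = P.rowLabel (s + 1) v (n - (c + 1)) ∧ w' (c + 1) = v (c + 1) := by
    simp only [hw, hw', PipeDream.colLabel, hv', ← hv, if_neg h4, if_pos m1, and_self]
  -- the lower row of the square
  have b0 : ∀ l ≤ n - (c + 1), P.rowLabel (s + 1 + 1) w l = P'.rowLabel (s + 1 + 1) w' l := by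
    refine PipeDream.rowLabel_congr (fun d hd => hcol _ d (by omega) (by omega))
      (fun d _ _ => w1 d (by omega) (by omega))
  have b1 : P.rowLabel (s + 1 + 1) w (n - c) = w (c + 1) := by
    have := P.rowLabel_sub (s + 1 + 1) w (c := c + 1) (by omega) (by omega)
    simpa [h2] using this
  have b1' : P'.rowLabel (s + 1 + 1) w' (n - c) = w' (c + 1) := by
    have := P'.rowLabel_sub (s + 1 + 1) w' (c := c + 1) (by omega) (by omega)
    simpa [m4] using this
  have b2 : ∀ l, n - (c - 1) ≤ l → l ≤ n →
      P.rowLabel (s + 1 + 1) w l = P'.rowLabel (s + 1 + 1) w' l := by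
    refine PipeDream.rowLabel_congr_from ?_ (fun d hd => hcol _ d (by omega) (by omega))
      (fun d _ => w1 d (by omega) (by omega))
    rw [P.rowLabel_sub (s + 1 + 1) w (c := c) (by omega) (by omega),
      P'.rowLabel_sub (s + 1 + 1) w' (c := c) (by omega) (by omega), if_pos h1, if_neg m3,
      b1, w3.1, w2.2]
  have b3 : ∀ l, l ≠ n - c → l ≤ n →
      P.rowLabel (s + 1 + 1) w l = P'.rowLabel (s + 1 + 1) w' l := by
    intro l hl hn
    rcases Nat.lt_or_ge l (n - c) with h | h
    · exact b0 l (by omega)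
    · exact b2 l (by omega) hn
  have down0 : P.colLabel (s + 1 + 1) = P'.colLabel (s + 1 + 1) := by
    funext d
    rw [P.colLabel_succ (s + 1), P'.colLabel_succ (s + 1), ← hw, ← hw']
    by_cases hd : d = c
    · subst hd
      rw [if_pos h1, if_neg m3, b1', w2.1, w3.2]
    · rw [b3 (n - d) (by omega) (by omega)]
      by_cases hd' : d = c + 1
      · subst hd'
        rw [if_neg h2, if_neg m4]
      · rw [w1 d hd hd']
        simp only [hcol (s + 1 + 1) d hd hd']
  have down : ∀ m, s + 1 + 1 ≤ m → P.colLabel m = P'.colLabel m := by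
    intro m hm
    induction m, hm using Nat.le_induction with
    | base => exact down0
    | succ m hm ih =>
      funext d
      simp only [PipeDream.colLabel]
      rw [ih]
      rw [PipeDream.rowLabel_congr (k := n - d) (fun x _ => hrow (m + 1) (by omega) (by omega) x)
        (fun _ _ _ => rfl) _ le_rfl]
      simp only [hrow (m + 1) (by omega) (by omega) d]
  have off : ∀ m, m ≠ s + 1 → P.colLabel m = P'.colLabel m := by
    intro m hm
    rcases Nat.lt_or_ge m (s + 1) with h | h
    · exact up m (by omega)
    · exact down m (by omega)
  have rows : ∀ m, m ≠ s + 1 → m ≠ s + 1 + 1 → ∀ l,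
      P.rowLabel m (P.colLabel (m - 1)) l = P'.rowLabel m (P'.colLabel (m - 1)) l := by
    intro m hm1 hm2 l
    rw [off (m - 1) (by omega)]
    exact PipeDream.rowLabel_congr (k := l) (fun x _ => hrow m hm1 hm2 x)
      (fun _ _ _ => rfl) _ le_rfl
  refine ⟨fun m => ?_, c, h1, h4, h5, ?_, ?_, ?_⟩
  · unfold PipeDream.exitLabel
    by_cases hm1 : m = s + 1
    · subst hm1
      simp only [Nat.add_sub_cancel, hv', ← hv]
      exact a3 n (by omega) le_rfl
    by_cases hm2 : m = s + 1 + 1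
    · subst hm2
      simp only [Nat.add_sub_cancel]
      exact b3 n (by omega) le_rfl
    exact rows m hm1 hm2 n
  · simp only [PipeDream.northLabel, Nat.add_sub_cancel, hv', ← hw]
    exact w2.1.symm
  · simp only [PipeDream.eastLabel, Nat.add_sub_cancel, hv', ← hw]
    rw [← a0 _ le_rfl, b1, w3.1]
  · rintro ⟨m, d⟩ hq hne
    have hvq := P.valid _ hq
    simp only at hvq
    have hd : (m = s + 1 ∨ m = s + 1 + 1) → d ≠ c ∧ d ≠ c + 1 := by
      rintro (rfl | rfl)
      · refine ⟨?_, ?_⟩ <;> rintro rfl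
        · exact h3 hq
        · exact h4 hq
      · refine ⟨?_, ?_⟩ <;> rintro rfl
        · exact hne rfl
        · exact h2 hq
    simp only [PipeDream.northLabel, PipeDream.eastLabel]
    by_cases hm1 : m = s + 1
    · subst hm1
      simp only [Nat.add_sub_cancel, hv', ← hv, true_and]
      exact (a3 _ (by have := hd (Or.inl rfl); omega) (by omega)).symm
    by_cases hm2 : m = s + 1 + 1
    · subst hm2
      have := hd (Or.inr rfl)
      simp only [Nat.add_sub_cancel]
      exact ⟨(w1 d this.1 this.2).symm, (b3 _ (by omega) (by omega)).symm⟩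
    exact ⟨by rw [off (m - 1) (by omega)], (rows m hm1 hm2 _).symm⟩

theorem SimpleSlide.hasPerm_iff {n r : ℕ} {P P' : PipeDream n} (h : SimpleSlide r P P')
    (π : Equiv.Perm (Fin n)) : P.HasPerm π ↔ P'.HasPerm π := by
  simp only [PipeDream.HasPerm, h.labels.1]

theorem SimpleSlide.isReduced_iff {n r : ℕ} {P P' : PipeDream n} (h : SimpleSlide r P P') :
    P.IsReduced ↔ P'.IsReduced := by
  obtain ⟨-, c, h1, h2, h3, hn, he, hq⟩ := h.labels
  have hmem : ∀ q, q ∈ P'.crosses ↔ q = (r, c + 1) ∨ (q ≠ (r + 1, c) ∧ q ∈ P.crosses) := by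
    intro q; rw [h3, mem_insert, mem_erase]
  have hne : ∀ q ∈ P.crosses, q ≠ (r, c + 1) := fun q hq h => h2 (h ▸ hq)
  constructor
  · intro hr p hp q hq' hpq
    rw [hmem] at hp hq'
    rcases hp with rfl | ⟨hp1, hp2⟩ <;> rcases hq' with rfl | ⟨hq1, hq2⟩
    · rfl
    · rw [hn, he, (hq q hq2 hq1).1, (hq q hq2 hq1).2] at hpq
      exact absurd (hr _ h1 _ hq2 hpq).symm hq1
    · rw [hn, he, (hq p hp2 hp1).1, (hq p hp2 hp1).2] at hpq
      exact absurd (hr _ hp2 _ h1 hpq) hp1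
    · rw [(hq p hp2 hp1).1, (hq p hp2 hp1).2, (hq q hq2 hq1).1, (hq q hq2 hq1).2] at hpq
      exact hr _ hp2 _ hq2 hpq
  · intro hr p hp q hq' hpq
    by_cases hp1 : p = (r + 1, c) <;> by_cases hq1 : q = (r + 1, c)
    · rw [hp1, hq1]
    · rw [hp1, ← hn, ← he, ← (hq q hq' hq1).1, ← (hq q hq' hq1).2] at hpq
      exact absurd (hr _ ((hmem _).2 (Or.inl rfl)) _ ((hmem _).2 (Or.inr ⟨hq1, hq'⟩)) hpq).symm
        (hne q hq')
    · rw [hq1, ← hn, ← he, ← (hq p hp hp1).1, ← (hq p hp hp1).2] at hpq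
      exact absurd (hr _ ((hmem _).2 (Or.inr ⟨hp1, hp⟩)) _ ((hmem _).2 (Or.inl rfl)) hpq)
        (hne p hp)
    · rw [← (hq p hp hp1).1, ← (hq p hp hp1).2, ← (hq q hq' hq1).1, ← (hq q hq' hq1).2] at hpq
      exact hr _ ((hmem _).2 (Or.inr ⟨hp1, hp⟩)) _ ((hmem _).2 (Or.inr ⟨hq1, hq'⟩)) hpq

/-! ### Left-justified pipe dreams -/

namespace PipeDream

/-- `P` is left-justified, with `l r` crosses in row `r`. -/
def IsJustified {n : ℕ} (P : PipeDream n) (l : ℕ → ℕ) : Prop :=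
  ∀ r c, (r, c) ∈ P.crosses ↔ 1 ≤ c ∧ c ≤ l r

theorem exists_isJustified {n : ℕ} (P : PipeDream n)
    (h : ∀ r c, 1 ≤ c → (r, c + 1) ∈ P.crosses → (r, c) ∈ P.crosses) :
    ∃ l, P.IsJustified l := by
  refine ⟨fun r => Nat.findGreatest (fun c => (r, c) ∈ P.crosses) n, fun r c => ⟨fun hc => ?_, ?_⟩⟩
  · have := P.valid _ hc
    simp only at this
    exact ⟨this.2.1, Nat.le_findGreatest (by omega) hc⟩
  · rintro ⟨h1, h2⟩
    replace h2 : c ≤ Nat.findGreatest (fun c => (r, c) ∈ P.crosses) n := h2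
    have h0 : (r, Nat.findGreatest (fun c => (r, c) ∈ P.crosses) n) ∈ P.crosses :=
      Nat.findGreatest_of_ne_zero rfl (Nat.lt_of_lt_of_le h1 h2).ne'
    obtain ⟨d, hd⟩ : ∃ d, Nat.findGreatest (fun c => (r, c) ∈ P.crosses) n = c + d :=
      ⟨_, (Nat.add_sub_cancel' h2).symm⟩
    rw [hd] at h0
    clear hd h2
    induction d with
    | zero => exact h0
    | succ d ih => exact ih (h r (c + d) (by omega) h0)

variable {n : ℕ} {P : PipeDream n} {l : ℕ → ℕ}

theorem IsJustified.add_le (h : P.IsJustified l) {r : ℕ} (hr : r ≤ n) : r + l r ≤ n := by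
  rcases Nat.eq_zero_or_pos (l r) with h0 | h0
  · omega
  · exact (P.valid _ ((h r (l r)).2 ⟨h0, le_rfl⟩)).2.2

theorem IsJustified.rowLabel_of_le (h : P.IsJustified l) {r : ℕ} (v : ℕ → ℕ) {c : ℕ}
    (hc : l r ≤ c) (hn : c < n) : P.rowLabel r v (n - c) = v (c + 1) := by
  have := P.rowLabel_sub r v (c := c + 1) (by omega) (by omega)
  rwa [if_neg (by rw [h]; omega)] at this

theorem IsJustified.rowLabel_of_ge (h : P.IsJustified l) {r : ℕ} (v : ℕ → ℕ) (hl : l r < n) :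
    ∀ c ≤ l r, P.rowLabel r v (n - c) = v (l r + 1) := by
  intro c hc
  obtain ⟨d, hd⟩ : ∃ d, c = l r - d := ⟨l r - c, by omega⟩
  subst hd
  clear hc
  induction d with
  | zero => exact h.rowLabel_of_le v le_rfl hl
  | succ d ih =>
    rcases Nat.lt_or_ge d (l r) with hd | hd
    · have := P.rowLabel_sub r v (c := l r - d) (by omega) (by omega)
      rw [if_pos ((h _ _).2 ⟨by omega, by omega⟩), ih] at this
      exact this
    · have e : l r - (d + 1) = l r - d := by omega
      rw [e, ih]

theorem IsJustified.exitLabel_succ (h : P.IsJustified l) {m : ℕ} (hm : m < n) :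
    P.exitLabel (m + 1) = P.colLabel m (l (m + 1) + 1) := by
  have := h.add_le (r := m + 1) hm
  exact h.rowLabel_of_ge (r := m + 1) (P.colLabel m) (by omega) 0 (by omega)

theorem IsJustified.colLabel_succ (h : P.IsJustified l) {m c : ℕ} (h1 : 1 ≤ c) (hc : c < n) :
    P.colLabel (m + 1) c = P.colLabel m (if c ≤ l (m + 1) then c else c + 1) := by
  rw [PipeDream.colLabel_succ]
  by_cases hcl : c ≤ l (m + 1)
  · rw [if_pos ((h _ _).2 ⟨h1, hcl⟩), if_pos hcl]
  · rw [if_neg (by rw [h]; omega), if_neg hcl]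
    exact h.rowLabel_of_le _ (by omega) hc

theorem IsJustified.colLabel_lt (h : P.IsJustified l) : ∀ m c d, 1 ≤ c → c < d → d + m ≤ n →
    P.colLabel m c < P.colLabel m d := by
  intro m
  induction m with
  | zero => intro c d _ hcd _; exact hcd
  | succ m ih =>
    intro c d h1 hcd hd
    rw [h.colLabel_succ h1 (by omega), h.colLabel_succ (by omega) (by omega)]
    apply ih
    · split_ifs <;> omega
    · split_ifs <;> omega
    · split_ifs <;> omega

theorem IsJustified.colLabel_inj (h : P.IsJustified l) {m c d : ℕ} (hc : 1 ≤ c) (hd : 1 ≤ d)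
    (hcn : c + m ≤ n) (hdn : d + m ≤ n) (he : P.colLabel m c = P.colLabel m d) : c = d := by
  rcases lt_trichotomy c d with hl | hl | hl
  · exact absurd he (h.colLabel_lt m c d hc hl hdn).ne
  · exact hl
  · exact absurd he.symm (h.colLabel_lt m d c hd hl hcn).ne

/-- The labels entering row `m + 1` (in the columns where there is a pipe) are those which have not
left through the first `m` rows. -/
theorem IsJustified.image_colLabel (h : P.IsJustified l) (π : Equiv.Perm (Fin n)) :
    ∀ m ≤ n, (∀ i : Fin n, i.val < m → P.exitLabel (i.val + 1) = (π i).val + 1) →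
      ∀ x, (∃ c, 1 ≤ c ∧ c + m ≤ n ∧ P.colLabel m c = x) ↔
        ∃ i : Fin n, m ≤ i.val ∧ (π i).val + 1 = x := by
  intro m
  induction m with
  | zero =>
    intro _ _ x
    constructor
    · rintro ⟨c, h1, hc, rfl⟩
      refine ⟨π.symm ⟨c - 1, by omega⟩, Nat.zero_le _, ?_⟩
      simp only [Equiv.apply_symm_apply]
      change c - 1 + 1 = c
      omega
    · rintro ⟨i, -, rfl⟩
      exact ⟨(π i).val + 1, by omega, (π i).isLt, rfl⟩
  | succ m ih =>
    intro hm hex x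
    have ih := ih (by omega) (fun i hi => hex i (by omega))
    have hl := h.add_le hm
    have hexit := hex ⟨m, hm⟩ (Nat.lt_succ_self m)
    simp only at hexit
    rw [h.exitLabel_succ hm] at hexit
    constructor
    · rintro ⟨c, h1, hc, rfl⟩
      have hne : (if c ≤ l (m + 1) then c else c + 1) ≠ l (m + 1) + 1 := by split_ifs <;> omega
      have hb : 1 ≤ (if c ≤ l (m + 1) then c else c + 1) ∧
          (if c ≤ l (m + 1) then c else c + 1) + m ≤ n := by split_ifs <;> omega
      rw [h.colLabel_succ h1 (by omega)]
      generalize (if c ≤ l (m + 1) then c else c + 1) = d at hne hb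
      obtain ⟨i, hi, hi'⟩ := (ih (P.colLabel m d)).1 ⟨d, hb.1, hb.2, rfl⟩
      refine ⟨i, ?_, hi'⟩
      rcases Nat.lt_or_ge m i.val with h2 | h2
      · exact h2
      · have : i = ⟨m, hm⟩ := Fin.ext (le_antisymm h2 hi)
        rw [this, ← hexit] at hi'
        exact absurd (h.colLabel_inj (by omega) hb.1 (by omega) hb.2 hi').symm hne
    · rintro ⟨i, hi, rfl⟩
      obtain ⟨d, hd1, hd2, hd3⟩ := (ih _).2 ⟨i, by omega, rfl⟩
      have hne : d ≠ l (m + 1) + 1 := by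
        rintro rfl
        rw [hd3] at hexit
        have := congrArg Fin.val (π.injective (Fin.ext (Nat.succ_injective hexit)))
        simp only at this
        omega
      refine ⟨if d ≤ l (m + 1) then d else d - 1, ?_, ?_, ?_⟩
      · split_ifs <;> omega
      · split_ifs <;> omega
      · rw [h.colLabel_succ (by split_ifs <;> omega) (by split_ifs <;> omega), ← hd3]
        congr 1
        split_ifs <;> omega

/-- In a left-justified pipe dream the labels entering a row increase from left to right and the
label following the crosses leaves. Hence the row lengths are forced by the exit labels: they form the
Lehmer code. -/
theorem IsJustified.exitLabel_eq_iff (h : P.IsJustified l) (π : Equiv.Perm (Fin n)) (m : Fin n)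
    (hex : ∀ i : Fin n, i < m → P.exitLabel (i.val + 1) = (π i).val + 1) :
    P.exitLabel (m.val + 1) = (π m).val + 1 ↔ l (m.val + 1) = code π m := by
  have him := h.image_colLabel π m.val m.isLt.le hex
  obtain ⟨c, hc1, hc2, hc3⟩ := (him ((π m).val + 1)).2 ⟨m, le_rfl, rfl⟩
  have hcode : code π m = c - 1 := by
    have himage : (univ.filter fun i : Fin n => m < i ∧ π i < π m).image (fun i => (π i).val + 1)
        = (Finset.Icc 1 (c - 1)).image (P.colLabel m) := by
      ext x
      simp only [mem_image, mem_filter, mem_univ, true_and, mem_Icc]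
      constructor
      · rintro ⟨i, ⟨hi1, hi2⟩, rfl⟩
        obtain ⟨d, hd1, hd2, hd3⟩ := (him ((π i).val + 1)).2 ⟨i, hi1.le, rfl⟩
        refine ⟨d, ⟨hd1, ?_⟩, hd3⟩
        by_contra hlt
        have hle : P.colLabel m c ≤ P.colLabel m d := by
          rcases Nat.eq_or_lt_of_le (show c ≤ d by omega) with e | e
          · rw [e]
          · exact (h.colLabel_lt m c d hc1 e hd2).le
        have hi2 : (π i).val < (π m).val := hi2
        omega
      · rintro ⟨d, ⟨hd1, hd2⟩, rfl⟩
        obtain ⟨i, hi1, hi2⟩ := (him (P.colLabel m d)).1 ⟨d, hd1, by omega, rfl⟩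
        have hlt := h.colLabel_lt m d c hd1 (by omega) hc2
        have hlt' : π i < π m := by
          change (π i).val < (π m).val
          omega
        refine ⟨i, ⟨lt_of_le_of_ne hi1 ?_, hlt'⟩, hi2⟩
        rintro rfl
        exact absurd hlt' (lt_irrefl _)
    have hcard := congrArg Finset.card himage
    rw [card_image_of_injective _ (fun i j hij => π.injective (Fin.ext (Nat.succ_injective hij))),
      card_image_of_injOn, Nat.card_Icc] at hcard
    · exact hcard
    · intro d hd d' hd' he
      simp only [coe_Icc, Set.mem_Icc] at hd hd'
      exact h.colLabel_inj hd.1 hd'.1 (by omega) (by omega) he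
  have hl := h.add_le (r := m.val + 1) m.isLt
  rw [h.exitLabel_succ m.isLt, hcode, ← hc3]
  constructor
  · intro he
    have := h.colLabel_inj (by omega) hc1 (by omega) hc2 he
    omega
  · intro he
    congr 1
    omega

theorem IsJustified.hasPerm_iff (h : P.IsJustified l) (π : Equiv.Perm (Fin n)) :
    P.HasPerm π ↔ ∀ i : Fin n, l (i.val + 1) = code π i := by
  constructor
  · exact fun hp i => (h.exitLabel_eq_iff π i fun j _ => hp j).1 (hp i)
  · intro hc
    have key : ∀ m, ∀ i : Fin n, i.val < m → P.exitLabel (i.val + 1) = (π i).val + 1 := by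
      intro m
      induction m with
      | zero => exact fun i hi => absurd hi (Nat.not_lt_zero _)
      | succ m ih =>
        intro i hi
        exact (h.exitLabel_eq_iff π i fun j hj => ih j (lt_of_lt_of_le hj (Nat.le_of_lt_succ hi))).2
          (hc i)
    exact fun i => key n i i.isLt

/-- In a left-justified pipe dream all crosses of a row lie on the pipe leaving through that row,
so no two pipes cross twice. -/
theorem IsJustified.isReduced (h : P.IsJustified l) {π : Equiv.Perm (Fin n)} (hp : P.HasPerm π) :
    P.IsReduced := by
  have key : ∀ p ∈ P.crosses, ∃ i : Fin n, i.val + 1 = p.1 ∧ P.eastLabel p = (π i).val + 1 ∧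
      P.northLabel p < P.eastLabel p := by
    rintro ⟨r, c⟩ hc
    have hv := P.valid _ hc
    simp only at hv
    obtain ⟨m, rfl⟩ : ∃ m, r = m + 1 := ⟨r - 1, by omega⟩
    have hm : m < n := by omega
    have hl := h.add_le (r := m + 1) hm
    have he : P.eastLabel (m + 1, c) = P.exitLabel (m + 1) := by
      rw [h.exitLabel_succ hm]
      exact h.rowLabel_of_ge (r := m + 1) _ (by omega) c ((h _ _).1 hc).2
    refine ⟨⟨m, hm⟩, rfl, he.trans (hp ⟨m, hm⟩), ?_⟩
    rw [he, h.exitLabel_succ hm]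
    have := (h (m + 1) c).1 hc
    exact h.colLabel_lt m c _ this.1 (by omega) (by omega)
  rintro ⟨r, c⟩ hp1 ⟨r', c'⟩ hq1 hpq
  have hv := P.valid _ hp1
  have hv' := P.valid _ hq1
  obtain ⟨i, hi1, hi2, hi3⟩ := key _ hp1
  obtain ⟨j, hj1, hj2, hj3⟩ := key _ hq1
  rw [Sym2.eq_iff] at hpq
  obtain ⟨e1, e2⟩ : P.northLabel (r, c) = P.northLabel (r', c') ∧
      P.eastLabel (r, c) = P.eastLabel (r', c') := by omega
  have hij : i = j := π.injective (Fin.ext (by omega))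
  subst hij
  simp only at hi1 hj1 hv hv'
  obtain rfl : r = r' := by omega
  have : c = c' := h.colLabel_inj (m := r - 1) hv.2.1 hv'.2.1 (by omega) (by omega) e1
  rw [this]

theorem bottomPD_isJustified (π : Equiv.Perm (Fin n)) :
    (bottomPD π).IsJustified fun r => if h : 1 ≤ r ∧ r ≤ n then code π ⟨r - 1, by omega⟩ else 0 := by
  intro r c
  simp only [bottomPD, mem_biUnion, mem_univ, true_and, mem_image, mem_Icc, Prod.mk.injEq]
  constructor
  · rintro ⟨i, d, ⟨h1, h2⟩, rfl, rfl⟩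
    have := i.isLt
    rw [dif_pos ⟨by omega, by omega⟩]
    exact ⟨h1, h2⟩
  · rintro ⟨h1, h2⟩
    split_ifs at h2 with h
    · exact ⟨⟨r - 1, by omega⟩, c, ⟨h1, h2⟩, by simp only; omega, rfl⟩
    · omega

theorem bottomPD_hasPerm (π : Equiv.Perm (Fin n)) : (bottomPD π).HasPerm π := by
  rw [(bottomPD_isJustified π).hasPerm_iff]
  intro i
  have := i.isLt
  rw [dif_pos ⟨by omega, by omega⟩]
  rfl

theorem bottomPD_isReduced (π : Equiv.Perm (Fin n)) : (bottomPD π).IsReduced :=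
  (bottomPD_isJustified π).isReduced (bottomPD_hasPerm π)

theorem IsJustified.eq_bottomPD (h : P.IsJustified l) {π : Equiv.Perm (Fin n)}
    (hp : P.HasPerm π) : P = bottomPD π := by
  rw [h.hasPerm_iff] at hp
  ext ⟨r, c⟩
  have hb := bottomPD_isJustified π r c
  beta_reduce at hb
  constructor
  · intro hc
    have hv := P.valid _ hc
    simp only at hv
    rw [hb, dif_pos ⟨by omega, by omega⟩, ← hp]
    simp only
    rw [Nat.sub_add_cancel hv.1]
    exact (h _ _).1 hc
  · intro hc
    have hv := (bottomPD π).valid _ hc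
    simp only at hv
    rw [hb, dif_pos ⟨by omega, by omega⟩, ← hp] at hc
    simp only at hc
    rw [Nat.sub_add_cancel hv.1] at hc
    exact (h _ _).2 hc

end PipeDream

theorem SlideLE.bottom_hasPerm_isReduced {n : ℕ} {π : Equiv.Perm (Fin n)} {P : PipeDream n}
    (h : SlideLE (bottomPD π) P) : P.HasPerm π ∧ P.IsReduced := by
  induction h with
  | refl => exact ⟨PipeDream.bottomPD_hasPerm π, PipeDream.bottomPD_isReduced π⟩
  | tail _ hs ih =>
    obtain ⟨r, hs⟩ := hs
    exact ⟨(hs.hasPerm_iff π).1 ih.1, hs.isReduced_iff.1 ih.2⟩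

/-! ### The colours of the pipes at a cross of a reduced pipe dream -/

/-- In the word `W`, the letters of which are indexed by the natural numbers, there is a letter `b` to the left of a letter `a`. -/
def Precedes (W : ℕ → ℕ) (b a : ℕ) : Prop := ∃ p q, p < q ∧ W p = b ∧ W q = a

/-- Exchanging two adjacent letters only affects the relative order of these letters. -/
theorem Precedes.of_swap {W W' : ℕ → ℕ} {q : ℕ} (h : ∀ p, p ≠ q → p ≠ q + 1 → W' p = W p)
    (h1 : W' q = W (q + 1)) (h2 : W' (q + 1) = W q) {a b : ℕ} (hp : Precedes W' b a) :
    Precedes W b a ∨ (W q = a ∧ W (q + 1) = b) := by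
  obtain ⟨x, y, hxy, rfl, rfl⟩ := hp
  by_cases hx1 : x = q
  · subst hx1
    by_cases hy : y = x + 1
    · subst hy
      exact Or.inr ⟨h2.symm, h1.symm⟩
    · exact Or.inl ⟨x + 1, y, by omega, h1.symm, (h y (by omega) (by omega)).symm⟩
  by_cases hx2 : x = q + 1
  · subst hx2
    exact Or.inl ⟨q, y, by omega, h2.symm, (h y (by omega) (by omega)).symm⟩
  have hx := (h x hx1 hx2).symm
  by_cases hy1 : y = q
  · subst hy1
    exact Or.inl ⟨x, y + 1, by omega, hx, h1.symm⟩
  by_cases hy2 : y = q + 1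
  · subst hy2
    exact Or.inl ⟨x, q, by omega, hx, h2.symm⟩
  exact Or.inl ⟨x, y, hxy, hx, (h y hy1 hy2).symm⟩

namespace PipeDream

variable {n : ℕ} (P : PipeDream n)

theorem rowLabel_ne_zero_iff {r : ℕ} {v : ℕ → ℕ}
    (hv : ∀ c, 1 ≤ c → c ≤ n → (v c ≠ 0 ↔ c + r ≤ n)) :
    ∀ k ≤ n, P.rowLabel (r + 1) v k ≠ 0 ↔ r < k := by
  intro k
  induction k with
  | zero => intro _; simp [rowLabel]
  | succ k ih =>
    intro hk
    rw [rowLabel]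
    split_ifs with hc
    · have := P.valid _ hc
      simp only at this
      rw [ih (by omega)]
      omega
    · rw [hv _ (by omega) (by omega)]
      omega

theorem colLabel_ne_zero_iff : ∀ r c, 1 ≤ c → c ≤ n → (P.colLabel r c ≠ 0 ↔ c + r ≤ n) := by
  intro r
  induction r with
  | zero => intro c h1 h2; simp only [colLabel]; omega
  | succ r ih =>
    intro c h1 h2
    rw [colLabel_succ]
    split_ifs with hc
    · have := P.valid _ hc
      simp only at this
      rw [ih c h1 h2]
      omega
    · rw [P.rowLabel_ne_zero_iff ih _ (by omega)]
      omega

/-- The labels along the lattice path separating the tiles in the first `r` rows and the last `k`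
tiles of row `r + 1` from the other tiles: first the exits in the first `r` rows, from top to
bottom, then the edges of the path from left to right. -/
def word (r k : ℕ) (p : ℕ) : ℕ :=
  if p < r then P.exitLabel (p + 1)
  else if p + k < r + n then P.colLabel r (p - r + 1)
  else if p + k = r + n then P.rowLabel (r + 1) (P.colLabel r) k
  else if p ≤ r + n then P.colLabel (r + 1) (p - r)
  else 0

theorem word_next (r : ℕ) : P.word r n = P.word (r + 1) 0 := by
  funext p
  unfold word
  rcases lt_trichotomy p r with h | rfl | h
  · rw [if_pos h, if_pos (by omega)]
  · rw [if_neg (by omega), if_neg (by omega), if_pos (by omega), if_pos (by omega)]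
    rfl
  · rw [if_neg (by omega), if_neg (by omega), if_neg (by omega)]
    by_cases h2 : p ≤ r + n
    · rw [if_pos h2, if_neg (by omega), if_pos (by omega)]
      congr 1
      omega
    · rw [if_neg h2, if_neg (by omega), if_neg (by omega)]
      by_cases h3 : p + 0 = r + 1 + n
      · rw [if_pos h3]; rfl
      · rw [if_neg h3, if_neg (by omega)]

/-- Passing the tile in column `n - k` of row `r + 1` exchanges two letters at a cross and does not
change the word at an elbow tile. -/
theorem word_step (r : ℕ) {k : ℕ} (hk : k < n) :
    (∀ p, p ≠ r + (n - k) - 1 → p ≠ r + (n - k) - 1 + 1 → P.word r (k + 1) p = P.word r k p) ∧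
    P.word r k (r + (n - k) - 1) = P.northLabel (r + 1, n - k) ∧
    P.word r k (r + (n - k) - 1 + 1) = P.eastLabel (r + 1, n - k) ∧
    (if (r + 1, n - k) ∈ P.crosses then
      P.word r (k + 1) (r + (n - k) - 1) = P.eastLabel (r + 1, n - k) ∧
      P.word r (k + 1) (r + (n - k) - 1 + 1) = P.northLabel (r + 1, n - k)
    else P.word r (k + 1) = P.word r k) := by
  have hs : n - (n - k) = k := by omega
  have off : ∀ p, p ≠ r + (n - k) - 1 → p ≠ r + (n - k) - 1 + 1 →
      P.word r (k + 1) p = P.word r k p := by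
    intro p h1 h2
    unfold word
    by_cases h3 : p < r
    · rw [if_pos h3, if_pos h3]
    rw [if_neg h3, if_neg h3]
    by_cases h4 : p + k + 1 < r + n
    · rw [if_pos (by omega), if_pos (by omega)]
    · rw [if_neg (show ¬ p + (k + 1) < r + n by omega),
        if_neg (show ¬ p + (k + 1) = r + n by omega), if_neg (show ¬ p + k < r + n by omega),
        if_neg (show ¬ p + k = r + n by omega)]
  have n1 : P.word r k (r + (n - k) - 1) = P.northLabel (r + 1, n - k) := by
    unfold word northLabel
    rw [if_neg (by omega), if_pos (by omega)]
    simp only [Nat.add_sub_cancel]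
    congr 1
    omega
  have e1 : P.word r k (r + (n - k) - 1 + 1) = P.eastLabel (r + 1, n - k) := by
    unfold word eastLabel
    rw [if_neg (by omega), if_neg (by omega), if_pos (by omega)]
    simp only [Nat.add_sub_cancel, hs]
  have n2 : P.word r (k + 1) (r + (n - k) - 1) = if (r + 1, n - k) ∈ P.crosses then
      P.eastLabel (r + 1, n - k) else P.northLabel (r + 1, n - k) := by
    unfold word eastLabel northLabel
    rw [if_neg (by omega), if_neg (by omega), if_pos (by omega)]
    simp only [Nat.add_sub_cancel, hs, rowLabel]
  have e2 : P.word r (k + 1) (r + (n - k) - 1 + 1) = if (r + 1, n - k) ∈ P.crosses then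
      P.northLabel (r + 1, n - k) else P.eastLabel (r + 1, n - k) := by
    have : r + (n - k) - 1 + 1 - r = n - k := by omega
    unfold word eastLabel northLabel
    rw [if_neg (by omega), if_neg (by omega), if_neg (by omega), if_pos (by omega), this]
    simp only [Nat.add_sub_cancel, hs, colLabel_succ]
  refine ⟨off, n1, e1, ?_⟩
  split_ifs with hc
  · rw [if_pos hc] at n2 e2
    exact ⟨n2, e2⟩
  · rw [if_neg hc] at n2 e2
    funext p
    by_cases h1 : p = r + (n - k) - 1
    · rw [h1, n2, n1]
    by_cases h2 : p = r + (n - k) - 1 + 1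
    · rw [h2, e2, e1]
    exact off p h1 h2

/-- Labels which are not in increasing order have crossed. -/
theorem exists_cross_of_precedes {a b : ℕ} (ha : 0 < a) (hab : a ≤ b) : ∀ r k, k ≤ n →
    Precedes (P.word r k) b a →
      a < b ∧ ∃ p ∈ P.crosses, P.northLabel p = a ∧ P.eastLabel p = b := by
  have inner : ∀ r, (Precedes (P.word r 0) b a →
      a < b ∧ ∃ p ∈ P.crosses, P.northLabel p = a ∧ P.eastLabel p = b) → ∀ k, k ≤ n →
      Precedes (P.word r k) b a →
      a < b ∧ ∃ p ∈ P.crosses, P.northLabel p = a ∧ P.eastLabel p = b := by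
    intro r h0 k
    induction k with
    | zero => exact fun _ => h0
    | succ k ih =>
      intro hk hp
      obtain ⟨off, n1, e1, hc⟩ := P.word_step r (k := k) hk
      split_ifs at hc with hmem
      · rcases hp.of_swap off (by rw [hc.1, e1]) (by rw [hc.2, n1]) with h | ⟨h1, h2⟩
        · exact ih (by omega) h
        · rcases hab.eq_or_lt with rfl | hlt
          · exact ih (by omega) ⟨_, _, Nat.lt_succ_self _, h1, h2⟩
          · exact ⟨hlt, _, hmem, n1.symm.trans h1, e1.symm.trans h2⟩
      · rw [hc] at hp
        exact ih (by omega) hp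
  intro r
  induction r with
  | zero =>
    refine inner 0 ?_
    rintro ⟨p, q, hpq, rfl, rfl⟩
    exfalso
    have hw : ∀ p, P.word 0 0 p = if p < n then p + 1 else 0 := by
      intro p
      unfold word
      simp only [Nat.not_lt_zero, if_false, add_zero, zero_add, rowLabel, colLabel, Nat.sub_zero]
      split_ifs <;> first | rfl | omega
    rw [hw] at ha
    rw [hw, hw] at hab
    split_ifs at ha hab <;> omega
  | succ r ih =>
    refine inner (r + 1) ?_
    rw [← P.word_next]
    exact ih n le_rfl

/-- Labels which are in decreasing order at some stage stay so unless they cross again. -/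
theorem precedes_final {a b : ℕ} (hx : ∀ p ∈ P.crosses, ¬ (P.northLabel p = b ∧ P.eastLabel p = a)) :
    ∀ r ≤ n, ∀ k ≤ n, Precedes (P.word r k) b a → Precedes (P.word n n) b a := by
  have inner : ∀ r d k, k + d = n → Precedes (P.word r k) b a → Precedes (P.word r n) b a := by
    intro r d
    induction d with
    | zero => intro k hk h; rwa [show k = n from hk] at h
    | succ d ih =>
      intro k hk hp
      refine ih (k + 1) (by omega) ?_
      obtain ⟨off, n1, e1, hc⟩ := P.word_step r (k := k) (by omega)
      split_ifs at hc with hmem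
      · rcases hp.of_swap (W' := P.word r k) (W := P.word r (k + 1))
          (fun p h1 h2 => (off p h1 h2).symm) (by rw [hc.2, n1]) (by rw [hc.1, e1]) with h | ⟨h1, h2⟩
        · exact h
        · exact absurd ⟨hc.2.symm.trans h2, hc.1.symm.trans h1⟩ (hx _ hmem)
      · rwa [hc]
  have outer : ∀ d r, r + d = n → Precedes (P.word r n) b a → Precedes (P.word n n) b a := by
    intro d
    induction d with
    | zero => intro r hr h; rwa [show r = n from hr] at h
    | succ d ih =>
      intro r hr hp
      refine ih (r + 1) (by omega) (inner (r + 1) n 0 (by omega) ?_)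
      rwa [← P.word_next]
  intro r hr k hk hp
  exact outer (n - r) r (by omega) (inner r (n - k) k (by omega) hp)

/-- In a reduced pipe dream of a shuffle, a pipe with a small label passes every cross from north
to south, and a pipe with a large label passes it from east to west: the labels of two crossing
pipes are in increasing order before the cross, as otherwise the pipes would have crossed before,
and in decreasing order at the end, as otherwise they would cross again. -/
theorem label_of_mem_crosses {P : PipeDream n} {π : Equiv.Perm (Fin n)} {k : ℕ}
    (hπ : IsShuffle π k) (hr : P.IsReduced) (hp : P.HasPerm π) {p : ℕ × ℕ} (hc : p ∈ P.crosses) :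
    P.northLabel p ≤ k ∧ k < P.eastLabel p := by
  obtain ⟨r, c⟩ := p
  have hv := P.valid _ hc
  simp only at hv
  obtain ⟨m, rfl⟩ : ∃ m, r = m + 1 := ⟨r - 1, by omega⟩
  obtain ⟨j, hj⟩ : ∃ j, c = n - j := ⟨n - c, by omega⟩
  obtain ⟨off, n1, e1, hw⟩ := P.word_step m (k := j) (by omega)
  rw [← hj] at off n1 e1 hw
  rw [if_pos hc] at hw
  have hN : P.northLabel (m + 1, c) ≠ 0 :=
    (P.colLabel_ne_zero_iff m c hv.2.1 (by omega)).2 (by omega)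
  have hE : P.eastLabel (m + 1, c) ≠ 0 :=
    (P.rowLabel_ne_zero_iff (P.colLabel_ne_zero_iff m) _ (by omega)).2 (by simp only; omega)
  have hlt : P.northLabel (m + 1, c) < P.eastLabel (m + 1, c) := by
    by_contra hle
    obtain ⟨h1, q, hq, h2, h3⟩ := P.exists_cross_of_precedes (Nat.pos_of_ne_zero hE) (not_lt.1 hle)
      m j (by omega) ⟨_, _, Nat.lt_succ_self _, n1, e1⟩
    have := hr _ hc q hq (by rw [h2, h3, Sym2.eq_swap])
    rw [← this] at h2
    omega
  have hfin := P.precedes_final (a := P.northLabel (m + 1, c)) (b := P.eastLabel (m + 1, c))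
    (fun q hq h => by
      have := hr _ hc q hq (by rw [h.1, h.2, Sym2.eq_swap])
      rw [← this] at h
      omega) m (by omega) (j + 1) (by omega) ⟨_, _, Nat.lt_succ_self _, hw.1, hw.2⟩
  obtain ⟨x, y, hxy, hx, hy⟩ := hfin
  have hword : ∀ x, P.word n n x ≠ 0 → ∃ h : x < n, P.word n n x = (π ⟨x, h⟩).val + 1 := by
    intro x hx
    by_cases hxn : x < n
    · refine ⟨hxn, ?_⟩
      rw [word, if_pos hxn]
      exact hp ⟨x, hxn⟩
    · exfalso
      apply hx
      unfold word
      have hcol := fun r (hr : n ≤ r) (c : ℕ) (h1 : 1 ≤ c) (h2 : c ≤ n) =>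
        not_not.1 fun h => absurd ((P.colLabel_ne_zero_iff r c h1 h2).1 h) (by omega)
      rw [if_neg hxn, if_neg (by omega)]
      split_ifs with h1 h2
      · exact not_not.1 fun h =>
          absurd ((P.rowLabel_ne_zero_iff (P.colLabel_ne_zero_iff n) n le_rfl).1 h) (by omega)
      · exact hcol (n + 1) (by omega) _ (by omega) (by omega)
      · rfl
  obtain ⟨hxn, hx'⟩ := hword x (by rw [hx]; exact hE)
  obtain ⟨hyn, hy'⟩ := hword y (by rw [hy]; exact hN)
  rw [hx] at hx'
  rw [hy] at hy'
  have := hπ ⟨x, hxn⟩ ⟨y, hyn⟩ hxy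
  rw [Fin.lt_def] at this
  omega

/-! ### Reduced pipe dreams of a shuffle are reached from the bottom by slides -/

/-- If a cross has an elbow tile to its left, then a simple slide can be undone in these two
columns: the pipe leaving the elbow tile to the south has a large label, so that the tile below
is not a cross. -/
theorem exists_unslide {P : PipeDream n} {k : ℕ}
    (hR : ∀ p ∈ P.crosses, P.northLabel p ≤ k ∧ k < P.eastLabel p) {c : ℕ} (hc : 1 ≤ c) :
    ∀ r, (r, c + 1) ∈ P.crosses → (r, c) ∉ P.crosses →
      ∃ (m : ℕ) (P' : PipeDream n), SimpleSlide m P' P := by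
  intro r h1 h2
  obtain ⟨d, hd⟩ : ∃ d, r + d = n := ⟨n - r, by have := P.valid _ h1; simp only at this; omega⟩
  induction d generalizing r with
  | zero =>
    have := P.valid _ h1
    simp only at this
    omega
  | succ d ih =>
    have hv := P.valid _ h1
    simp only at hv
    have h3 : (r + 1, c) ∉ P.crosses := by
      intro h3
      have hs := (hR _ h3).1
      have hl := (hR _ h1).2
      simp only [northLabel, eastLabel, Nat.add_sub_cancel] at hs hl
      obtain ⟨m, rfl⟩ : ∃ m, r = m + 1 := ⟨r - 1, by omega⟩
      have := P.rowLabel_sub (m + 1) (P.colLabel m) (c := c + 1) (by omega) (by omega)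
      rw [if_pos h1, Nat.add_sub_cancel] at this
      rw [colLabel_succ, if_neg h2, this] at hs
      simp only [Nat.add_sub_cancel] at hl
      omega
    by_cases h4 : (r + 1, c + 1) ∈ P.crosses
    · exact ih (r + 1) h4 h3 (by omega)
    · refine ⟨r, ⟨insert (r + 1, c) (P.crosses.erase (r, c + 1)), ?_⟩, c, ?_⟩
      · intro p hp
        rcases mem_insert.1 hp with rfl | hp
        · simp only; omega
        · exact P.valid p (mem_of_mem_erase hp)
      · simp only [mem_insert, mem_erase, Prod.mk.injEq, h2, h4, true_or, ne_eq, not_true_eq_false,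
          false_and, and_false, or_false, not_and, true_and]
        refine ⟨by omega, by omega, by omega, ?_⟩
        rw [erase_insert (by simp [h3]), insert_erase h1]

end PipeDream

/-- Auxiliary: the sum of the column numbers of the crosses. -/
def PipeDream.corank {n : ℕ} (P : PipeDream n) : ℕ := ∑ p ∈ P.crosses, p.2

theorem SimpleSlide.corank_lt {n r : ℕ} {P P' : PipeDream n} (h : SimpleSlide r P P') :
    P.corank < P'.corank := by
  obtain ⟨c, h1, _, _, h4, h5⟩ := h
  unfold PipeDream.corank
  rw [h5, sum_insert (fun h => h4 (mem_of_mem_erase h)), ← add_sum_erase _ _ h1]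
  simp

/-- Undoing slides as long as possible ends in a left-justified pipe dream, which is the bottom one;
the process stops as the sum of the column numbers of the crosses decreases. -/
theorem IsShuffle.slideLE {n k : ℕ} {π : Equiv.Perm (Fin n)} (hπ : IsShuffle π k) :
    ∀ (m : ℕ) (P : PipeDream n), P.corank = m → P.IsReduced → P.HasPerm π →
      SlideLE (bottomPD π) P := by
  intro m
  induction m using Nat.strong_induction_on with
  | _ m ih =>
    intro P hm hr hp
    by_cases hj : ∀ r c, 1 ≤ c → (r, c + 1) ∈ P.crosses → (r, c) ∈ P.crosses
    · obtain ⟨l, hl⟩ := P.exists_isJustified hj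
      rw [hl.eq_bottomPD hp]
      exact Relation.ReflTransGen.refl
    · push Not at hj
      obtain ⟨r, c, hc, h1, h2⟩ := hj
      obtain ⟨s, P', hs⟩ := PipeDream.exists_unslide
        (fun p h => PipeDream.label_of_mem_crosses hπ hr hp h) hc r h1 h2
      exact Relation.ReflTransGen.tail
        (ih P'.corank (hm ▸ hs.corank_lt) P' rfl (hs.isReduced_iff.2 hr) ((hs.hasPerm_iff π).2 hp))
        ⟨s, hs⟩

/-! ### A TSSCPP is determined by its pipe dream -/

/-- The cardinality of an initial segment of the natural numbers, described by its elements. -/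
theorem lt_card_filter_range_iff {f : ℕ → Prop} [DecidablePred f] {n : ℕ}
    (hd : ∀ p, f (p + 1) → f p) (hn : ∀ p, f p → p < n) (p : ℕ) :
    p < ((range n).filter f).card ↔ f p := by
  have hle : ∀ d p, f (p + d) → f p := by
    intro d
    induction d with
    | zero => exact fun p h => h
    | succ d ih => exact fun p h => ih p (hd _ h)
  constructor
  · intro h
    by_contra hp
    have hsub : (range n).filter f ⊆ range p := by
      intro q hq
      rw [mem_filter] at hq
      rw [mem_range]
      by_contra hpq
      exact hp (hle (q - p) p (by rw [Nat.add_sub_cancel' (not_lt.1 hpq)]; exact hq.2))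
    have := card_le_card hsub
    rw [card_range] at this
    omega
  · intro h
    have hsub : range (p + 1) ⊆ (range n).filter f := by
      intro q hq
      rw [mem_range] at hq
      have hfq : f q := hle (p - q) q (by rw [Nat.add_sub_cancel' (by omega)]; exact h)
      exact mem_filter.2 ⟨mem_range.2 (hn q hfq), hfq⟩
    have := card_le_card hsub
    rw [card_range] at this
    omega

namespace TSSCPP

variable {n : ℕ} (T : TSSCPP n)

theorem mem_mono {i i' j j' k k' : ℕ} (hi : i ≤ i') (hj : j ≤ j') (hk : k ≤ k')
    (h : T.Mem i' j' k') : T.Mem i j k :=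
  lt_of_le_of_lt hk (lt_of_lt_of_le h (T.anti i i' j j' hi hj))

theorem mem_swap {i j k : ℕ} (h : T.Mem i j k) : T.Mem j i k := by
  unfold PlanePartition.Mem at *
  rwa [T.symm j i]

theorem mem_rotate {i j k : ℕ} (h : T.Mem i j k) : T.Mem j k i := T.cyclic i j k h

theorem mem_bound {i j k : ℕ} (h : T.Mem i j k) : i < 2 * n ∧ j < 2 * n ∧ k < 2 * n := by
  have aux : ∀ i j k, T.Mem i j k → i < 2 * n := by
    intro i j k h
    by_contra hi
    have := T.inBox.1 i j (Or.inl (not_lt.1 hi))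
    unfold PlanePartition.Mem at h
    omega
  exact ⟨aux _ _ _ h, aux _ _ _ (T.mem_rotate h), aux _ _ _ (T.mem_rotate (T.mem_rotate h))⟩

theorem mem_compl {i j k : ℕ} (hi : i < 2 * n) (hj : j < 2 * n) (hk : k < 2 * n) :
    T.Mem i j k ↔ ¬ T.Mem (2 * n - 1 - i) (2 * n - 1 - j) (2 * n - 1 - k) := by
  have := T.selfCompl i j hi hj
  unfold PlanePartition.Mem
  omega

/-- Otherwise the point `(n + p, n + q, n - 1 - q)` and, by symmetry, its complement would both
belong to `T`. -/
theorem mem_fundamental_bound {p q k : ℕ} (h : T.Mem (n + p) (n + q) k) : q + k + 1 < n := by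
  by_contra hlt
  have hb := T.mem_bound h
  have h1 : T.Mem (n + p) (n + q) (n - 1 - q) := T.mem_mono le_rfl le_rfl (by omega) h
  have h2 : T.Mem (n + p) (n - 1 - q) (n + q) := T.mem_rotate (T.mem_swap h1)
  rw [T.mem_compl (by omega) (by omega) (by omega)] at h1
  apply h1
  exact T.mem_mono (by omega) (by omega) (by omega) h2

theorem lt_depth_iff (k d p : ℕ) : p < T.depth (k + 1) d ↔ T.Mem (n + p) (n + p + d) k := by
  unfold depth
  rw [lt_card_filter_range_iff]
  · rfl
  · intro p h
    exact le_trans h (T.anti _ _ _ _ (by omega) (by omega))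
  · intro p h
    have := (T.mem_bound (i := n + p) (j := n + p + d) (k := k) h).1
    omega

theorem depth_succ_le (k d : ℕ) : T.depth (k + 1) (d + 1) ≤ T.depth (k + 1) d := by
  refine le_of_forall_lt fun p hp => ?_
  rw [lt_depth_iff] at hp ⊢
  exact T.mem_mono le_rfl (by omega) le_rfl hp

theorem depth_le_succ (k d : ℕ) : T.depth (k + 1) d ≤ T.depth (k + 1) (d + 1) + 1 := by
  refine le_of_forall_lt fun p hp => ?_
  rcases p with _ | p
  · exact Nat.succ_pos _
  rw [lt_depth_iff] at hp
  exact Nat.succ_lt_succ ((T.lt_depth_iff _ _ _).2 (T.mem_mono (by omega) (by omega) le_rfl hp))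

theorem depth_eq_zero {k d : ℕ} (h : n ≤ k + 1 + d) : T.depth (k + 1) d = 0 := by
  by_contra h0
  have := (T.lt_depth_iff k d 0).1 (Nat.pos_of_ne_zero h0)
  rw [Nat.add_assoc n 0 d] at this
  have := T.mem_fundamental_bound this
  omega

theorem mem_pipeDream {r c : ℕ} : (r, c) ∈ T.pipeDream.crosses ↔
    (1 ≤ r ∧ 1 ≤ c ∧ r + c ≤ n) ∧ T.depth (n + 1 - r - c) (r - 1) = T.depth (n + 1 - r - c) r := by
  unfold pipeDream ones triangle
  simp only [mem_filter, mem_product, mem_Icc]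
  constructor
  · rintro ⟨⟨⟨h1, h2⟩, h3, h4⟩, h5, h6, h7⟩
    refine ⟨⟨h1, h3, h5⟩, ?_⟩
    have e1 : n - (r + c - 1) = n + 1 - r - c := by omega
    have e2 : n - 1 - (n - r) = r - 1 := by omega
    have e3 : n - (n - r) = r := by omega
    rwa [e1, e2, e3] at h7
  · rintro ⟨⟨h1, h3, h5⟩, h7⟩
    have e1 : n - (r + c - 1) = n + 1 - r - c := by omega
    have e2 : n - 1 - (n - r) = r - 1 := by omega
    have e3 : n - (n - r) = r := by omega
    refine ⟨by omega, h5, by omega, ?_⟩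
    rwa [e1, e2, e3]

theorem mem_pipeDream_iff_depth {k d : ℕ} (h : k + 1 + d < n) :
    (d + 1, n - (k + 1) - d) ∈ T.pipeDream.crosses ↔
      T.depth (k + 1) d = T.depth (k + 1) (d + 1) := by
  rw [mem_pipeDream]
  have e : n + 1 - (d + 1) - (n - (k + 1) - d) = k + 1 := by omega
  rw [e, Nat.add_sub_cancel]
  exact and_iff_right ⟨by omega, by omega, by omega⟩

theorem depth_eq_of_pipeDream_eq {T T' : TSSCPP n} (h : T.pipeDream = T'.pipeDream) (k d : ℕ) :
    T.depth (k + 1) d = T'.depth (k + 1) d := by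
  by_cases hd : n ≤ k + 1 + d
  · rw [T.depth_eq_zero hd, T'.depth_eq_zero hd]
  · have ih := depth_eq_of_pipeDream_eq h k (d + 1)
    have h1 := T.mem_pipeDream_iff_depth (k := k) (d := d) (by omega)
    have h2 := T'.mem_pipeDream_iff_depth (k := k) (d := d) (by omega)
    have h3 := T.depth_succ_le k d
    have h4 := T.depth_le_succ k d
    have h5 := T'.depth_succ_le k d
    have h6 := T'.depth_le_succ k d
    rw [h] at h1
    have h7 := h1.symm.trans h2
    omega
termination_by n - d

/-- A TSSCPP is determined by its lattice points with two coordinates in the upper half of the box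
and one in the lower half: the others are obtained by complementation, except for those with all
coordinates in the same half. -/
theorem ext_of_fundamental {T T' : TSSCPP n}
    (h : ∀ p q k, T.Mem (n + p) (n + q) k ↔ T'.Mem (n + p) (n + q) k) : T = T' := by
  have key : ∀ (T T' : TSSCPP n), (∀ p q k, T.Mem (n + p) (n + q) k ↔ T'.Mem (n + p) (n + q) k) →
      ∀ i j k, T.Mem i j k → T'.Mem i j k := by
    intro T T' h
    have big : ∀ i j k, n ≤ i → n ≤ j → T.Mem i j k → T'.Mem i j k := by
      intro i j k hi hj
      have := h (i - n) (j - n) k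
      rw [Nat.add_sub_cancel' hi, Nat.add_sub_cancel' hj] at this
      exact this.1
    have big' : ∀ i j k, n ≤ i → n ≤ j → T'.Mem i j k → T.Mem i j k := by
      intro i j k hi hj
      have := h (i - n) (j - n) k
      rw [Nat.add_sub_cancel' hi, Nat.add_sub_cancel' hj] at this
      exact this.2
    have small : ∀ i j k, i < n → j < n → T.Mem i j k → T'.Mem i j k := by
      intro i j k hi hj hm
      have hb := T.mem_bound hm
      rw [mem_compl _ hb.1 hb.2.1 hb.2.2] at hm ⊢
      exact fun hm' => hm (big' _ _ _ (by omega) (by omega) hm')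
    -- two of the three coordinates lie in the same half
    intro i j k hm
    rcases Nat.lt_or_ge i n with hi | hi <;> rcases Nat.lt_or_ge j n with hj | hj <;>
      rcases Nat.lt_or_ge k n with hk | hk
    · exact small _ _ _ hi hj hm
    · exact small _ _ _ hi hj hm
    · exact T'.mem_rotate (small _ _ _ hk hi (T.mem_rotate (T.mem_rotate hm)))
    · exact T'.mem_rotate (T'.mem_rotate (big _ _ _ hj hk (T.mem_rotate hm)))
    · exact T'.mem_rotate (T'.mem_rotate (small _ _ _ hj hk (T.mem_rotate hm)))
    · exact T'.mem_rotate (big _ _ _ hk hi (T.mem_rotate (T.mem_rotate hm)))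
    · exact big _ _ _ hi hj hm
    · exact big _ _ _ hi hj hm
  have hpart : ∀ i j, T.part i j = T'.part i j := fun i j =>
    le_antisymm (le_of_forall_lt fun k hk => key T T' h i j k hk)
      (le_of_forall_lt fun k hk => key T' T (fun p q k => (h p q k).symm) i j k hk)
  ext i j
  exact hpart i j

theorem pipeDream_injective : Function.Injective (pipeDream (n := n)) := by
  intro T T' h
  have aux : ∀ p d k, T.Mem (n + p) (n + p + d) k ↔ T'.Mem (n + p) (n + p + d) k := by
    intro p d k
    rw [← lt_depth_iff, ← lt_depth_iff, depth_eq_of_pipeDream_eq h]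
  refine ext_of_fundamental fun p q k => ?_
  rcases le_total p q with hpq | hpq
  · have := aux p (q - p) k
    rwa [Nat.add_assoc, Nat.add_sub_cancel' hpq] at this
  · have := aux q (p - q) k
    rw [Nat.add_assoc, Nat.add_sub_cancel' hpq] at this
    exact ⟨fun h => T'.mem_swap (this.1 (T.mem_swap h)), fun h => T.mem_swap (this.2 (T'.mem_swap h))⟩

end TSSCPP

/-! ### Construction of a TSSCPP from a family of depths -/

/-- The conditions on numbers `μ l d` to be the depths of a TSSCPP in the `2n × 2n × 2n` box. -/
structure IsDepth (n : ℕ) (μ : ℕ → ℕ → ℕ) : Prop where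
  succ_le : ∀ l d, μ l (d + 1) ≤ μ l d
  le_succ : ∀ l d, μ l d ≤ μ l (d + 1) + 1
  level : ∀ l d, 1 ≤ l → μ (l + 1) d ≤ μ l d
  bound : ∀ l d p, p < μ l d → p + d + l < n

/-- The condition for the lattice point `(n + p, n + q, k)` (counted from `0`) to belong to the
plane partition with depths `μ`. -/
def Fund (μ : ℕ → ℕ → ℕ) (p q k : ℕ) : Prop := min p q < μ (k + 1) (max p q - min p q)

/-- The lattice points of the plane partition with depths `μ`: the points with two large and one
small coordinates are prescribed by `Fund`, those with one large and two small coordinates are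
their complements; the points with three small coordinates belong to the plane partition, those
with three large coordinates do not. -/
def Cube (n : ℕ) (μ : ℕ → ℕ → ℕ) (i j k : ℕ) : Prop :=
  i < 2 * n ∧ j < 2 * n ∧ k < 2 * n ∧
  if i < n then
    if j < n then
      if k < n then True else ¬ Fund μ (n - 1 - i) (n - 1 - j) (2 * n - 1 - k)
    else
      if k < n then ¬ Fund μ (n - 1 - i) (n - 1 - k) (2 * n - 1 - j) else Fund μ (j - n) (k - n) i
  else
    if j < n then
      if k < n then ¬ Fund μ (n - 1 - j) (n - 1 - k) (2 * n - 1 - i) else Fund μ (i - n) (k - n) j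
    else
      if k < n then Fund μ (i - n) (j - n) k else False

theorem Fund.comm {μ : ℕ → ℕ → ℕ} {p q k : ℕ} : Fund μ p q k ↔ Fund μ q p k := by
  unfold Fund; rw [min_comm, max_comm]

namespace IsDepth

variable {n : ℕ} {μ : ℕ → ℕ → ℕ} (h : IsDepth n μ)
include h

theorem fund_bound {p q k : ℕ} (hf : Fund μ p q k) : p + k + 1 < n ∧ q + k + 1 < n := by
  have := h.bound _ _ _ hf
  omega

theorem fund_of_succ {p q k : ℕ} (hf : Fund μ p (q + 1) k) : Fund μ p q k := by
  unfold Fund at *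
  rcases Nat.lt_or_ge q p with hpq | hpq
  · rw [min_eq_right (by omega), max_eq_left (by omega)] at *
    have := h.le_succ (k + 1) (p - (q + 1))
    rw [show p - (q + 1) + 1 = p - q by omega] at this
    omega
  · rw [min_eq_left (by omega), max_eq_right (by omega)] at *
    have := h.succ_le (k + 1) (q - p)
    rw [show q - p + 1 = q + 1 - p by omega] at this
    omega

theorem fund_of_level {p q k : ℕ} (hf : Fund μ p q (k + 1)) : Fund μ p q k :=
  lt_of_lt_of_le hf (h.level _ _ (by omega))

end IsDepth

theorem Cube.swap {n : ℕ} {μ : ℕ → ℕ → ℕ} {i j k : ℕ} (hc : Cube n μ i j k) : Cube n μ j i k := by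
  unfold Cube at *
  refine ⟨hc.2.1, hc.1, hc.2.2.1, ?_⟩
  have h := hc.2.2.2
  split_ifs at h ⊢ <;> first | exact h | (rw [Fund.comm]; exact h)

theorem Cube.rotate {n : ℕ} {μ : ℕ → ℕ → ℕ} {i j k : ℕ} (hc : Cube n μ i j k) :
    Cube n μ j k i := by
  unfold Cube at *
  refine ⟨hc.2.1, hc.2.2.1, hc.1, ?_⟩
  have h := hc.2.2.2
  split_ifs at h ⊢ <;> first | exact h | (rw [Fund.comm]; exact h)

theorem Cube.compl {n : ℕ} {μ : ℕ → ℕ → ℕ} {i j k : ℕ} (hi : i < 2 * n) (hj : j < 2 * n)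
    (hk : k < 2 * n) :
    Cube n μ i j k ↔ ¬ Cube n μ (2 * n - 1 - i) (2 * n - 1 - j) (2 * n - 1 - k) := by
  have sm : ∀ x, x < n → 2 * n - 1 - x - n = n - 1 - x ∧ 2 * n - 1 - (2 * n - 1 - x) = x ∧
      ¬ (2 * n - 1 - x < n) := fun x hx => by omega
  have bg : ∀ x, x < 2 * n → ¬ x < n → n - 1 - (2 * n - 1 - x) = x - n ∧
      2 * n - 1 - (2 * n - 1 - x) = x ∧ 2 * n - 1 - x < n := fun x hx hx' => by omega
  have b : ∀ x, x < 2 * n → 2 * n - 1 - x < 2 * n := fun x hx => by omega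
  unfold Cube
  simp only [hi, hj, hk, b, true_and]
  by_cases h1 : i < n <;> by_cases h2 : j < n <;> by_cases h3 : k < n
  all_goals
    first | have e1 := sm i h1 | have e1 := bg i hi h1
    first | have e2 := sm j h2 | have e2 := bg j hj h2
    first | have e3 := sm k h3 | have e3 := bg k hk h3
    simp only [h1, h2, h3, e1, e2, e3, if_true, if_false, not_not, not_true_eq_false,
      not_false_eq_true]

theorem IsDepth.cube_of_succ {n : ℕ} {μ : ℕ → ℕ → ℕ} (h : IsDepth n μ) {i j k : ℕ}
    (hc : Cube n μ i j (k + 1)) : Cube n μ i j k := by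
  obtain ⟨hi, hj, hk, hc⟩ := hc
  refine ⟨hi, hj, by omega, ?_⟩
  have hs : ∀ p m, k + 1 < n → ¬ Fund μ p (n - 1 - (k + 1)) m → ¬ Fund μ p (n - 1 - k) m := by
    intro p m hkn hf hf'
    rw [show n - 1 - k = n - 1 - (k + 1) + 1 by omega] at hf'
    exact hf (h.fund_of_succ hf')
  have hl : ∀ p m, ¬ k < n → Fund μ p (k + 1 - n) m → Fund μ p (k - n) m := by
    intro p m hkn hf
    rw [show k + 1 - n = k - n + 1 by omega] at hf
    exact h.fund_of_succ hf
  split_ifs at hc ⊢ with h1 h2 h3 h4 h5 h6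
  all_goals first
    | trivial
    | omega
    | exact hs _ _ (by assumption) hc
    | exact hl _ _ (by assumption) hc
    | exact h.fund_of_level hc
    | skip
  · rw [show 2 * n - 1 - k = 2 * n - 1 - (k + 1) + 1 by omega]
    exact fun hf => hc (h.fund_of_level hf)
  · intro hf
    have b1 := (h.fund_bound hc).1
    have b2 := (h.fund_bound hf).1
    omega
  · intro hf
    have b1 := (h.fund_bound hc).1
    have b2 := (h.fund_bound hf).1
    omega

theorem IsDepth.cube_mono {n : ℕ} {μ : ℕ → ℕ → ℕ} (h : IsDepth n μ) {i i' j j' k k' : ℕ}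
    (hi : i ≤ i') (hj : j ≤ j') (hk : k ≤ k') (hc : Cube n μ i' j' k') : Cube n μ i j k := by
  have aux : ∀ d i j k, Cube n μ i j (k + d) → Cube n μ i j k := by
    intro d
    induction d with
    | zero => exact fun _ _ _ h => h
    | succ d ih => exact fun i j k hc => ih i j k (h.cube_of_succ hc)
  have aux' : ∀ i j k k', k ≤ k' → Cube n μ i j k' → Cube n μ i j k := fun i j k k' hk hc =>
    aux (k' - k) i j k (by rwa [Nat.add_sub_cancel' hk])
  exact (aux' _ _ _ _ hj (aux' _ _ _ _ hi (aux' _ _ _ _ hk hc).rotate).rotate).rotate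

open Classical in
/-- The TSSCPP with the depths `μ`. -/
noncomputable def TSSCPP.ofDepth {n : ℕ} {μ : ℕ → ℕ → ℕ} (h : IsDepth n μ) : TSSCPP n :=
  have hmem : ∀ i j k, k < ((range (2 * n)).filter (Cube n μ i j)).card ↔ Cube n μ i j k :=
    fun i j => lt_card_filter_range_iff (f := Cube n μ i j) (fun _ hc => h.cube_mono le_rfl le_rfl (Nat.le_succ _) hc)
      (fun _ hc => hc.2.2.1)
  { part := fun i j => ((range (2 * n)).filter (Cube n μ i j)).card
    anti := fun i i' j j' hi hj => le_of_forall_lt fun k hk => by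
      rw [hmem] at hk ⊢
      exact h.cube_mono hi hj le_rfl hk
    inBox := by
      refine ⟨fun i j hij => ?_, fun i j => ?_⟩
      · by_contra h0
        have := (hmem i j 0).1 (Nat.pos_of_ne_zero h0)
        unfold Cube at this
        omega
      · exact (card_filter_le _ _).trans (card_range _).le
    symm := fun i j => le_antisymm
      (le_of_forall_lt fun k hk => by rw [hmem] at hk ⊢; exact hk.swap)
      (le_of_forall_lt fun k hk => by rw [hmem] at hk ⊢; exact hk.swap)
    cyclic := fun i j k hc => by
      unfold PlanePartition.Mem at hc ⊢
      rw [hmem] at hc ⊢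
      exact hc.rotate
    selfCompl := fun i j hi hj => by
      change ((range (2 * n)).filter (Cube n μ i j)).card =
        2 * n - ((range (2 * n)).filter (Cube n μ (2 * n - 1 - i) (2 * n - 1 - j))).card
      have hc : ∀ k, k < 2 * n → (k < ((range (2 * n)).filter (Cube n μ i j)).card ↔
          ¬ 2 * n - 1 - k < ((range (2 * n)).filter
            (Cube n μ (2 * n - 1 - i) (2 * n - 1 - j))).card) := by
        intro k hk
        rw [hmem, hmem]
        exact Cube.compl hi hj hk
      have b1 := (card_filter_le (range (2 * n)) (Cube n μ i j)).trans (card_range _).le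
      generalize ((range (2 * n)).filter (Cube n μ i j)).card = x at *
      have b2 := (card_filter_le (range (2 * n))
        (Cube n μ (2 * n - 1 - i) (2 * n - 1 - j))).trans (card_range _).le
      generalize ((range (2 * n)).filter (Cube n μ (2 * n - 1 - i) (2 * n - 1 - j))).card = y at *
      refine le_antisymm (le_of_forall_lt fun k hk => ?_) (le_of_forall_lt fun k hk => ?_)
      · have := (hc k (by omega)).1 hk
        omega
      · exact (hc k (by omega)).2 (by omega) }

theorem TSSCPP.mem_ofDepth {n : ℕ} {μ : ℕ → ℕ → ℕ} (h : IsDepth n μ) (i j k : ℕ) :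
    (TSSCPP.ofDepth h).Mem i j k ↔ Cube n μ i j k := by
  classical
  unfold PlanePartition.Mem ofDepth
  exact lt_card_filter_range_iff (f := Cube n μ i j)
    (fun _ hc => h.cube_mono le_rfl le_rfl (Nat.le_succ _) hc) (fun _ hc => hc.2.2.1) k

theorem TSSCPP.depth_ofDepth {n : ℕ} {μ : ℕ → ℕ → ℕ} (h : IsDepth n μ) (k d : ℕ) :
    (TSSCPP.ofDepth h).depth (k + 1) d = μ (k + 1) d := by
  have key : ∀ p, p < (TSSCPP.ofDepth h).depth (k + 1) d ↔ p < μ (k + 1) d := by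
    intro p
    rw [TSSCPP.lt_depth_iff, TSSCPP.mem_ofDepth]
    have hf : Fund μ p (p + d) k ↔ p < μ (k + 1) d := by
      unfold Fund
      rw [min_eq_left (by omega), max_eq_right (by omega), Nat.add_sub_cancel_left]
    unfold Cube
    rw [if_neg (by omega), if_neg (by omega), Nat.add_assoc, Nat.add_sub_cancel_left,
      Nat.add_sub_cancel_left, hf]
    constructor
    · rintro ⟨-, -, -, hc⟩
      split_ifs at hc
      exact hc
    · intro hp
      have := h.bound _ _ _ hp
      rw [if_pos (by omega)]
      exact ⟨by omega, by omega, by omega, hp⟩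
  exact le_antisymm (le_of_forall_lt fun p hp => (key p).1 hp)
    (le_of_forall_lt fun p hp => (key p).2 hp)

/-! ### The depths prescribed by a pipe dream -/

namespace PipeDream

variable {n : ℕ} (P : PipeDream n)

/-- The number of elbow tiles of `P` on the antidiagonal `r + c = n + 1 - l` in the rows
`r > d`. -/
def elbows (l d : ℕ) : ℕ :=
  ((range n).filter fun e => d ≤ e ∧ e + l < n ∧ (e + 1, n - l - e) ∉ P.crosses).card

theorem elbows_eq_zero {l d : ℕ} (h : n ≤ d + l) : P.elbows l d = 0 := by
  unfold elbows
  rw [card_eq_zero, filter_eq_empty_iff]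
  intro e _ he
  omega

theorem elbows_eq (l d : ℕ) : P.elbows l d = P.elbows l (d + 1) +
    if d + l < n ∧ (d + 1, n - l - d) ∉ P.crosses then 1 else 0 := by
  unfold elbows
  split_ifs with h
  · have hs : ((range n).filter fun e => d ≤ e ∧ e + l < n ∧ (e + 1, n - l - e) ∉ P.crosses) =
        insert d ((range n).filter fun e =>
          d + 1 ≤ e ∧ e + l < n ∧ (e + 1, n - l - e) ∉ P.crosses) := by
      ext e
      simp only [mem_filter, mem_range, mem_insert]
      constructor
      · rintro ⟨h1, h2, h3⟩
        by_cases hde : e = d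
        · exact Or.inl hde
        · exact Or.inr ⟨h1, by omega, h3⟩
      · rintro (rfl | ⟨h1, h2, h3⟩)
        · exact ⟨by omega, le_rfl, h⟩
        · exact ⟨h1, by omega, h3⟩
    rw [hs, card_insert_of_notMem (by simp)]
  · rw [Nat.add_zero]
    refine congrArg card (filter_congr fun e _ => ?_)
    constructor
    · rintro ⟨h2, h3⟩
      refine ⟨?_, h3⟩
      by_contra hlt
      obtain rfl : e = d := by omega
      exact h h3
    · rintro ⟨h2, h3⟩
      exact ⟨by omega, h3⟩

theorem elbows_add_le {l d : ℕ} (h : d + l ≤ n) : P.elbows l d + d + l ≤ n := by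
  by_cases hd : d + l = n
  · rw [P.elbows_eq_zero (by omega)]
    omega
  · have := elbows_add_le (l := l) (d := d + 1) (by omega)
    rw [elbows_eq]
    split_ifs <;> omega
termination_by n - d

/-- The numbers of elbow tiles on consecutive antidiagonals satisfy the condition for the lattice
paths of a TSSCPP to be non-intersecting. -/
def IsNest : Prop := ∀ l d, 1 ≤ l → P.elbows (l + 1) d ≤ P.elbows l d

variable {P}

theorem IsNest.isDepth (h : P.IsNest) : IsDepth n P.elbows where
  succ_le l d := by rw [P.elbows_eq l d]; omega
  le_succ l d := by rw [P.elbows_eq l d]; split_ifs <;> omega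
  level := h
  bound l d p hp := by
    have hd : d + l ≤ n := by
      by_contra hlt
      rw [P.elbows_eq_zero (by omega)] at hp
      omega
    have := P.elbows_add_le hd
    omega

theorem IsNest.exists_tsscpp (h : P.IsNest) : ∃ T : TSSCPP n, T.pipeDream = P := by
  refine ⟨TSSCPP.ofDepth h.isDepth, ?_⟩
  ext ⟨r, c⟩
  by_cases hv : 1 ≤ r ∧ 1 ≤ c ∧ r + c ≤ n
  · obtain ⟨d, rfl⟩ : ∃ d, r = d + 1 := ⟨r - 1, by omega⟩
    obtain ⟨k, rfl⟩ : ∃ k, c = n - (k + 1) - d := ⟨n - 1 - d - c, by omega⟩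
    rw [TSSCPP.mem_pipeDream_iff_depth _ (by omega), TSSCPP.depth_ofDepth, TSSCPP.depth_ofDepth,
      elbows_eq]
    have hb : d + (k + 1) < n := by omega
    by_cases hc : (d + 1, n - (k + 1) - d) ∈ P.crosses
    · simp [hc]
    · simp [hc, hb]
  · exact ⟨fun hm => absurd ((TSSCPP.pipeDream _).valid _ hm) hv, fun hm => absurd (P.valid _ hm) hv⟩

/-- In a left-justified pipe dream the tile to the right of an elbow tile is an elbow tile. -/
theorem IsJustified.isNest {l : ℕ → ℕ} (h : P.IsJustified l) : P.IsNest := by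
  intro m d hm
  refine card_le_card fun e => ?_
  simp only [mem_filter, h (e + 1)]
  rintro ⟨h1, h2, h3, h4⟩
  exact ⟨h1, h2, by omega, by omega⟩

end PipeDream

/-- A slide moves an elbow tile down by one row on its antidiagonal. -/
theorem SimpleSlide.elbows_eq {n r : ℕ} {P P' : PipeDream n} {c : ℕ}
    (h1 : (r + 1, c) ∈ P.crosses) (h3 : (r, c + 1) ∉ P.crosses)
    (h4 : P'.crosses = insert (r, c + 1) (P.crosses.erase (r + 1, c))) (l d : ℕ) :
    P'.elbows l d = P.elbows l d + if r + c + l = n ∧ d = r then 1 else 0 := by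
  have hmem : ∀ q, q ∈ P'.crosses ↔ q = (r, c + 1) ∨ (q ≠ (r + 1, c) ∧ q ∈ P.crosses) := by
    intro q; rw [h4, mem_insert, mem_erase]
  have hv := P.valid _ h1
  have hv' := P'.valid (r, c + 1) ((hmem _).2 (Or.inl rfl))
  simp only at hv hv'
  by_cases hd : n ≤ d
  · rw [P.elbows_eq_zero (by omega), P'.elbows_eq_zero (by omega), if_neg (by omega)]
  · have ih := SimpleSlide.elbows_eq h1 h3 h4 l (d + 1)
    rw [P.elbows_eq, P'.elbows_eq, ih]
    by_cases hl : r + c + l = n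
    · have e1 : n - l - r = c := by omega
      by_cases hdr : d = r
      · subst hdr
        have m1 : (d + 1, c) ∉ P'.crosses := by rw [hmem]; simp
        rw [e1, if_neg (by omega), if_pos ⟨by omega, m1⟩, if_neg (fun h => h.2 h1),
          if_pos ⟨hl, rfl⟩]
      · by_cases hdr' : d + 1 = r
        · have e2 : n - l - d = c + 1 := by omega
          have m1 : (d + 1, c + 1) ∈ P'.crosses := by rw [hmem, hdr']; simp
          rw [e2, if_pos ⟨hl, hdr'⟩, if_neg (fun h => h.2 m1), hdr', if_pos ⟨by omega, h3⟩,
            if_neg (by omega)]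
        · have e3 : (d + 1, n - l - d) ∈ P'.crosses ↔ (d + 1, n - l - d) ∈ P.crosses := by
            rw [hmem]; simp only [Prod.mk.injEq]; constructor
            · rintro (h | h)
              · omega
              · exact h.2
            · exact fun h => Or.inr ⟨by simp only [ne_eq, Prod.mk.injEq]; omega, h⟩
          simp only [e3]
          rw [if_neg (show ¬ (r + c + l = n ∧ d + 1 = r) by omega),
            if_neg (show ¬ (r + c + l = n ∧ d = r) by omega)]
          omega
    · have e3 : d + l < n → ((d + 1, n - l - d) ∈ P'.crosses ↔ (d + 1, n - l - d) ∈ P.crosses) := by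
        intro hdl
        rw [hmem]; simp only [Prod.mk.injEq]; constructor
        · rintro (h | h)
          · omega
          · exact h.2
        · exact fun h => Or.inr ⟨by simp only [ne_eq, Prod.mk.injEq]; omega, h⟩
      have e4 : (d + l < n ∧ (d + 1, n - l - d) ∉ P'.crosses) ↔
          (d + l < n ∧ (d + 1, n - l - d) ∉ P.crosses) :=
        and_congr_right fun hdl => not_congr (e3 hdl)
      simp only [e4]
      rw [if_neg (show ¬ (r + c + l = n ∧ d + 1 = r) by omega),
        if_neg (show ¬ (r + c + l = n ∧ d = r) by omega)]
      omega
termination_by n - d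

theorem SimpleSlide.isNest {n r : ℕ} {P P' : PipeDream n} (h : SimpleSlide r P P')
    (hn : P.IsNest) : P'.IsNest := by
  obtain ⟨c, h1, h2, h3, h4, h5⟩ := h
  intro l d hl
  have hv := P.valid _ h1
  simp only at hv
  rw [SimpleSlide.elbows_eq h1 h4 h5, SimpleSlide.elbows_eq h1 h4 h5]
  have := hn l d hl
  by_cases hld : r + c + (l + 1) = n ∧ d = r
  · obtain ⟨hld, rfl⟩ := hld
    -- on the antidiagonal of the south-east corner of the square there is one more elbow tile
    have e1 := P.elbows_eq l d
    have e2 := P.elbows_eq (l + 1) d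
    have e3 := hn l (d + 1) hl
    rw [show n - l - d = c + 1 by omega, if_pos ⟨by omega, h2⟩] at e1
    rw [show n - (l + 1) - d = c by omega, if_neg (fun h => h.2 h1)] at e2
    rw [if_pos ⟨hld, rfl⟩]
    omega
  · rw [if_neg hld]
    omega

theorem SlideLE.bottom_exists_tsscpp {n : ℕ} {π : Equiv.Perm (Fin n)} {P : PipeDream n}
    (h : SlideLE (bottomPD π) P) : ∃ T : TSSCPP n, T.pipeDream = P := by
  apply PipeDream.IsNest.exists_tsscpp
  induction h with
  | refl => exact (PipeDream.bottomPD_isJustified π).isNest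
  | tail _ hs ih =>
    obtain ⟨r, hs⟩ := hs
    exact hs.isNest ih

/-- Taking the pipe dream is a bijection from the TSSCPPs with reduced pipe dream and permutation
`π` to the pipe dreams reached from the bottom by slides. -/
theorem IsShuffle.exists_slideEquiv {n k : ℕ} {π : Equiv.Perm (Fin n)} (hπ : IsShuffle π k) :
    ∃ β : TSSCPPRed π ≃ Slide π, ∀ T, (β T).1 = T.1.pipeDream := by
  refine ⟨Equiv.ofBijective
    (fun T => ⟨T.1.pipeDream, hπ.slideLE _ _ rfl T.2.1 T.2.2⟩) ⟨?_, ?_⟩, fun _ => rfl⟩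
  · intro T T' h
    exact Subtype.ext (TSSCPP.pipeDream_injective (congrArg Subtype.val h))
  · rintro ⟨P, hP⟩
    obtain ⟨T, hT⟩ := hP.bottom_exists_tsscpp
    have := hP.bottom_hasPerm_isReduced
    rw [← hT] at this
    exact ⟨⟨T, this.2, this.1⟩, Subtype.ext hT⟩

/-! ### Alternating sign matrices and bumpless pipe dreams -/

theorem partialSum_eq_of_step {n : ℕ} {v : Fin n → ℤ} {e : ℕ → ℤ} (h0 : e 0 = 0)
    (hv : ∀ k (h : k < n), v ⟨k, h⟩ = e (k + 1) - e k) : ∀ k ≤ n, partialSum v k = e k := by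
  intro k
  induction k with
  | zero => intro _; rw [partialSum_zero, h0]
  | succ k ih =>
    intro hk
    rw [partialSum_succ v k hk, ih (by omega), hv k hk]
    ring

/-- The differences of a sequence of zeros and ones from `0` to `1` form a row of an alternating
sign matrix. -/
theorem isAltLine_of_step {n : ℕ} {v : Fin n → ℤ} {e : ℕ → ℤ} (h0 : e 0 = 0) (hn : e n = 1)
    (he : ∀ k, e k = 0 ∨ e k = 1) (hv : ∀ k (h : k < n), v ⟨k, h⟩ = e (k + 1) - e k) :
    IsAltLine v where
  entries k := by
    have h1 := hv k k.isLt
    rw [Fin.eta] at h1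
    rcases he k with h | h <;> rcases he (k.val + 1) with h' | h' <;> rw [h1, h, h'] <;> norm_num
  sum_eq := by
    rw [← hn, ← partialSum_eq_of_step h0 hv n le_rfl]
    simp [partialSum]
  alt k l hkl hk hl hz := by
    have hc : ∀ d, k.val + 1 + d ≤ l.val → e (k.val + 1 + d) = e (k.val + 1) := by
      intro d
      induction d with
      | zero => intro _; rfl
      | succ d ih =>
        intro hd
        have h1 := hv (k.val + 1 + d) (by omega)
        rw [hz ⟨k.val + 1 + d, by omega⟩ (by rw [Fin.lt_def]; simp only; omega)
          (by rw [Fin.lt_def]; simp only; omega)] at h1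
        rw [← ih (by omega), ← Nat.add_assoc]
        linarith
    have hkl' : k.val < l.val := hkl
    have hl' := hc (l.val - (k.val + 1)) (by omega)
    rw [Nat.add_sub_cancel' (by omega)] at hl'
    have h1 := hv k k.isLt
    have h2 := hv l l.isLt
    rw [Fin.eta] at h1 h2
    rw [hl'] at h2
    rw [h1] at hk
    rw [h2] at hl
    rw [h1, h2]
    rcases he k with a | a <;> rcases he (k.val + 1) with b | b <;>
      rcases he (l.val + 1) with c | c <;> rw [a, b] at hk <;> rw [b, c] at hl <;> rw [a, b, c] <;>
      revert hk hl <;> norm_num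

/-- The entry of an alternating sign matrix encoded by a tile. -/
def Tile.entry : Tile → ℤ
  | .southEast => 1
  | .northWest => -1
  | _ => 0

namespace BPD

variable {n : ℕ} (D : BPD n)

/-- Is there a pipe through the `k`-th vertical edge of row `i`? -/
def rowEdge (i : Fin n) (k : ℕ) : ℤ :=
  if h : k < n then (if (D.tile i ⟨k, h⟩).left then 1 else 0) else 1

/-- Is there a pipe through the `k`-th horizontal edge of column `j`? -/
def colEdge (j : Fin n) (k : ℕ) : ℤ :=
  if h : k < n then (if (D.tile ⟨k, h⟩ j).top then 1 else 0) else 1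

theorem rowEdge_zero (i : Fin n) : D.rowEdge i 0 = 0 := by
  have : 0 < n := i.pos
  rw [rowEdge, dif_pos this, D.west i ⟨0, this⟩ rfl]
  rfl

theorem colEdge_zero (j : Fin n) : D.colEdge j 0 = 0 := by
  have : 0 < n := j.pos
  rw [colEdge, dif_pos this, D.north ⟨0, this⟩ j rfl]
  rfl

theorem rowEdge_succ (i j : Fin n) :
    D.rowEdge i (j.val + 1) = if (D.tile i j).right then 1 else 0 := by
  unfold rowEdge
  split_ifs with h h1 h2 h2 h1
  · rfl
  · rw [D.match_row i j ⟨j.val + 1, h⟩ rfl] at h2; exact absurd h1 h2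
  · rw [D.match_row i j ⟨j.val + 1, h⟩ rfl] at h2; exact absurd h2 h1
  · rfl
  · rfl
  · exact absurd (D.east i j (by have := j.isLt; omega)) h1

theorem colEdge_succ (i j : Fin n) :
    D.colEdge j (i.val + 1) = if (D.tile i j).bottom then 1 else 0 := by
  unfold colEdge
  split_ifs with h h1 h2 h2 h1
  · rfl
  · rw [D.match_col i ⟨i.val + 1, h⟩ j rfl] at h2; exact absurd h1 h2
  · rw [D.match_col i ⟨i.val + 1, h⟩ j rfl] at h2; exact absurd h2 h1
  · rfl
  · rfl
  · exact absurd (D.south i j (by have := i.isLt; omega)) h1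

theorem entry_eq_row (i : Fin n) (k : ℕ) (h : k < n) :
    (D.tile i ⟨k, h⟩).entry = D.rowEdge i (k + 1) - D.rowEdge i k := by
  have := D.rowEdge_succ i ⟨k, h⟩
  simp only at this
  rw [this, rowEdge, dif_pos h]
  cases D.tile i ⟨k, h⟩ <;> simp [Tile.entry, Tile.left, Tile.right]

theorem entry_eq_col (j : Fin n) (k : ℕ) (h : k < n) :
    (D.tile ⟨k, h⟩ j).entry = D.colEdge j (k + 1) - D.colEdge j k := by
  have := D.colEdge_succ ⟨k, h⟩ j
  simp only at this
  rw [this, colEdge, dif_pos h]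
  cases D.tile ⟨k, h⟩ j <;> simp [Tile.entry, Tile.top, Tile.bottom]

/-- The alternating sign matrix of a bumpless pipe dream. -/
def toASM : ASM n where
  mat i j := (D.tile i j).entry
  row i := isAltLine_of_step (e := D.rowEdge i) (D.rowEdge_zero i)
    (by rw [rowEdge, dif_neg (lt_irrefl n)])
    (fun k => by unfold rowEdge; split_ifs <;> simp) (D.entry_eq_row i)
  col j := isAltLine_of_step (e := D.colEdge j) (D.colEdge_zero j)
    (by rw [colEdge, dif_neg (lt_irrefl n)])
    (fun k => by unfold colEdge; split_ifs <;> simp) (D.entry_eq_col j)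

theorem toASM_toBPD : D.toASM.toBPD = D := by
  ext i j
  have hr : D.toASM.rowSum i j = D.rowEdge i (j.val + 1) :=
    partialSum_eq_of_step (D.rowEdge_zero i) (D.entry_eq_row i) _ j.isLt
  have hc : D.toASM.colSum i j = D.colEdge j (i.val + 1) :=
    partialSum_eq_of_step (D.colEdge_zero j) (D.entry_eq_col j) _ i.isLt
  have hm : D.toASM.mat i j = (D.tile i j).entry := rfl
  change D.toASM.tileAt i j = D.tile i j
  rw [ASM.tileAt, hr, hc, hm, D.rowEdge_succ, D.colEdge_succ]
  cases D.tile i j <;> simp [Tile.entry, Tile.right, Tile.bottom]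

end BPD

theorem ASM.entry_tileAt {n : ℕ} (A : ASM n) (i j : Fin n) : (A.tileAt i j).entry = A.mat i j := by
  unfold ASM.tileAt
  rcases (A.row i).entries j with h | h | h <;> rw [h] <;> simp [Tile.entry]
  split_ifs <;> rfl

theorem ASM.toBPD_injective {n : ℕ} : Function.Injective (ASM.toBPD (n := n)) := by
  intro A B h
  ext i j
  rw [← A.entry_tileAt, ← B.entry_tileAt]
  exact congrArg Tile.entry (congrFun (congrFun (congrArg BPD.tile h) i) j)

/-- An alternating sign matrix without negative entries is a permutation matrix. -/
theorem ASM.exists_eq_permASM {n : ℕ} (A : ASM n) (h : ∀ i j, A.mat i j ≠ -1) :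
    ∃ π : Equiv.Perm (Fin n), A = permASM π := by
  have h01 : ∀ i j, A.mat i j = 0 ∨ A.mat i j = 1 := by
    intro i j
    have := (A.row i).entries j
    have := h i j
    tauto
  have uniq : ∀ v : Fin n → ℤ, (∀ k, v k = 0 ∨ v k = 1) → ∑ k, v k = 1 →
      (∃ k, v k = 1) ∧ ∀ k l, v k = 1 → v l = 1 → k = l := by
    intro v hv hs
    constructor
    · by_contra hne
      push Not at hne
      rw [sum_eq_zero fun k _ => (hv k).resolve_right (hne k)] at hs
      exact absurd hs (by norm_num)
    · intro k l hk hl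
      by_contra hkl
      have h2 : ∑ x ∈ {k, l}, v x ≤ ∑ x, v x :=
        sum_le_sum_of_subset_of_nonneg (subset_univ _) fun x _ _ => by
          rcases hv x with h | h <;> simp [h]
      rw [sum_pair hkl, hk, hl, hs] at h2
      norm_num at h2
  have hr := fun i => uniq (fun j => A.mat i j) (h01 i) (A.row i).sum_eq
  have hc := fun j => uniq (fun i => A.mat i j) (fun i => h01 i j) (A.col j).sum_eq
  choose f hf using fun i => (hr i).1
  have hinj : Function.Injective f := by
    intro i i' he
    have h1 := hf i
    rw [he] at h1
    exact (hc _).2 _ _ h1 (hf i')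
  refine ⟨Equiv.ofBijective f (Finite.injective_iff_bijective.1 hinj), ?_⟩
  ext i j
  change A.mat i j = if f i = j then 1 else 0
  split_ifs with hij
  · rw [← hij]; exact hf i
  · exact (h01 i j).resolve_right fun h1 => hij ((hr i).2 _ _ (hf i) h1)

/-! ### Labels of bumpless pipe dreams -/

namespace BPD

variable {n : ℕ} (D : BPD n)

theorem get_eq {i j : ℕ} (hi : i < n) (hj : j < n) : D.get i j = D.tile ⟨i, hi⟩ ⟨j, hj⟩ :=
  dif_pos ⟨hi, hj⟩

theorem get_val (i j : Fin n) : D.get i j = D.tile i j := D.get_eq i.isLt j.isLt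

theorem get_match_row {i j : ℕ} (hi : i < n) (hj : j + 1 < n) :
    (D.get i j).right = (D.get i (j + 1)).left := by
  rw [D.get_eq hi (by omega), D.get_eq hi hj]
  exact D.match_row _ _ _ rfl

theorem get_match_col {i j : ℕ} (hi : i + 1 < n) (hj : j < n) :
    (D.get i j).bottom = (D.get (i + 1) j).top := by
  rw [D.get_eq (by omega) hj, D.get_eq hi hj]
  exact D.match_col _ _ _ rfl

theorem get_west {i : ℕ} (hi : i < n) : (D.get i 0).left = false := by
  rw [D.get_eq hi (by omega)]
  exact D.west _ _ rfl

theorem get_north {j : ℕ} (hj : j < n) : (D.get 0 j).top = false := by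
  rw [D.get_eq (by omega) hj]
  exact D.north _ _ rfl

theorem get_east {i j : ℕ} (hi : i < n) (hj : j + 1 = n) : (D.get i j).right = true := by
  rw [D.get_eq hi (by omega)]
  exact D.east _ _ hj

theorem get_south {i j : ℕ} (hi : i + 1 = n) (hj : j < n) : (D.get i j).bottom = true := by
  rw [D.get_eq (by omega) hj]
  exact D.south _ _ hi

/-- The label on the bottom edge of the tile `(i,j)`. -/
def botLabel (i j : ℕ) : ℕ := D.colLabel (n - 1 - i) j

/-- The label on the left edge of the tile `(i,j)`. -/
def leftLabel (i j : ℕ) : ℕ := ASMTSSCPP.rowLabel (D.get i) (D.botLabel i) j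

/-- The label on the top edge of the tile `(i,j)`. -/
def topLabel (i j : ℕ) : ℕ := (D.get i j).outTop (D.leftLabel i j) (D.botLabel i j)

theorem leftLabel_zero (i : ℕ) : D.leftLabel i 0 = 0 := rfl

theorem leftLabel_succ (i j : ℕ) :
    D.leftLabel i (j + 1) = (D.get i j).outRight (D.leftLabel i j) (D.botLabel i j) := rfl

theorem exitLabel_eq (i : ℕ) : D.exitLabel i = D.leftLabel i n := rfl

theorem botLabel_last {i : ℕ} (hi : n ≤ i + 1) (j : ℕ) : D.botLabel i j = j + 1 := by
  unfold botLabel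
  rw [show n - 1 - i = 0 by omega]
  rfl

theorem botLabel_eq {i : ℕ} (hi : i + 1 < n) (j : ℕ) : D.botLabel i j = D.topLabel (i + 1) j := by
  unfold botLabel topLabel leftLabel botLabel
  have h1 : n - 1 - i = n - 1 - (i + 1) + 1 := by omega
  have h2 : n - 1 - (n - 1 - (i + 1)) = i + 1 := by omega
  rw [h1, colLabel, h2]

/-- Induction over the rows from the bottom to the top. -/
theorem row_induction {n : ℕ} {C : ℕ → Prop} (h0 : ∀ i, i + 1 = n → C i)
    (hs : ∀ i, i + 1 < n → C (i + 1) → C i) : ∀ i, i < n → C i := by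
  intro i hi
  by_cases h : i + 1 = n
  · exact h0 i h
  · exact hs i (by omega) (row_induction h0 hs (i + 1) (by omega))
termination_by i => n - i

/-- An edge carries a label if and only if there is a pipe through it. -/
theorem label_ne_zero_iff : ∀ i, i < n → ∀ j, j < n →
    (D.botLabel i j ≠ 0 ↔ (D.get i j).bottom = true) ∧
    (D.leftLabel i j ≠ 0 ↔ (D.get i j).left = true) := by
  have left : ∀ i, i < n → (∀ j, j < n → (D.botLabel i j ≠ 0 ↔ (D.get i j).bottom = true)) →
      ∀ j, j < n → (D.leftLabel i j ≠ 0 ↔ (D.get i j).left = true) := by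
    intro i hi hb j
    induction j with
    | zero => intro _; rw [leftLabel_zero, D.get_west hi]; simp
    | succ j ih =>
      intro hj
      have hl := ih (by omega)
      have hb := hb j (by omega)
      rw [leftLabel_succ, ← D.get_match_row hi hj]
      revert hl hb
      cases D.get i j <;>
        simp [Tile.outRight, Tile.left, Tile.right, Tile.bottom] <;> omega
  refine row_induction ?_ ?_
  · intro i hi j hj
    have hb : ∀ j, j < n → (D.botLabel i j ≠ 0 ↔ (D.get i j).bottom = true) := by
      intro j hj
      rw [D.get_south hi hj, D.botLabel_last (by omega)]
      simp
    exact ⟨hb j hj, left i (by omega) hb j hj⟩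
  · intro i hi ih j hj
    have hb : ∀ j, j < n → (D.botLabel i j ≠ 0 ↔ (D.get i j).bottom = true) := by
      intro j hj
      obtain ⟨hb, hl⟩ := ih j hj
      rw [D.get_match_col hi hj, D.botLabel_eq hi, topLabel]
      revert hl hb
      cases D.get (i + 1) j <;>
        simp [Tile.outTop, Tile.left, Tile.top, Tile.bottom] <;> omega
    exact ⟨hb j hj, left i (by omega) hb j hj⟩

theorem botLabel_ne_zero_iff {i j : ℕ} (hi : i < n) (hj : j < n) :
    D.botLabel i j ≠ 0 ↔ (D.get i j).bottom = true := (D.label_ne_zero_iff i hi j hj).1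

theorem leftLabel_ne_zero_iff {i j : ℕ} (hi : i < n) (hj : j < n) :
    D.leftLabel i j ≠ 0 ↔ (D.get i j).left = true := (D.label_ne_zero_iff i hi j hj).2

theorem topLabel_ne_zero_iff {i j : ℕ} (hi : i < n) (hj : j < n) :
    D.topLabel i j ≠ 0 ↔ (D.get i j).top = true := by
  have hb := D.botLabel_ne_zero_iff hi hj
  have hl := D.leftLabel_ne_zero_iff hi hj
  rw [topLabel]
  revert hl hb
  cases D.get i j <;> simp [Tile.outTop, Tile.left, Tile.top, Tile.bottom] <;> omega

theorem HasPerm.unique {D : BPD n} {π π' : Equiv.Perm (Fin n)} (h : D.HasPerm π)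
    (h' : D.HasPerm π') : π = π' := by
  ext i
  have h1 := h i
  have h2 := h' i
  omega

end BPD

/-! ### The Rothe bumpless pipe dream -/

theorem partialSum_single {n : ℕ} (a : Fin n) (m : ℕ) :
    partialSum (fun k : Fin n => if a = k then (1 : ℤ) else 0) m = if a.val < m then 1 else 0 := by
  unfold partialSum
  rw [sum_ite_eq]
  simp

theorem rothe_tile {n : ℕ} (π : Equiv.Perm (Fin n)) (i j : Fin n) :
    (rothe π).tile i j =
      if π i = j then .southEast
      else if i < π.symm j then (if j < π i then .blank else .horiz)
      else (if j < π i then .vert else .cross) := by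
  have hr : (permASM π).rowSum i j = if (π i).val < j.val + 1 then 1 else 0 :=
    partialSum_single (π i) _
  have hc : (permASM π).colSum i j = if (π.symm j).val < i.val + 1 then 1 else 0 := by
    rw [← partialSum_single]
    unfold ASM.colSum
    congr 1
    funext k
    change (if π k = j then (1 : ℤ) else 0) = _
    have : π k = j ↔ π.symm j = k := by
      rw [Equiv.symm_apply_eq]
      exact eq_comm
    simp only [this]
  have hm : (permASM π).mat i j = if π i = j then 1 else 0 := rfl
  change (permASM π).tileAt i j = _
  rw [ASM.tileAt, hr, hc, hm]
  by_cases h1 : π i = j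
  · simp [h1]
  · simp only [h1, if_false, Fin.lt_def]
    by_cases h2 : i.val < (π.symm j).val <;> by_cases h3 : j.val < (π i).val
    · rw [if_neg (show ¬ (π.symm j).val < i.val + 1 by omega),
        if_neg (show ¬ (π i).val < j.val + 1 by omega)]; simp [h2, h3]
    · rw [if_neg (show ¬ (π.symm j).val < i.val + 1 by omega),
        if_pos (show (π i).val < j.val + 1 by omega)]; simp [h2, h3]
    · rw [if_pos (show (π.symm j).val < i.val + 1 by omega),
        if_neg (show ¬ (π i).val < j.val + 1 by omega)]; simp [h2, h3]
    · rw [if_pos (show (π.symm j).val < i.val + 1 by omega),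
        if_pos (show (π i).val < j.val + 1 by omega)]; simp [h2, h3]

theorem rothe_hasPerm {n : ℕ} (π : Equiv.Perm (Fin n)) : (rothe π).HasPerm π := by
  have left : ∀ i : Fin n, (∀ j : Fin n, (rothe π).botLabel i j =
      if π.symm j ≤ i then j.val + 1 else 0) → ∀ j, j ≤ n →
      (rothe π).leftLabel i j = if (π i).val < j then (π i).val + 1 else 0 := by
    intro i hb j
    induction j with
    | zero => intro _; rfl
    | succ j ih =>
      intro hj
      have ih := ih (by omega)
      have hb := hb ⟨j, hj⟩
      simp only at hb
      rw [BPD.leftLabel_succ, ih, hb, BPD.get_eq _ i.isLt hj, Fin.eta, rothe_tile]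
      by_cases h1 : π i = ⟨j, hj⟩
      · have h2 : π.symm ⟨j, hj⟩ = i := by rw [← h1, Equiv.symm_apply_apply]
        have h3 : (π i).val = j := congrArg Fin.val h1
        simp [h1, h2, Tile.outRight]
      · have h3 : (π i).val ≠ j := fun h => h1 (Fin.ext h)
        have e1 : (⟨j, hj⟩ : Fin n) < π i ↔ ¬ (π i).val < j := by
          rw [Fin.lt_def]; simp only; omega
        have e2 : (π i).val < j + 1 ↔ (π i).val < j := by omega
        have e3 : i < π.symm ⟨j, hj⟩ ↔ ¬ π.symm ⟨j, hj⟩ ≤ i := not_le.symm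
        simp only [h1, if_false, e1, e2, e3]
        split_ifs <;> (simp [Tile.outRight]; try omega)
  have bot : ∀ i, i < n → ∀ (hi : i < n) (j : Fin n), (rothe π).botLabel i j =
      if π.symm j ≤ ⟨i, hi⟩ then j.val + 1 else 0 := by
    refine BPD.row_induction ?_ ?_
    · intro i hn hi j
      rw [BPD.botLabel_last _ (by omega), if_pos]
      rw [Fin.le_def]
      have := (π.symm j).isLt
      simp only
      omega
    · intro i hn ih hi j
      have ih := ih hn
      have hl := left ⟨i + 1, hn⟩ ih j j.isLt.le
      simp only at hl
      rw [BPD.botLabel_eq _ hn, BPD.topLabel, hl, ih j, BPD.get_eq _ hn j.isLt, Fin.eta, rothe_tile]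
      by_cases h1 : π ⟨i + 1, hn⟩ = j
      · have h2 : π.symm j = ⟨i + 1, hn⟩ := by rw [← h1, Equiv.symm_apply_apply]
        simp [h1, h2, Tile.outTop]
      · have h3 : (π ⟨i + 1, hn⟩).val ≠ j := fun h => h1 (Fin.ext h)
        have h4 : (π.symm j).val ≠ i + 1 := fun h => h1 (by
          rw [← Equiv.eq_symm_apply]; exact Fin.ext h.symm)
        have e1 : j < π ⟨i + 1, hn⟩ ↔ ¬ (π ⟨i + 1, hn⟩).val < j := by
          rw [Fin.lt_def]; omega
        have e2 : π.symm j ≤ ⟨i, hi⟩ ↔ π.symm j ≤ ⟨i + 1, hn⟩ := by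
          rw [Fin.le_def, Fin.le_def]; simp only; omega
        have e3 : ⟨i + 1, hn⟩ < π.symm j ↔ ¬ π.symm j ≤ ⟨i + 1, hn⟩ := not_le.symm
        simp only [h1, if_false, e1, e2, e3]
        split_ifs <;> (simp [Tile.outTop]; try omega)
  intro i
  rw [BPD.exitLabel_eq, left i (bot i i.isLt i.isLt) n le_rfl, if_pos (π i).isLt]

/-! ### Simple droops -/

/-- The four tiles of a `2 × 2` square of a bumpless pipe dream may be replaced by other tiles
which match along the inner edges and have the same outer edges. -/
theorem BPD.exists_replace {n : ℕ} (D : BPD n) {i i' j j' : Fin n} (hi : i'.val = i.val + 1)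
    (hj : j'.val = j.val + 1) {t00 t01 t10 t11 : Tile}
    (h00 : t00.left = (D.tile i j).left ∧ t00.top = (D.tile i j).top)
    (h01 : t01.right = (D.tile i j').right ∧ t01.top = (D.tile i j').top)
    (h10 : t10.left = (D.tile i' j).left ∧ t10.bottom = (D.tile i' j).bottom)
    (h11 : t11.right = (D.tile i' j').right ∧ t11.bottom = (D.tile i' j').bottom)
    (hin : t00.right = t01.left ∧ t10.right = t11.left ∧ t00.bottom = t10.top ∧
      t01.bottom = t11.top) :
    ∃ D' : BPD n, D'.tile i j = t00 ∧ D'.tile i j' = t01 ∧ D'.tile i' j = t10 ∧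
      D'.tile i' j' = t11 ∧
      ∀ a b : Fin n, ¬ ((a = i ∨ a = i') ∧ (b = j ∨ b = j')) → D'.tile a b = D.tile a b := by
  have hii : i ≠ i' := fun h => by rw [h] at hi; omega
  have hjj : j ≠ j' := fun h => by rw [h] at hj; omega
  let f : Fin n → Fin n → Tile := fun a b =>
    if a = i ∧ b = j then t00 else if a = i ∧ b = j' then t01 else
    if a = i' ∧ b = j then t10 else if a = i' ∧ b = j' then t11 else D.tile a b
  have f00 : f i j = t00 := by simp [f]
  have f01 : f i j' = t01 := by simp [f, hjj.symm]
  have f10 : f i' j = t10 := by simp [f, hii.symm]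
  have f11 : f i' j' = t11 := by simp [f, hii.symm, hjj.symm]
  have foff : ∀ a b : Fin n, ¬ ((a = i ∨ a = i') ∧ (b = j ∨ b = j')) → f a b = D.tile a b := by
    intro a b h
    simp only [f]
    rw [if_neg (by tauto), if_neg (by tauto), if_neg (by tauto), if_neg (by tauto)]
  -- the edges which are not inner edges of the square do not change
  have fl : ∀ a b : Fin n, ¬ ((a = i ∨ a = i') ∧ b = j') → (f a b).left = (D.tile a b).left := by
    intro a b h
    by_cases hab : (a = i ∨ a = i') ∧ (b = j ∨ b = j')
    · obtain ⟨rfl | rfl, rfl | rfl⟩ := hab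
      · rw [f00, h00.1]
      · exact absurd ⟨Or.inl rfl, rfl⟩ h
      · rw [f10, h10.1]
      · exact absurd ⟨Or.inr rfl, rfl⟩ h
    · rw [foff a b hab]
  have fr : ∀ a b : Fin n, ¬ ((a = i ∨ a = i') ∧ b = j) → (f a b).right = (D.tile a b).right := by
    intro a b h
    by_cases hab : (a = i ∨ a = i') ∧ (b = j ∨ b = j')
    · obtain ⟨rfl | rfl, rfl | rfl⟩ := hab
      · exact absurd ⟨Or.inl rfl, rfl⟩ h
      · rw [f01, h01.1]
      · exact absurd ⟨Or.inr rfl, rfl⟩ h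
      · rw [f11, h11.1]
    · rw [foff a b hab]
  have ft : ∀ a b : Fin n, ¬ (a = i' ∧ (b = j ∨ b = j')) → (f a b).top = (D.tile a b).top := by
    intro a b h
    by_cases hab : (a = i ∨ a = i') ∧ (b = j ∨ b = j')
    · obtain ⟨rfl | rfl, rfl | rfl⟩ := hab
      · rw [f00, h00.2]
      · rw [f01, h01.2]
      · exact absurd ⟨rfl, Or.inl rfl⟩ h
      · exact absurd ⟨rfl, Or.inr rfl⟩ h
    · rw [foff a b hab]
  have fb : ∀ a b : Fin n, ¬ (a = i ∧ (b = j ∨ b = j')) →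
      (f a b).bottom = (D.tile a b).bottom := by
    intro a b h
    by_cases hab : (a = i ∨ a = i') ∧ (b = j ∨ b = j')
    · obtain ⟨rfl | rfl, rfl | rfl⟩ := hab
      · exact absurd ⟨rfl, Or.inl rfl⟩ h
      · exact absurd ⟨rfl, Or.inr rfl⟩ h
      · rw [f10, h10.2]
      · rw [f11, h11.2]
    · rw [foff a b hab]
  refine ⟨⟨f, ?_, ?_, ?_, ?_, ?_, ?_⟩, f00, f01, f10, f11, foff⟩
  · intro a b b' hb
    by_cases h : (a = i ∨ a = i') ∧ b = j
    · obtain ⟨ha, rfl⟩ := h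
      obtain rfl : b' = j' := Fin.ext (by omega)
      rcases ha with rfl | rfl
      · rw [f00, f01, hin.1]
      · rw [f10, f11, hin.2.1]
    · rw [fr a b h, fl a b' fun h' => h ⟨h'.1, Fin.ext (by rw [h'.2] at hb; omega)⟩]
      exact D.match_row a b b' hb
  · intro a a' b ha
    by_cases h : a = i ∧ (b = j ∨ b = j')
    · obtain ⟨rfl, hb⟩ := h
      obtain rfl : a' = i' := Fin.ext (by omega)
      rcases hb with rfl | rfl
      · rw [f00, f10, hin.2.2.1]
      · rw [f01, f11, hin.2.2.2]
    · rw [fb a b h, ft a' b fun h' => h ⟨Fin.ext (by rw [h'.1] at ha; omega), h'.2⟩]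
      exact D.match_col a a' b ha
  · intro a b hb
    rw [fl a b fun h => by rw [h.2] at hb; omega]
    exact D.west a b hb
  · intro a b ha
    rw [ft a b fun h => by rw [h.1] at ha; omega]
    exact D.north a b ha
  · intro a b hb
    rw [fr a b fun h => by have := j'.isLt; rw [h.2] at hb; omega]
    exact D.east a b hb
  · intro a b ha
    rw [fb a b fun h => by have := i'.isLt; rw [h.1] at ha; omega]
    exact D.south a b ha

theorem rowLabel_congr {T T' : ℕ → Tile} {v v' : ℕ → ℕ} {a b : ℕ} (hab : a ≤ b)
    (h0 : rowLabel T v a = rowLabel T' v' a) (hT : ∀ x, a ≤ x → x < b → T x = T' x)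
    (hv : ∀ x, a ≤ x → x < b → v x = v' x) : rowLabel T v b = rowLabel T' v' b := by
  induction b, hab using Nat.le_induction with
  | base => exact h0
  | succ b hb ih =>
    rw [rowLabel, rowLabel, ih (fun x h1 h2 => hT x h1 (by omega))
      (fun x h1 h2 => hv x h1 (by omega)), hT b hb (by omega), hv b hb (by omega)]

/-- A simple droop only changes the labels on the four inner edges of its square. -/
theorem SimpleDroop.exitLabel_eq {n : ℕ} {i : Fin n} {D D' : BPD n} (h : SimpleDroop i D D')
    (r : ℕ) (hr : r < n) : D.exitLabel r = D'.exitLabel r := by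
  obtain ⟨i', j, j', hi, hj, ⟨a1, a2⟩, ⟨b1, b2⟩, hc, hd, he⟩ := h
  have hoff : ∀ a b, ¬ ((a = i.val ∨ a = i.val + 1) ∧ (b = j.val ∨ b = j.val + 1)) →
      D.get a b = D'.get a b := by
    intro a b hab
    unfold BPD.get
    split_ifs with hn
    · refine (he _ _ fun h => hab ?_).symm
      simp only [Fin.ext_iff, hi, hj] at h
      exact h
    · rfl
  have g00 : D.get i j = .southEast ∧ D'.get i j = .blank := by
    rw [D.get_val, D'.get_val]; exact ⟨a1, a2⟩
  have g11 : D.get (i.val + 1) (j.val + 1) = .blank ∧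
      D'.get (i.val + 1) (j.val + 1) = .northWest := by
    rw [← hi, ← hj, D.get_val, D'.get_val]; exact ⟨b1, b2⟩
  have g01 : (D.get i (j.val + 1) = .horiz ∧ D'.get i (j.val + 1) = .southEast) ∨
      (D.get i (j.val + 1) = .northWest ∧ D'.get i (j.val + 1) = .vert) := by
    rw [← hj, D.get_val, D'.get_val]; exact hc
  have g10 : (D.get (i.val + 1) j = .vert ∧ D'.get (i.val + 1) j = .southEast) ∨
      (D.get (i.val + 1) j = .northWest ∧ D'.get (i.val + 1) j = .horiz) := by
    rw [← hi, D.get_val, D'.get_val]; exact hd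
  have hin : i.val + 1 < n := by have := i'.isLt; omega
  have hjn : j.val + 1 < n := by have := j'.isLt; omega
  clear hc hd he a1 a2 b1 b2
  generalize i.val = s at *
  generalize j.val = c at *
  -- in a row whose bottom labels agree, all labels agree
  have same : ∀ a, (∀ b, D.get a b = D'.get a b) → (∀ b, D.botLabel a b = D'.botLabel a b) →
      ∀ b, D.leftLabel a b = D'.leftLabel a b := by
    intro a ha hb b
    exact rowLabel_congr (a := 0) (Nat.zero_le _) rfl (fun x _ _ => ha x) (fun x _ _ => hb x)
  have same' : ∀ a, (∀ b, D.get a b = D'.get a b) → (∀ b, D.botLabel a b = D'.botLabel a b) →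
      ∀ b, D.topLabel a b = D'.topLabel a b := by
    intro a ha hb b
    rw [BPD.topLabel, BPD.topLabel, same a ha hb, ha, hb]
  have low : ∀ a, a < n → s + 1 ≤ a → ∀ b, D.botLabel a b = D'.botLabel a b := by
    refine BPD.row_induction ?_ ?_
    · intro a ha _ b
      rw [BPD.botLabel_last _ (by omega), BPD.botLabel_last _ (by omega)]
    · intro a ha ih hs b
      rw [BPD.botLabel_eq _ ha, BPD.botLabel_eq _ ha]
      exact same' _ (fun x => hoff _ _ (by omega)) (ih (by omega)) b
  -- the lower row of the square
  have l0 : ∀ b ≤ c, D.leftLabel (s + 1) b = D'.leftLabel (s + 1) b := fun b hb =>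
    rowLabel_congr (a := 0) (Nat.zero_le _) rfl (fun x _ _ => hoff _ _ (by omega))
      (fun x _ _ => low _ hin le_rfl x)
  obtain ⟨x, x1, x2, x3, x4⟩ : ∃ x, D.topLabel (s + 1) c = x ∧ D.leftLabel (s + 1) (c + 1) = 0 ∧
      D'.topLabel (s + 1) c = 0 ∧ D'.leftLabel (s + 1) (c + 1) = x := by
    refine ⟨_, rfl, ?_⟩
    rw [BPD.leftLabel_succ, BPD.leftLabel_succ, BPD.topLabel, BPD.topLabel, l0 c le_rfl,
      low _ hin le_rfl c]
    rcases g10 with ⟨h1, h2⟩ | ⟨h1, h2⟩ <;> rw [h1, h2] <;> exact ⟨rfl, rfl, rfl⟩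
  have t1 : D.topLabel (s + 1) (c + 1) = 0 ∧ D'.topLabel (s + 1) (c + 1) = x := by
    rw [BPD.topLabel, BPD.topLabel, g11.1, g11.2, x4]
    exact ⟨rfl, rfl⟩
  have l1 : ∀ b, c + 2 ≤ b → D.leftLabel (s + 1) b = D'.leftLabel (s + 1) b := by
    intro b hb
    refine rowLabel_congr hb ?_ (fun x _ _ => hoff _ _ (by omega)) (fun x _ _ => low _ hin le_rfl x)
    change D.leftLabel (s + 1) (c + 1 + 1) = D'.leftLabel (s + 1) (c + 1 + 1)
    rw [D.leftLabel_succ _ (c + 1), D'.leftLabel_succ _ (c + 1), g11.1, g11.2]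
    rfl
  have t2 : ∀ b, b ≠ c → b ≠ c + 1 → D.topLabel (s + 1) b = D'.topLabel (s + 1) b := by
    intro b h1 h2
    have hl : D.leftLabel (s + 1) b = D'.leftLabel (s + 1) b := by
      rcases Nat.lt_or_ge b c with h | h
      · exact l0 b h.le
      · exact l1 b (by omega)
    rw [BPD.topLabel, BPD.topLabel, hl, low _ hin le_rfl b, hoff _ _ (by omega)]
  -- the upper row of the square
  have m0 : ∀ b ≤ c, D.leftLabel s b = D'.leftLabel s b := fun b hb =>
    rowLabel_congr (a := 0) (Nat.zero_le _) rfl (fun y _ _ => hoff _ _ (by omega))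
      (fun y _ _ => by
        rw [BPD.botLabel_eq _ hin, BPD.botLabel_eq _ hin, t2 y (by omega) (by omega)])
  have m1 : D.leftLabel s (c + 1) = x ∧ D'.leftLabel s (c + 1) = 0 ∧ D.topLabel s c = 0 ∧
      D'.topLabel s c = 0 := by
    rw [BPD.leftLabel_succ, BPD.leftLabel_succ, BPD.topLabel, BPD.topLabel, g00.1, g00.2,
      BPD.botLabel_eq _ hin, x1]
    exact ⟨rfl, rfl, rfl, rfl⟩
  have m2 : D.leftLabel s (c + 2) = D'.leftLabel s (c + 2) ∧
      D.topLabel s (c + 1) = D'.topLabel s (c + 1) := by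
    rw [D.leftLabel_succ _ (c + 1), D'.leftLabel_succ _ (c + 1), BPD.topLabel, BPD.topLabel, m1.1,
      m1.2.1, D.botLabel_eq hin, D'.botLabel_eq hin, t1.1, t1.2]
    rcases g01 with ⟨h1, h2⟩ | ⟨h1, h2⟩ <;> rw [h1, h2] <;> exact ⟨rfl, rfl⟩
  have m3 : ∀ b, c + 2 ≤ b → D.leftLabel s b = D'.leftLabel s b := fun b hb =>
    rowLabel_congr hb m2.1 (fun y _ _ => hoff _ _ (by omega))
      (fun y _ _ => by
        rw [BPD.botLabel_eq _ hin, BPD.botLabel_eq _ hin, t2 y (by omega) (by omega)])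
  have m4 : ∀ b, D.topLabel s b = D'.topLabel s b := by
    intro b
    by_cases h1 : b = c
    · rw [h1, m1.2.2.1, m1.2.2.2]
    by_cases h2 : b = c + 1
    · rw [h2, m2.2]
    have hl : D.leftLabel s b = D'.leftLabel s b := by
      rcases Nat.lt_or_ge b c with h | h
      · exact m0 b h.le
      · exact m3 b (by omega)
    rw [BPD.topLabel, BPD.topLabel, hl, BPD.botLabel_eq _ hin, BPD.botLabel_eq _ hin, t2 b h1 h2,
      hoff _ _ (by omega)]
  have high : ∀ a, a < n → a + 1 ≤ s → ∀ b, D.botLabel a b = D'.botLabel a b := by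
    refine BPD.row_induction (fun a _ _ => by omega) ?_
    intro a ha ih hs b
    rw [BPD.botLabel_eq _ ha, BPD.botLabel_eq _ ha]
    rcases Nat.eq_or_lt_of_le hs with h | h
    · rw [h]
      exact m4 b
    · exact same' _ (fun x => hoff _ _ (by omega)) (ih (by omega)) b
  rw [BPD.exitLabel_eq, BPD.exitLabel_eq]
  rcases lt_trichotomy r s with h | rfl | h
  · exact same r (fun b => hoff _ _ (by omega)) (high r hr h) n
  · exact m3 n (by omega)
  · rcases Nat.eq_or_lt_of_le h with h | h
    · rw [← h]
      exact l1 n (by omega)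
    · exact same r (fun b => hoff _ _ (by omega)) (low r hr (by omega)) n

theorem SimpleDroop.hasPerm_iff {n : ℕ} {i : Fin n} {D D' : BPD n} (h : SimpleDroop i D D')
    (π : Equiv.Perm (Fin n)) : D.HasPerm π ↔ D'.HasPerm π := by
  unfold BPD.HasPerm
  exact forall_congr' fun r => by rw [h.exitLabel_eq r r.isLt]

theorem DroopLE.rothe_hasPerm {n : ℕ} {π : Equiv.Perm (Fin n)} {D : BPD n}
    (h : DroopLE (rothe π) D) : D.HasPerm π := by
  induction h with
  | refl => exact ASMTSSCPP.rothe_hasPerm π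
  | tail _ hs ih =>
    obtain ⟨i, hs⟩ := hs
    exact (hs.hasPerm_iff π).1 ih

/-! ### The colours of the pipes at a crossing of a bumpless pipe dream -/

theorem Tile.eq_cross_of {t : Tile} (hl : t.left = true) (hb : t.bottom = true) : t = .cross := by
  revert hl hb; cases t <;> simp [Tile.left, Tile.bottom]

theorem Tile.eq_vert_or_of {t : Tile} (hl : ¬ t.left = true) (hb : t.bottom = true) :
    t = .vert ∨ t = .southEast := by
  revert hl hb; cases t <;> simp [Tile.left, Tile.bottom]

theorem Tile.eq_horiz_of {t : Tile} (hr : t.right = true) (hb : ¬ t.bottom = true) : t = .horiz := by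
  revert hr hb; cases t <;> simp [Tile.right, Tile.bottom]

/-- In the word `W`, the letters `1, …, k` occur in increasing order, and so do the letters greater
than `k`; the letters `0` are disregarded. -/
def IsSorted (k : ℕ) (W : ℕ → ℕ) : Prop :=
  ∀ p q, p < q → W p ≠ 0 → W q ≠ 0 → (W p ≤ k ↔ W q ≤ k) → W p < W q

/-- If `W'` arises from `W` by permuting two adjacent letters which are not subject to comparison,
then sortedness of `W'` implies that of `W`. -/
theorem IsSorted.of_local {k : ℕ} {W W' : ℕ → ℕ} {p : ℕ}
    (hoff : ∀ x, x ≠ p → x ≠ p + 1 → W' x = W x)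
    (hmem : ∀ v, v ≠ 0 → (v = W p ∨ v = W (p + 1)) → (v = W' p ∨ v = W' (p + 1)))
    (hpair : W p ≠ 0 → W (p + 1) ≠ 0 → ¬ (W p ≤ k ↔ W (p + 1) ≤ k)) (h : IsSorted k W') :
    IsSorted k W := by
  have key : ∀ x, W x ≠ 0 → ∃ y, W x = W' y ∧
      ((x ≠ p ∧ x ≠ p + 1 ∧ y = x) ∨ ((x = p ∨ x = p + 1) ∧ (y = p ∨ y = p + 1))) := by
    intro x hx
    by_cases h1 : x = p
    · subst h1
      rcases hmem _ hx (Or.inl rfl) with h | h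
      · exact ⟨_, h, by omega⟩
      · exact ⟨_, h, by omega⟩
    by_cases h2 : x = p + 1
    · subst h2
      rcases hmem _ hx (Or.inr rfl) with h | h
      · exact ⟨_, h, by omega⟩
      · exact ⟨_, h, by omega⟩
    exact ⟨x, (hoff x h1 h2).symm, by omega⟩
  intro a b hab ha hb hcl
  by_cases hp : a = p ∧ b = p + 1
  · obtain ⟨rfl, rfl⟩ := hp
    exact absurd hcl (hpair ha hb)
  · obtain ⟨a', ha1, ha2⟩ := key a ha
    obtain ⟨b', hb1, hb2⟩ := key b hb
    rw [ha1, hb1] at hcl ⊢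
    rw [ha1] at ha
    rw [hb1] at hb
    exact h a' b' (by omega) ha hb hcl

namespace BPD

variable {n : ℕ} (D : BPD n)

/-- The labels along the lattice path separating the tiles below row `i` and the first `j` tiles of
row `i` from the other tiles, read from left to right, followed by the exits below row `i`. -/
def word (i j : ℕ) (p : ℕ) : ℕ :=
  if p < i then 0
  else if p < i + j then D.topLabel i (p - i)
  else if p = i + j then D.leftLabel i j
  else if p ≤ i + n then D.botLabel i (p - i - 1)
  else if p < 2 * n then D.exitLabel (p - n)
  else 0

theorem word_next {i : ℕ} (hi : i + 1 < n) : D.word (i + 1) n = D.word i 0 := by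
  funext p
  unfold word
  by_cases h1 : p < i + 1
  · rw [if_pos h1]
    by_cases h2 : p < i
    · rw [if_pos h2]
    · rw [if_neg h2, if_neg (by omega), if_pos (by omega)]
      rfl
  · rw [if_neg h1]
    by_cases h2 : p < i + 1 + n
    · rw [if_pos h2, if_neg (by omega), if_neg (by omega), if_neg (by omega), if_pos (by omega),
        D.botLabel_eq hi, Nat.sub_sub]
    · rw [if_neg h2]
      by_cases h3 : p = i + 1 + n
      · rw [if_pos h3, if_neg (by omega), if_neg (by omega), if_neg (by omega),
          if_neg (by omega), if_pos (by omega), exitLabel_eq]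
        congr 1
        omega
      · rw [if_neg h3, if_neg (by omega), if_neg (show ¬ p < i by omega),
          if_neg (show ¬ p < i + 0 by omega), if_neg (show ¬ p = i + 0 by omega),
          if_neg (show ¬ p ≤ i + n by omega)]

theorem word_left (i j : ℕ) : D.word i j (i + j) = D.leftLabel i j := by
  unfold word
  rw [if_neg (by omega), if_neg (by omega), if_pos rfl]

theorem word_bot (i : ℕ) {j : ℕ} (hj : j < n) : D.word i j (i + j + 1) = D.botLabel i j := by
  unfold word
  rw [if_neg (by omega), if_neg (by omega), if_neg (by omega), if_pos (by omega)]
  congr 1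
  omega

theorem word_top (i j : ℕ) : D.word i (j + 1) (i + j) = D.topLabel i j := by
  unfold word
  rw [if_neg (by omega), if_pos (by omega), Nat.add_sub_cancel_left]

theorem word_off {i j p : ℕ} (h1 : p ≠ i + j) (h2 : p ≠ i + j + 1) :
    D.word i (j + 1) p = D.word i j p := by
  unfold word
  by_cases h3 : p < i
  · rw [if_pos h3, if_pos h3]
  rw [if_neg h3, if_neg h3]
  by_cases h4 : p < i + j
  · rw [if_pos h4, if_pos (by omega)]
  · rw [if_neg h4, if_neg (show ¬ p < i + (j + 1) by omega),
      if_neg (show ¬ p = i + (j + 1) by omega), if_neg (show ¬ p = i + j by omega)]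

variable {D} {π : Equiv.Perm (Fin n)} {k : ℕ}

/-- At a crossing the greater label comes before the smaller one afterwards; hence if the word is
sorted after the crossing, then the two labels are separated by `k`. -/
theorem isSorted_word_of_succ {i j : ℕ} (hi : i < n) (hj : j < n)
    (h : IsSorted k (D.word i (j + 1))) :
    (D.get i j = .cross → ¬ (D.leftLabel i j ≤ k ↔ D.botLabel i j ≤ k)) ∧
      IsSorted k (D.word i j) := by
  have hl := D.leftLabel_ne_zero_iff hi hj
  have hb := D.botLabel_ne_zero_iff hi hj
  have w1 := D.word_left i j
  have w2 := D.word_bot i hj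
  have w3 := D.word_top i j
  have w4 : D.word i (j + 1) (i + j + 1) = D.leftLabel i (j + 1) := D.word_left i (j + 1)
  rw [leftLabel_succ] at w4
  rw [topLabel] at w3
  have hc : D.get i j = .cross → ¬ (D.leftLabel i j ≤ k ↔ D.botLabel i j ≤ k) := by
    intro hc hcl
    have hs := h (i + j) (i + j + 1) (Nat.lt_succ_self _)
    rw [hc] at w3 w4 hl hb
    have hl' := hl.2 rfl
    have hb' := hb.2 rfl
    simp only [Tile.outTop, Tile.outRight] at w3 w4
    rw [w3, w4] at hs
    have := hs (by omega) (by omega) (by omega)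
    omega
  refine ⟨hc, IsSorted.of_local (p := i + j) (fun x h1 h2 => D.word_off h1 h2) ?_ ?_ h⟩
  · intro v hv
    rw [w1, w2, w3, w4]
    revert hl hb
    cases D.get i j <;>
      simp [Tile.outTop, Tile.outRight, Tile.left, Tile.bottom] <;> omega
  · rw [w1, w2]
    intro h1 h2
    exact hc (Tile.eq_cross_of (hl.1 h1) (hb.1 h2))

/-- The word is sorted at the end, when it consists of the values of `π`, hence at all stages. -/
theorem isSorted_word (hπ : IsShuffle π k) (hp : D.HasPerm π) :
    ∀ i, i < n → ∀ j, j ≤ n → IsSorted k (D.word i j) := by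
  have inner : ∀ i, i < n → IsSorted k (D.word i n) → ∀ d j, j + d = n →
      IsSorted k (D.word i j) := by
    intro i hi h0 d
    induction d with
    | zero => intro j hj; rwa [show j = n from hj]
    | succ d ih => exact fun j hj =>
        (isSorted_word_of_succ hi (by omega) (ih (j + 1) (by omega))).2
  intro i
  induction i with
  | zero =>
    intro hi j hj
    refine inner 0 hi ?_ (n - j) j (by omega)
    have hw : ∀ p, D.word 0 n p ≠ 0 → ∃ i : Fin n, p = n + i.val ∧
        D.word 0 n p = (π i).val + 1 := by
      intro p h0
      have e : D.word 0 n p = if h : n ≤ p ∧ p - n < n then D.exitLabel (p - n) else 0 := by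
        unfold word
        rw [if_neg (by omega)]
        by_cases h1 : p < n
        · rw [if_pos (by omega), dif_neg (by omega)]
          by_contra h2
          have := (D.topLabel_ne_zero_iff hi h1).1 h2
          rw [D.get_north h1] at this
          exact absurd this (by simp)
        · rw [if_neg (by omega)]
          by_cases h2 : p = n
          · subst h2
            rw [if_pos (by omega), dif_pos (by omega), Nat.sub_self]
            rfl
          · rw [if_neg (by omega), if_neg (by omega)]
            by_cases h3 : p < 2 * n
            · rw [if_pos h3, dif_pos (by omega)]
            · rw [if_neg h3, dif_neg (by omega)]
      rw [e] at h0 ⊢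
      split_ifs at h0 ⊢ with h1
      · exact ⟨⟨p - n, h1.2⟩, by simp only; omega, hp ⟨p - n, h1.2⟩⟩
      · exact absurd rfl h0
    intro p q hpq h1 h2 hcl
    obtain ⟨a, ha1, ha2⟩ := hw p h1
    obtain ⟨b, hb1, hb2⟩ := hw q h2
    rw [ha2, hb2] at hcl ⊢
    have := hπ a b (by rw [Fin.lt_def]; omega) (by omega)
    rw [Fin.lt_def] at this
    omega
  | succ i ih =>
    intro hi j hj
    refine inner (i + 1) hi ?_ (n - j) j (by omega)
    rw [D.word_next hi]
    exact ih (by omega) 0 (Nat.zero_le _)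

theorem not_iff_of_cross (hπ : IsShuffle π k) (hp : D.HasPerm π) {i j : ℕ} (hi : i < n)
    (hj : j < n) (hc : D.get i j = .cross) :
    ¬ (D.leftLabel i j ≤ k ↔ D.botLabel i j ≤ k) :=
  (isSorted_word_of_succ hi hj (isSorted_word hπ hp i hi (j + 1) hj)).1 hc

/-! ### The shape of the bumpless pipe dreams of a shuffle -/

/-- There are no crossings in the first `k` columns, and neither blank tiles nor north-west elbows in
the other columns. -/
structure IsSplit (D : BPD n) (k : ℕ) : Prop where
  cross : ∀ i j : Fin n, D.tile i j = .cross → k ≤ j.val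
  blank : ∀ i j : Fin n, D.tile i j = .blank → j.val < k
  northWest : ∀ i j : Fin n, D.tile i j = .northWest → j.val < k

/-- Pipes only travel up and to the right, so there are only small pipes in the first `k` columns. -/
theorem label_le (D : BPD n) (k : ℕ) : ∀ i, i < n →
    (∀ j, j < k → D.botLabel i j ≤ k) ∧ (∀ j, j ≤ k → D.leftLabel i j ≤ k) := by
  have left : ∀ i, (∀ j, j < k → D.botLabel i j ≤ k) → ∀ j, j ≤ k → D.leftLabel i j ≤ k := by
    intro i hb j
    induction j with
    | zero => exact fun _ => Nat.zero_le _
    | succ j ih =>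
      intro hj
      have h1 := ih (by omega)
      have h2 := hb j (by omega)
      rw [leftLabel_succ]
      cases D.get i j <;> simp [Tile.outRight] <;> omega
  refine row_induction ?_ ?_
  · intro i hi
    have hb : ∀ j, j < k → D.botLabel i j ≤ k := by
      intro j hj
      rw [D.botLabel_last (by omega)]
      omega
    exact ⟨hb, left i hb⟩
  · intro i hi ih
    have hb : ∀ j, j < k → D.botLabel i j ≤ k := by
      intro j hj
      have h1 := ih.1 j hj
      have h2 := ih.2 j hj.le
      rw [D.botLabel_eq hi, topLabel]
      cases D.get (i + 1) j <;> simp [Tile.outTop] <;> omega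
    exact ⟨hb, left i hb⟩

/-- The horizontal edges with labels `v` in the columns from `k` on are occupied, by large labels,
in the first `b` of these columns only. -/
def Packed (n k b : ℕ) (v : ℕ → ℕ) : Prop :=
  k + b ≤ n ∧ ∀ j, k ≤ j → j < n → (j < k + b → k < v j) ∧ (k + b ≤ j → v j = 0)

/-- If the large pipes enter a row in the columns `k, …, k+b-1`, then either a small pipe enters the
row from the first `k` columns and crosses all of them, or the last of them turns right and the
others go straight up. -/
theorem packed_row (hx : ∀ i j, i < n → j < n → D.get i j = .cross →
      ¬ (D.leftLabel i j ≤ k ↔ D.botLabel i j ≤ k)) {i : ℕ} (hi : i < n) (hk : k ≤ n) {b : ℕ}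
    (hb : Packed n k b (D.botLabel i)) :
    (∃ b', Packed n k b' (D.topLabel i)) ∧
      ∀ j, k ≤ j → j < n → D.get i j ≠ .blank ∧ D.get i j ≠ .northWest := by
  obtain ⟨hbn, hb⟩ := hb
  -- to the right of the large pipes
  have horiz : ∀ d j, j + d + 1 = n → k + b ≤ j → D.get i j = .horiz := by
    intro d
    induction d with
    | zero =>
      intro j hj hkj
      refine Tile.eq_horiz_of (D.get_east hi hj) fun h => ?_
      exact ((D.botLabel_ne_zero_iff hi (by omega)).2 h) ((hb j (by omega) (by omega)).2 hkj)
    | succ d ih =>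
      intro j hj hkj
      refine Tile.eq_horiz_of ?_ fun h => ?_
      · rw [D.get_match_row hi (by omega), ih (j + 1) (by omega) (by omega)]
        rfl
      · exact ((D.botLabel_ne_zero_iff hi (by omega)).2 h) ((hb j (by omega) (by omega)).2 hkj)
  replace horiz : ∀ j, j < n → k + b ≤ j → D.get i j = .horiz := fun j hj h =>
    horiz (n - 1 - j) j (by omega) h
  have bottom : ∀ j, k ≤ j → j < k + b → (D.get i j).bottom = true := fun j h1 h2 =>
    (D.botLabel_ne_zero_iff hi (by omega)).1 (by have := (hb j h1 (by omega)).1 h2; omega)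
  by_cases hkn : k = n
  · exact ⟨⟨0, by omega, fun j h1 h2 => by omega⟩, fun j h1 h2 => by omega⟩
  have hkn' : k < n := by omega
  have hle := (D.label_le k i hi).2 k le_rfl
  by_cases h0 : D.leftLabel i k = 0
  · have hbpos : 0 < b := by
      by_contra hb0
      have hh := horiz k hkn' (by omega)
      have := (D.leftLabel_ne_zero_iff hi hkn').2 (by rw [hh]; rfl)
      exact this h0
    have tiles : ∀ j, k ≤ j → j < k + b → D.leftLabel i j = 0 →
        D.get i j = .vert ∨ D.get i j = .southEast := by
      intro j h1 h2 hl
      exact Tile.eq_vert_or_of (fun h => (D.leftLabel_ne_zero_iff hi (by omega)).2 h hl)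
        (bottom j h1 h2)
    have step : ∀ j, k ≤ j → j + 1 < k + b → D.leftLabel i j = 0 → D.get i j = .vert := by
      intro j h1 h2 hl
      refine (tiles j h1 (by omega) hl).resolve_right fun hse => ?_
      have hl' : D.leftLabel i (j + 1) = D.botLabel i j := by
        rw [leftLabel_succ, hse]
        rfl
      have b1 := (hb j h1 (by omega)).1 (by omega)
      have b2 := (hb (j + 1) (by omega) (by omega)).1 h2
      have hc := Tile.eq_cross_of
        ((D.leftLabel_ne_zero_iff hi (show j + 1 < n by omega)).1 (by omega))
        (bottom (j + 1) (by omega) h2)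
      have := hx i (j + 1) hi (by omega) hc
      omega
    have left0 : ∀ d, d < b → D.leftLabel i (k + d) = 0 := by
      intro d
      induction d with
      | zero => exact fun _ => h0
      | succ d ih =>
        intro hd
        rw [← Nat.add_assoc, leftLabel_succ, step (k + d) (by omega) (by omega) (ih (by omega))]
        rfl
    have vert : ∀ j, k ≤ j → j + 1 < k + b → D.get i j = .vert := by
      intro j h1 h2
      have := left0 (j - k) (by omega)
      rw [Nat.add_sub_cancel' h1] at this
      exact step j h1 h2 this
    have turn : D.get i (k + b - 1) = .southEast := by
      have hl := left0 (b - 1) (by omega)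
      rw [show k + (b - 1) = k + b - 1 by omega] at hl
      refine (tiles _ (by omega) (by omega) hl).resolve_left fun hv => ?_
      have hr : (D.get i (k + b - 1)).right = true := by
        by_cases hlast : k + b = n
        · exact D.get_east hi (by omega)
        · rw [D.get_match_row hi (by omega), horiz _ (by omega) (by omega)]
          rfl
      rw [hv] at hr
      exact absurd hr (by simp [Tile.right])
    refine ⟨⟨b - 1, by omega, fun j h1 h2 => ⟨fun h3 => ?_, fun h3 => ?_⟩⟩, fun j h1 h2 => ?_⟩
    · rw [topLabel, vert j h1 (by omega)]
      exact (hb j h1 h2).1 (by omega)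
    · rcases Nat.eq_or_lt_of_le h3 with h | h
      · rw [topLabel, show j = k + b - 1 by omega, turn]
        rfl
      · rw [topLabel, horiz j h2 (by omega)]
        rfl
    · rcases lt_trichotomy (j + 1) (k + b) with h | h | h
      · rw [vert j h1 h]; simp
      · rw [show j = k + b - 1 by omega, turn]; simp
      · rw [horiz j h2 (by omega)]; simp
  · have cross : ∀ j, k ≤ j → j < k + b → D.leftLabel i j = D.leftLabel i k →
        D.get i j = .cross := by
      intro j h1 h2 hl
      exact Tile.eq_cross_of ((D.leftLabel_ne_zero_iff hi (by omega)).1 (by omega)) (bottom j h1 h2)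
    have left1 : ∀ d, d < b → D.leftLabel i (k + d) = D.leftLabel i k := by
      intro d
      induction d with
      | zero => exact fun _ => rfl
      | succ d ih =>
        intro hd
        have hl := ih (by omega)
        have := (hb (k + d) (by omega) (by omega)).1 (by omega)
        rw [← Nat.add_assoc, leftLabel_succ, cross (k + d) (by omega) (by omega) hl, hl]
        simp only [Tile.outRight]
        omega
    replace cross : ∀ j, k ≤ j → j < k + b → D.get i j = .cross := by
      intro j h1 h2
      have := left1 (j - k) (by omega)
      rw [Nat.add_sub_cancel' h1] at this
      exact cross j h1 h2 this
    refine ⟨⟨b, hbn, fun j h1 h2 => ⟨fun h3 => ?_, fun h3 => ?_⟩⟩, fun j h1 h2 => ?_⟩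
    · have := (hb j h1 h2).1 h3
      rw [topLabel, cross j h1 h3]
      simp only [Tile.outTop]
      omega
    · rw [topLabel, horiz j h2 h3]
      rfl
    · rcases Nat.lt_or_ge j (k + b) with h | h
      · rw [cross j h1 h]; simp
      · rw [horiz j h2 h]; simp

theorem HasPerm.isSplit (hπ : IsShuffle π k) (hk : k ≤ n) (hp : D.HasPerm π) : D.IsSplit k := by
  have hx : ∀ i j, i < n → j < n → D.get i j = .cross →
      ¬ (D.leftLabel i j ≤ k ↔ D.botLabel i j ≤ k) := fun i j hi hj hc =>
    not_iff_of_cross hπ hp hi hj hc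
  have hpacked : ∀ i, i < n → ∃ b, Packed n k b (D.botLabel i) := by
    refine row_induction ?_ ?_
    · intro i hi
      refine ⟨n - k, by omega, fun j h1 h2 => ?_⟩
      rw [D.botLabel_last (by omega)]
      omega
    · rintro i hi ⟨b, hb⟩
      obtain ⟨b', hb'⟩ := (packed_row hx hi hk hb).1
      refine ⟨b', ?_⟩
      rw [show D.botLabel i = D.topLabel (i + 1) from funext fun j => D.botLabel_eq hi j]
      exact hb'
  have hright : ∀ i j : Fin n, k ≤ j.val → D.tile i j ≠ .blank ∧ D.tile i j ≠ .northWest := by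
    intro i j hj
    obtain ⟨b, hb⟩ := hpacked i i.isLt
    have := (packed_row hx i.isLt hk hb).2 j hj j.isLt
    rwa [D.get_val] at this
  refine ⟨fun i j hc => ?_, fun i j hc => ?_, fun i j hc => ?_⟩
  · by_contra hj
    have h1 := (D.label_le k i i.isLt).1 j (by omega)
    have h2 := (D.label_le k i i.isLt).2 j (by omega)
    exact hx i j i.isLt j.isLt (by rw [D.get_val]; exact hc) (by simp only [h1, h2])
  · by_contra hj
    exact (hright i j (not_lt.1 hj)).1 hc
  · by_contra hj
    exact (hright i j (not_lt.1 hj)).2 hc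

/-! ### Bumpless pipe dreams of a shuffle are reached from the Rothe one by droops -/

/-- If there is a north-west elbow, then following the north-west elbows diagonally up one arrives
at a blank tile, and there a simple droop can be undone. -/
theorem IsSplit.exists_undroop (h : D.IsSplit k) : ∀ (m : ℕ) (i' j' : Fin n), i'.val = m →
    D.tile i' j' = .northWest → ∃ (i : Fin n) (D' : BPD n), SimpleDroop i D' D := by
  intro m
  induction m with
  | zero =>
    intro i' j' hi ht
    have := D.north i' j' hi
    rw [ht] at this
    exact absurd this (by simp [Tile.top])
  | succ m ih =>
    intro i' j' hi ht
    have hjk := h.northWest _ _ ht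
    have hj0 : j'.val ≠ 0 := by
      intro h0
      have := D.west i' j' h0
      rw [ht] at this
      exact absurd this (by simp [Tile.left])
    let i : Fin n := ⟨m, by omega⟩
    let j : Fin n := ⟨j'.val - 1, by omega⟩
    have hii : i'.val = i.val + 1 := hi
    have hjj : j'.val = j.val + 1 := by simp only [j]; omega
    have e1 := D.match_row i' j j' hjj
    have e2 := D.match_col i i' j' hii
    have e3 := D.match_row i j j' hjj
    have e4 := D.match_col i i' j hii
    have hc1 : D.tile i j' ≠ .cross := fun hc => by have := h.cross _ _ hc; omega
    have hc2 : D.tile i' j ≠ .cross := fun hc => by have := h.cross _ _ hc; omega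
    by_cases hnw : D.tile i j = .northWest
    · exact ih i j rfl hnw
    rw [ht] at e1 e2
    have t01 : D.tile i j' = .southEast ∨ D.tile i j' = .vert := by
      revert e2 hc1
      cases D.tile i j' <;> simp [Tile.bottom, Tile.top]
    have t10 : D.tile i' j = .southEast ∨ D.tile i' j = .horiz := by
      revert e1 hc2
      cases D.tile i' j <;> simp [Tile.left, Tile.right]
    have t00 : D.tile i j = .blank := by
      revert hnw e3 e4
      rcases t01 with a | a <;> rcases t10 with b | b <;> rw [a, b] <;>
        cases D.tile i j <;> simp [Tile.bottom, Tile.top, Tile.left, Tile.right]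
    obtain ⟨D', d1, d2, d3, d4, d5⟩ := D.exists_replace hii hjj
      (t00 := .southEast)
      (t01 := if D.tile i j' = .southEast then .horiz else .northWest)
      (t10 := if D.tile i' j = .southEast then .vert else .northWest)
      (t11 := .blank)
      (by rw [t00]; exact ⟨rfl, rfl⟩)
      (by rcases t01 with a | a <;> rw [a] <;> exact ⟨rfl, rfl⟩)
      (by rcases t10 with a | a <;> rw [a] <;> exact ⟨rfl, rfl⟩)
      (by rw [ht]; exact ⟨rfl, rfl⟩)
      (by rcases t01 with a | a <;> rcases t10 with b | b <;> rw [a, b] <;>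
            exact ⟨rfl, rfl, rfl, rfl⟩)
    refine ⟨i, D', i', j, j', hii, hjj, ⟨d1, t00⟩, ⟨d4, ht⟩, ?_, ?_, fun a b hab => (d5 a b hab).symm⟩
    · rcases t01 with a | a
      · rw [a] at d2; exact Or.inl ⟨d2, a⟩
      · rw [a] at d2; exact Or.inr ⟨d2, a⟩
    · rcases t10 with a | a
      · rw [a] at d3; exact Or.inl ⟨d3, a⟩
      · rw [a] at d3; exact Or.inr ⟨d3, a⟩

theorem rank_le (D : BPD n) : D.rank ≤ ∑ p : Fin n × Fin n, p.1.val :=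
  sum_le_sum fun p _ => by split_ifs <;> omega

end BPD

/-- Undoing droops as long as possible ends in a bumpless pipe dream without north-west elbows,
which is a Rothe one; the process stops as the sum of the row numbers of the blank tiles
increases. -/
theorem IsShuffle.droopLE {n k : ℕ} {π : Equiv.Perm (Fin n)} (hπ : IsShuffle π k) (hk : k ≤ n) :
    ∀ (m : ℕ) (D : BPD n), (∑ p : Fin n × Fin n, p.1.val) - D.rank = m → D.HasPerm π →
      DroopLE (rothe π) D := by
  intro m
  induction m using Nat.strong_induction_on with
  | _ m ih =>
    intro D hm hp
    by_cases hnw : ∃ i j, D.tile i j = .northWest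
    · obtain ⟨i', j', ht⟩ := hnw
      obtain ⟨i, D', hs⟩ := (hp.isSplit hπ hk).exists_undroop i' i' j' rfl ht
      have h1 := hs.rank_lt
      have h2 := D'.rank_le
      exact Relation.ReflTransGen.tail
        (ih _ (by omega) D' rfl ((hs.hasPerm_iff π).2 hp)) ⟨i, hs⟩
    · push Not at hnw
      obtain ⟨π', hπ'⟩ := D.toASM.exists_eq_permASM fun i j h => by
        change (D.tile i j).entry = -1 at h
        have := hnw i j
        revert h this
        cases D.tile i j <;> simp [Tile.entry]
      have hD : rothe π' = D := by
        rw [rothe, ← hπ', D.toASM_toBPD]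
      rw [← hD] at hp ⊢
      rw [hp.unique (rothe_hasPerm π')]
      exact Relation.ReflTransGen.refl

/-- Taking the bumpless pipe dream is a bijection from the alternating sign matrices with
permutation `π` to the bumpless pipe dreams reached from the Rothe one by droops. -/
theorem IsShuffle.exists_droopEquiv {n k : ℕ} {π : Equiv.Perm (Fin n)} (hπ : IsShuffle π k)
    (hk : k ≤ n) : ∃ α : ASMOf π ≃ Droop π, ∀ A, (α A).1 = A.1.toBPD := by
  refine ⟨Equiv.ofBijective
    (fun A => ⟨A.1.toBPD, hπ.droopLE hk _ _ rfl A.2⟩) ⟨?_, ?_⟩, fun _ => rfl⟩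
  · intro A B h
    exact Subtype.ext (ASM.toBPD_injective (congrArg Subtype.val h))
  · rintro ⟨D, hD⟩
    exact ⟨⟨D.toASM, by rw [D.toASM_toBPD]; exact hD.rothe_hasPerm⟩, Subtype.ext D.toASM_toBPD⟩

/-! ### Blank tiles and crosses -/

/-- The crosses of `P` are the blank tiles of `D`, reflected in their first `k` columns. In
coordinates counted from `1`, a blank tile at `(i,j)` corresponds to a cross at `(i, k + 1 - j)`. -/
def Corresponds {n : ℕ} (k : ℕ) (D : BPD n) (P : PipeDream n) : Prop :=
  ∀ r c, (r, c) ∈ P.crosses ↔ ∃ i j : Fin n, D.tile i j = .blank ∧ r = i.val + 1 ∧ c + j.val = k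

variable {n k : ℕ}

theorem Corresponds.right_unique {D : BPD n} {P P' : PipeDream n} (h : Corresponds k D P)
    (h' : Corresponds k D P') : P = P' := by
  ext ⟨r, c⟩
  rw [h, h']

theorem Corresponds.mem_iff {D : BPD n} {P : PipeDream n} (h : Corresponds k D P)
    (hD : D.IsSplit k) (i j : Fin n) :
    D.tile i j = .blank ↔ j.val < k ∧ (i.val + 1, k - j.val) ∈ P.crosses := by
  rw [h]
  constructor
  · intro ht
    have := hD.blank _ _ ht
    exact ⟨this, i, j, ht, rfl, by omega⟩
  · rintro ⟨h1, i', j', ht, h2, h3⟩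
    obtain rfl : i = i' := Fin.ext (by omega)
    obtain rfl : j = j' := Fin.ext (by omega)
    exact ht

/-- A bumpless pipe dream of a shuffle is determined by its blank tiles: one reconstructs the tiles
from the north-west corner. -/
theorem Corresponds.left_unique {D D' : BPD n} {P : PipeDream n} (h : Corresponds k D P)
    (h' : Corresponds k D' P) (hD : D.IsSplit k) (hD' : D'.IsSplit k) : D = D' := by
  have hblank : ∀ i j, D.tile i j = .blank ↔ D'.tile i j = .blank := fun i j => by
    rw [h.mem_iff hD, h'.mem_iff hD']
  have key : ∀ m, ∀ i j : Fin n, i.val + j.val = m → D.tile i j = D'.tile i j := by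
    intro m
    induction m using Nat.strong_induction_on with
    | _ m ih =>
      intro i j hm
      have hl : (D.tile i j).left = (D'.tile i j).left := by
        by_cases hj : j.val = 0
        · rw [D.west i j hj, D'.west i j hj]
        · have hj' : j.val = (⟨j.val - 1, by omega⟩ : Fin n).val + 1 := by simp only; omega
          rw [← D.match_row i _ j hj', ← D'.match_row i _ j hj',
            ih (m - 1) (by omega) i _ (by simp only; omega)]
      have ht : (D.tile i j).top = (D'.tile i j).top := by
        by_cases hi : i.val = 0
        · rw [D.north i j hi, D'.north i j hi]
        · have hi' : i.val = (⟨i.val - 1, by omega⟩ : Fin n).val + 1 := by simp only; omega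
          rw [← D.match_col _ i j hi', ← D'.match_col _ i j hi',
            ih (m - 1) (by omega) _ j (by simp only; omega)]
      have hb := hblank i j
      have c1 := hD.cross i j
      have c2 := hD'.cross i j
      have w1 := hD.northWest i j
      have w2 := hD'.northWest i j
      rcases Nat.lt_or_ge j.val k with hjk | hjk
      · replace c1 : D.tile i j ≠ .cross := fun h => absurd (c1 h) (by omega)
        replace c2 : D'.tile i j ≠ .cross := fun h => absurd (c2 h) (by omega)
        clear w1 w2
        revert hl ht hb c1 c2
        cases D.tile i j <;> cases D'.tile i j <;> simp [Tile.left, Tile.top]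
      · replace w1 : D.tile i j ≠ .northWest := fun h => absurd (w1 h) (by omega)
        replace w2 : D'.tile i j ≠ .northWest := fun h => absurd (w2 h) (by omega)
        clear c1 c2
        revert hl ht hb w1 w2
        cases D.tile i j <;> cases D'.tile i j <;> simp [Tile.left, Tile.top]
  ext i j
  exact key _ i j rfl

/-- In row `i` of the Rothe bumpless pipe dream, the blank tiles are right-justified in the first
`k` columns, and their number is the entry of the Lehmer code. -/
theorem IsShuffle.corresponds_rothe {π : Equiv.Perm (Fin n)} (hπ : IsShuffle π k) :
    Corresponds k (rothe π) (bottomPD π) := by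
  have hblank : ∀ i j, (rothe π).tile i j = .blank ↔ i < π.symm j ∧ j < π i := by
    intro i j
    rw [rothe_tile]
    by_cases h1 : π i = j
    · simp [h1]
    · by_cases h2 : i < π.symm j <;> by_cases h3 : j < π i <;> simp [h1, h2, h3]
  -- an inversion consists of a large and a small value
  have hinv : ∀ i i' : Fin n, i < i' → π i' < π i → (π i').val < k ∧ k ≤ (π i).val := by
    intro i i' h1 h2
    by_contra h3
    refine absurd (hπ i i' h1 ?_) (not_lt.2 h2.le)
    rw [Fin.lt_def] at h2
    omega
  have hcode : ∀ (i : Fin n) (c : ℕ), c < code π i ↔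
      ∃ i' : Fin n, i < i' ∧ π i' < π i ∧ c + (π i').val + 1 = k := by
    intro i
    classical
    have hcard : code π i = ((range k).filter fun c =>
        ∃ i' : Fin n, i < i' ∧ π i' < π i ∧ c + (π i').val + 1 = k).card := by
      unfold code
      refine card_bij (fun i' _ => k - 1 - (π i').val) ?_ ?_ ?_
      · intro i' hi'
        simp only [mem_filter, mem_univ, true_and, mem_range] at hi' ⊢
        have := hinv i i' hi'.1 hi'.2
        exact ⟨by omega, i', hi'.1, hi'.2, by omega⟩
      · intro a ha b hb hab
        simp only [mem_filter, mem_univ, true_and] at ha hb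
        have h1 := hinv i a ha.1 ha.2
        have h2 := hinv i b hb.1 hb.2
        exact π.injective (Fin.ext (by omega))
      · intro c hc
        simp only [mem_filter, mem_range] at hc
        obtain ⟨-, i', h1, h2, h3⟩ := hc
        exact ⟨i', by simp only [mem_filter, mem_univ, true_and]; exact ⟨h1, h2⟩, by omega⟩
    rw [hcard]
    refine lt_card_filter_range_iff ?_ ?_
    · rintro c ⟨i', h1, h2, h3⟩
      have hk := hinv i i' h1 h2
      have hlt : (π i').val + 1 < n := by have := (π i).isLt; omega
      let i'' := π.symm ⟨(π i').val + 1, hlt⟩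
      have hi'' : π i'' = ⟨(π i').val + 1, hlt⟩ := π.apply_symm_apply _
      have hval : (π i'').val = (π i').val + 1 := congrArg Fin.val hi''
      refine ⟨i'', h1.trans ?_, ?_, by omega⟩
      · by_contra hle
        have hne : i'' ≠ i' := fun h => by rw [h] at hval; omega
        have := hπ i'' i' (lt_of_le_of_ne (not_lt.1 hle) hne) (by omega)
        rw [Fin.lt_def] at this
        omega
      · rw [Fin.lt_def]
        omega
    · rintro c ⟨i', -, -, h⟩
      omega
  intro r c
  simp only [bottomPD, mem_biUnion, mem_univ, true_and, mem_image, mem_Icc, Prod.mk.injEq]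
  constructor
  · rintro ⟨i, d, ⟨h1, h2⟩, rfl, rfl⟩
    obtain ⟨i', h3, h4, h5⟩ := (hcode i (d - 1)).1 (by omega)
    refine ⟨i, π i', (hblank _ _).2 ⟨?_, h4⟩, rfl, by omega⟩
    rwa [Equiv.symm_apply_apply]
  · rintro ⟨i, j, ht, rfl, hc⟩
    obtain ⟨h1, h2⟩ := (hblank _ _).1 ht
    have hj : π (π.symm j) = j := π.apply_symm_apply j
    have h3 := hinv i (π.symm j) h1 (by rwa [hj])
    rw [hj] at h3
    have := (hcode i (c - 1)).2 ⟨π.symm j, h1, by rwa [hj], by rw [hj]; omega⟩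
    exact ⟨i, c, ⟨by omega, by omega⟩, rfl, rfl⟩

/-! ### Droops and slides -/

/-- The blank tiles after a simple droop: the blank tile of the square has moved to its north-west
corner. -/
theorem SimpleDroop.blank_iff {i i' j j' : Fin n} {D D' : BPD n} (hi : i'.val = i.val + 1)
    (h00 : D'.tile i j = .blank) (h11 : D'.tile i' j' = .northWest)
    (h01 : D.tile i j' ≠ .blank ∧ D'.tile i j' ≠ .blank)
    (h10 : D.tile i' j ≠ .blank ∧ D'.tile i' j ≠ .blank)
    (hoff : ∀ a b : Fin n, ¬ ((a = i ∨ a = i') ∧ (b = j ∨ b = j')) → D'.tile a b = D.tile a b)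
    (a b : Fin n) : D'.tile a b = .blank ↔
      (a = i ∧ b = j) ∨ (¬ (a = i' ∧ b = j') ∧ D.tile a b = .blank) := by
  have hii : i ≠ i' := fun h => by rw [h] at hi; omega
  by_cases hab : (a = i ∨ a = i') ∧ (b = j ∨ b = j')
  · obtain ⟨ha, hb⟩ := hab
    by_cases h1 : a = i ∧ b = j
    · rw [h1.1, h1.2]
      simp [h00]
    by_cases h2 : a = i' ∧ b = j'
    · rw [h2.1, h2.2]
      simp [h11, hii.symm]
    have h3 : (a = i ∧ b = j') ∨ (a = i' ∧ b = j) := by tauto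
    rcases h3 with ⟨rfl, rfl⟩ | ⟨rfl, rfl⟩
    · simp only [h01.1, h01.2, and_false, or_false, false_iff]
      simpa using h1
    · simp only [h10.1, h10.2, and_false, or_false, false_iff]
      simpa using h1
  · rw [hoff a b hab]
    constructor
    · exact fun h => Or.inr ⟨fun h' => hab ⟨Or.inr h'.1, Or.inr h'.2⟩, h⟩
    · rintro (⟨rfl, rfl⟩ | h)
      · exact absurd ⟨Or.inl rfl, Or.inl rfl⟩ hab
      · exact h.2

/-- The correspondence turns the move of a blank tile to the north-west into the move of a cross to
the north-east. -/
theorem Corresponds.move {i i' j j' : Fin n} {D D' : BPD n} {P P' : PipeDream n}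
    (h : Corresponds k D P) (hi : i'.val = i.val + 1) (hj : j'.val = j.val + 1) (hk : j'.val < k)
    (hD : ∀ a b, D'.tile a b = .blank ↔
      (a = i ∧ b = j) ∨ (¬ (a = i' ∧ b = j') ∧ D.tile a b = .blank))
    (hP : P'.crosses =
      insert (i.val + 1, k - j'.val + 1) (P.crosses.erase (i.val + 1 + 1, k - j'.val))) :
    Corresponds k D' P' := by
  intro r c
  rw [hP, mem_insert, mem_erase, h]
  simp only [ne_eq, Prod.mk.injEq, hD]
  constructor
  · rintro (⟨rfl, rfl⟩ | ⟨hne, a, b, ht, h1, h2⟩)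
    · exact ⟨i, j, Or.inl ⟨rfl, rfl⟩, rfl, by omega⟩
    · refine ⟨a, b, Or.inr ⟨?_, ht⟩, h1, h2⟩
      rintro ⟨rfl, rfl⟩
      exact hne ⟨by omega, by omega⟩
  · rintro ⟨a, b, ⟨rfl, rfl⟩ | ⟨hne, ht⟩, h1, h2⟩
    · exact Or.inl ⟨h1, by omega⟩
    · refine Or.inr ⟨?_, a, b, ht, h1, h2⟩
      rintro ⟨h3, h4⟩
      exact hne ⟨Fin.ext (by omega), Fin.ext (by omega)⟩

theorem Corresponds.exists_slide {i : Fin n} {D D' : BPD n} {P : PipeDream n}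
    (h : Corresponds k D P) (hD : D.IsSplit k) (hs : SimpleDroop i D D') :
    ∃ P', SimpleSlide (i.val + 1) P P' ∧ Corresponds k D' P' := by
  obtain ⟨i', j, j', hi, hj, ⟨a1, a2⟩, ⟨b1, b2⟩, hc, hd, he⟩ := hs
  have hk := hD.blank _ _ b1
  have h01 : D.tile i j' ≠ .blank ∧ D'.tile i j' ≠ .blank := by
    rcases hc with ⟨h1, h2⟩ | ⟨h1, h2⟩ <;> rw [h1, h2] <;> simp
  have h10 : D.tile i' j ≠ .blank ∧ D'.tile i' j ≠ .blank := by
    rcases hd with ⟨h1, h2⟩ | ⟨h1, h2⟩ <;> rw [h1, h2] <;> simp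
  have hmem := h.mem_iff hD
  have m11 : (i.val + 1 + 1, k - j'.val) ∈ P.crosses := by
    rw [← hi]; exact ((hmem _ _).1 b1).2
  have m10 : (i.val + 1 + 1, k - j'.val + 1) ∉ P.crosses := by
    intro hm
    refine h10.1 ((hmem _ _).2 ⟨by omega, ?_⟩)
    rwa [hi, show k - j.val = k - j'.val + 1 by omega]
  have m01 : (i.val + 1, k - j'.val) ∉ P.crosses := fun hm => h01.1 ((hmem _ _).2 ⟨hk, hm⟩)
  have m00 : (i.val + 1, k - j'.val + 1) ∉ P.crosses := by
    intro hm
    have : D.tile i j = .blank := (hmem _ _).2 ⟨by omega, by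
      rwa [show k - j.val = k - j'.val + 1 by omega]⟩
    rw [a1] at this
    exact absurd this (by simp)
  have hv := P.valid _ m11
  let P' : PipeDream n :=
    ⟨insert (i.val + 1, k - j'.val + 1) (P.crosses.erase (i.val + 1 + 1, k - j'.val)), by
      intro p hp
      rcases mem_insert.1 hp with rfl | hp
      · simp only at hv ⊢; omega
      · exact P.valid p (mem_of_mem_erase hp)⟩
  exact ⟨P', ⟨_, m11, m10, m01, m00, rfl⟩,
    h.move hi hj hk (SimpleDroop.blank_iff hi a2 b2 h01 h10 he) rfl⟩

/-- A slide of the corresponding crosses says that in some `2 × 2` square exactly the south-east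
tile is blank. As there are no crossings in the first `k` columns, this forces the tiles of the
square to be as required for a simple droop. -/
theorem Corresponds.exists_droop {r : ℕ} {D : BPD n} {P P' : PipeDream n}
    (h : Corresponds k D P) (hD : D.IsSplit k) (hs : SimpleSlide r P P') :
    ∃ (i : Fin n) (D' : BPD n), r = i.val + 1 ∧ SimpleDroop i D D' ∧ Corresponds k D' P' := by
  obtain ⟨c, m11, m10, m01, m00, hP⟩ := hs
  have hr : 1 ≤ r := (P'.valid (r, c + 1) (by rw [hP]; exact mem_insert_self _ _)).1
  obtain ⟨i', j', b1, hi', hc⟩ := (h _ _).1 m11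
  have hk := hD.blank _ _ b1
  let i : Fin n := ⟨r - 1, by have := i'.isLt; omega⟩
  have hi : i'.val = i.val + 1 := by simp only [i]; omega
  have hri : r = i.val + 1 := by simp only [i]; omega
  have hck : c = k - j'.val := by omega
  have hmem := h.mem_iff hD
  have n01 : D.tile i j' ≠ .blank := fun ht => m01 (by
    rw [hri, hck]; exact ((hmem _ _).1 ht).2)
  have e2 := D.match_col i i' j' hi
  rw [b1] at e2
  have hx : ∀ a b : Fin n, b.val < k → D.tile a b ≠ .cross := fun a b hb ht => by
    have := hD.cross _ _ ht; omega
  have t01 : D.tile i j' = .horiz ∨ D.tile i j' = .northWest := by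
    revert n01 e2
    cases D.tile i j' <;> simp [Tile.bottom, Tile.top]
  have hj0 : j'.val ≠ 0 := by
    intro h0
    have := D.west i j' h0
    rcases t01 with ht | ht <;> rw [ht] at this <;> exact absurd this (by simp [Tile.left])
  let j : Fin n := ⟨j'.val - 1, by omega⟩
  have hj : j'.val = j.val + 1 := by simp only [j]; omega
  have hcj : c + 1 = k - j.val := by omega
  have n10 : D.tile i' j ≠ .blank := fun ht => m10 (by
    rw [hcj, hri, ← hi]; exact ((hmem _ _).1 ht).2)
  have n00 : D.tile i j ≠ .blank := fun ht => m00 (by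
    rw [hcj, hri]; exact ((hmem _ _).1 ht).2)
  have e1 := D.match_row i' j j' hj
  rw [b1] at e1
  have t10 : D.tile i' j = .vert ∨ D.tile i' j = .northWest := by
    revert n10 e1
    cases D.tile i' j <;> simp [Tile.left, Tile.right]
  have t00 : D.tile i j = .southEast := by
    have e3 := D.match_row i j j' hj
    have e4 := D.match_col i i' j hi
    have hx00 := hx i j (by omega)
    revert n00 e3 e4 hx00
    rcases t01 with a | a <;> rcases t10 with b | b <;> rw [a, b] <;>
      cases D.tile i j <;> simp [Tile.bottom, Tile.top, Tile.left, Tile.right]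
  obtain ⟨D', d1, d2, d3, d4, d5⟩ := D.exists_replace hi hj
    (t00 := .blank)
    (t01 := if D.tile i j' = .horiz then .southEast else .vert)
    (t10 := if D.tile i' j = .vert then .southEast else .horiz)
    (t11 := .northWest)
    (by rw [t00]; exact ⟨rfl, rfl⟩)
    (by rcases t01 with a | a <;> rw [a] <;> exact ⟨rfl, rfl⟩)
    (by rcases t10 with a | a <;> rw [a] <;> exact ⟨rfl, rfl⟩)
    (by rw [b1]; exact ⟨rfl, rfl⟩)
    (by rcases t01 with a | a <;> rcases t10 with b | b <;> rw [a, b] <;>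
          exact ⟨rfl, rfl, rfl, rfl⟩)
  have hd01 : (D.tile i j' = .horiz ∧ D'.tile i j' = .southEast) ∨
      (D.tile i j' = .northWest ∧ D'.tile i j' = .vert) := by
    rcases t01 with a | a
    · rw [a] at d2; exact Or.inl ⟨a, d2⟩
    · rw [a] at d2; exact Or.inr ⟨a, d2⟩
  have hd10 : (D.tile i' j = .vert ∧ D'.tile i' j = .southEast) ∨
      (D.tile i' j = .northWest ∧ D'.tile i' j = .horiz) := by
    rcases t10 with a | a
    · rw [a] at d3; exact Or.inl ⟨a, d3⟩
    · rw [a] at d3; exact Or.inr ⟨a, d3⟩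
  refine ⟨i, D', hri, ⟨i', j, j', hi, hj, ⟨t00, d1⟩, ⟨b1, d4⟩, hd01, hd10, d5⟩, ?_⟩
  refine h.move hi hj hk (SimpleDroop.blank_iff hi d1 d4 ⟨n01, ?_⟩ ⟨n10, ?_⟩ d5) ?_
  · rcases hd01 with ⟨-, h2⟩ | ⟨-, h2⟩ <;> rw [h2] <;> simp
  · rcases hd10 with ⟨-, h2⟩ | ⟨-, h2⟩ <;> rw [h2] <;> simp
  · rw [hP, hck, hri]

/-! ### The isomorphism -/

theorem Corresponds.exists_slideLE {D D' : BPD n} {P : PipeDream n} (h : Corresponds k D P)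
    (hsplit : ∀ E, DroopLE D E → E.IsSplit k) (hs : DroopLE D D') :
    ∃ P', SlideLE P P' ∧ Corresponds k D' P' := by
  induction hs with
  | refl => exact ⟨P, Relation.ReflTransGen.refl, h⟩
  | tail hs hstep ih =>
    obtain ⟨Q, hQ, hc⟩ := ih
    obtain ⟨i, hstep⟩ := hstep
    obtain ⟨P', hP', hc'⟩ := hc.exists_slide (hsplit _ hs) hstep
    exact ⟨P', Relation.ReflTransGen.tail hQ ⟨_, hP'⟩, hc'⟩

theorem Corresponds.exists_droopLE {D : BPD n} {P P' : PipeDream n} (h : Corresponds k D P)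
    (hsplit : ∀ E, DroopLE D E → E.IsSplit k) (hs : SlideLE P P') :
    ∃ D', DroopLE D D' ∧ Corresponds k D' P' := by
  induction hs with
  | refl => exact ⟨D, Relation.ReflTransGen.refl, h⟩
  | tail hs hstep ih =>
    obtain ⟨E, hE, hc⟩ := ih
    obtain ⟨r, hstep⟩ := hstep
    obtain ⟨i, D', -, hD', hc'⟩ := hc.exists_droop (hsplit _ hE) hstep
    exact ⟨D', Relation.ReflTransGen.tail hE ⟨_, hD'⟩, hc'⟩

theorem IsShuffle.isSplit_droop {π : Equiv.Perm (Fin n)} (hπ : IsShuffle π k) (hk : k ≤ n)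
    (x : Droop π) : x.1.IsSplit k := x.2.rothe_hasPerm.isSplit hπ hk

theorem IsShuffle.isSplit_of_droopLE {π : Equiv.Perm (Fin n)} (hπ : IsShuffle π k) (hk : k ≤ n)
    (x : Droop π) (E : BPD n) (h : DroopLE x.1 E) : E.IsSplit k :=
  hπ.isSplit_droop hk ⟨E, x.2.trans h⟩

/-- Reflecting the blank tiles gives an isomorphism of posets from `droop(π)` to `slide(π)`. -/
theorem IsShuffle.exists_orderIso {π : Equiv.Perm (Fin n)} (hπ : IsShuffle π k) (hk : k ≤ n) :
    ∃ e : Droop π ≃o Slide π, ∀ x, Corresponds k x.1 (e x).1 := by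
  have hf : ∀ x : Droop π, ∃ y : Slide π, Corresponds k x.1 y.1 := fun x => by
    obtain ⟨P, hP, hc⟩ := hπ.corresponds_rothe.exists_slideLE
      (hπ.isSplit_of_droopLE hk (Droop.rothe π)) x.2
    exact ⟨⟨P, hP⟩, hc⟩
  have hg : ∀ y : Slide π, ∃ x : Droop π, Corresponds k x.1 y.1 := fun y => by
    obtain ⟨D, hD, hc⟩ := hπ.corresponds_rothe.exists_droopLE
      (hπ.isSplit_of_droopLE hk (Droop.rothe π)) y.2
    exact ⟨⟨D, hD⟩, hc⟩
  choose f hf using hf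
  choose g hg using hg
  refine ⟨⟨⟨f, g, fun x => ?_, fun y => ?_⟩, fun {x y} => ?_⟩, hf⟩
  · exact Subtype.ext ((hg (f x)).left_unique (hf x) (hπ.isSplit_droop hk _) (hπ.isSplit_droop hk _))
  · exact Subtype.ext ((hf (g y)).right_unique (hg y))
  · constructor
    · intro h
      obtain ⟨D, hD, hc⟩ := (hf x).exists_droopLE (hπ.isSplit_of_droopLE hk x) h
      have hDy := hc.left_unique (hf y) (hπ.isSplit_of_droopLE hk x D hD) (hπ.isSplit_droop hk y)
      change DroopLE x.1 y.1
      rwa [← hDy]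
    · intro h
      obtain ⟨P, hP, hc⟩ := (hf x).exists_slideLE (hπ.isSplit_of_droopLE hk x) h
      have hPy := hc.right_unique (hf y)
      change SlideLE (f x).1 (f y).1
      rwa [← hPy]

theorem Corresponds.simpleDroop_iff {D D' : BPD n} {P P' : PipeDream n} (h : Corresponds k D P)
    (h' : Corresponds k D' P') (hD : D.IsSplit k) (hD' : D'.IsSplit k)
    (hsplit : ∀ E, DroopLE D E → E.IsSplit k) (i : Fin n) :
    SimpleDroop i D D' ↔ SimpleSlide (i.val + 1) P P' := by
  constructor
  · intro hs
    obtain ⟨Q, hQ, hc⟩ := h.exists_slide hD hs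
    rwa [← hc.right_unique h']
  · intro hs
    obtain ⟨i', E, hi, hE, hc⟩ := h.exists_droop hD hs
    obtain rfl : i = i' := Fin.ext (by omega)
    rwa [← hc.left_unique h' (hsplit E (Relation.ReflTransGen.single ⟨i, hE⟩)) hD']

/-! ### Weights -/

theorem ASM.mem_nw_iff (A : ASM n) (p : Fin n × Fin n) :
    p ∈ A.nw ↔ A.toBPD.tile p.1 p.2 = .blank := by
  change _ ↔ A.tileAt p.1 p.2 = .blank
  simp only [ASM.nw, mem_filter, mem_univ, true_and]
  unfold ASM.tileAt
  rcases (A.row p.1).entries p.2 with h | h | h <;> rw [h] <;> simp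
  split_ifs <;> simp_all

theorem TSSCPP.wt_eq (T : TSSCPP n) :
    T.wt = ∏ p ∈ T.pipeDream.crosses, MvPolynomial.X p.1 := by
  unfold TSSCPP.wt
  have hones : ∀ p ∈ T.ones, (1 ≤ p.1 ∧ p.1 ≤ n - 1) ∧ (1 ≤ p.2 ∧ p.2 ≤ n - 1) ∧ n ≤ p.1 + p.2 := by
    intro p hp
    have := (mem_filter.1 hp).1
    simp only [triangle, mem_filter, mem_product, mem_Icc] at this
    exact ⟨this.1.1, this.1.2, this.2⟩
  refine prod_bij' (fun p _ => (n - p.1, p.1 + p.2 + 1 - n)) (fun p _ => (n - p.1, p.1 + p.2 - 1))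
    ?_ ?_ ?_ ?_ ?_
  · rintro ⟨i, j⟩ hp
    have hb := hones _ hp
    simp only at hb
    simp only [TSSCPP.pipeDream, mem_filter, mem_product, mem_Icc]
    refine ⟨by omega, by omega, ?_⟩
    rwa [show n - (n - i) = i by omega, show n - i + (i + j + 1 - n) - 1 = j by omega]
  · rintro ⟨r, c⟩ hp
    simp only [TSSCPP.pipeDream, mem_filter] at hp
    exact hp.2.2
  · rintro ⟨i, j⟩ hp
    have hb := hones _ hp
    simp only at hb
    simp only [Prod.mk.injEq]
    omega
  · rintro ⟨r, c⟩ hp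
    have hv := T.pipeDream.valid _ hp
    simp only at hv
    simp only [Prod.mk.injEq]
    omega
  · intro p _
    rfl

theorem Corresponds.wt_eq {A : ASM n} {P : PipeDream n} (h : Corresponds k A.toBPD P)
    (hD : A.toBPD.IsSplit k) : ∏ p ∈ P.crosses, MvPolynomial.X p.1 = A.wt := by
  unfold ASM.wt
  symm
  refine prod_bij (fun p _ => (p.1.val + 1, k - p.2.val)) ?_ ?_ ?_ ?_
  · rintro ⟨i, j⟩ hp
    rw [ASM.mem_nw_iff] at hp
    exact ((h.mem_iff hD i j).1 hp).2
  · rintro ⟨i, j⟩ hp ⟨i', j'⟩ hp' he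
    rw [ASM.mem_nw_iff] at hp hp'
    have h1 := hD.blank _ _ hp
    have h2 := hD.blank _ _ hp'
    simp only [Prod.mk.injEq, Fin.ext_iff] at he h1 h2 ⊢
    omega
  · rintro ⟨r, c⟩ hp
    obtain ⟨i, j, ht, h1, h2⟩ := (h r c).1 hp
    refine ⟨(i, j), (A.mem_nw_iff _).2 ht, ?_⟩
    simp only [Prod.mk.injEq]
    omega
  · intro p _
    rfl

end ASMTSSCPP

theorem mainTheorem8 (n : ℕ) (π : Equiv.Perm (Fin n)) (hπ : ASMTSSCPP.IsInverseGrassmannian π) :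
    ∃ (Φ : ASMTSSCPP.ASMOf π ≃ ASMTSSCPP.TSSCPPRed π)
      (α : ASMTSSCPP.ASMOf π ≃ ASMTSSCPP.Droop π)
      (β : ASMTSSCPP.TSSCPPRed π ≃ ASMTSSCPP.Slide π)
      (e : ASMTSSCPP.Droop π ≃o ASMTSSCPP.Slide π),
      (∀ A, (α A).1 = A.1.toBPD) ∧
      (∀ T, (β T).1 = T.1.pipeDream) ∧
      (∀ A, (Φ A).1.wt = A.1.wt) ∧
      (∀ A, β (Φ A) = e (α A)) ∧
      e (ASMTSSCPP.Droop.rothe π) = ASMTSSCPP.Slide.bottom π ∧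
      (∀ (D D' : ASMTSSCPP.Droop π) (i : Fin n),
        ASMTSSCPP.SimpleDroop i D.1 D'.1 ↔
          ASMTSSCPP.SimpleSlide (i.val + 1) (e D).1 (e D').1) := by
  obtain ⟨k, hk, hs⟩ := hπ.exists_isShuffle
  obtain ⟨α, hα⟩ := hs.exists_droopEquiv hk
  obtain ⟨β, hβ⟩ := hs.exists_slideEquiv
  obtain ⟨e, he⟩ := hs.exists_orderIso hk
  have hΦ : ∀ A, β ((α.trans (e.toEquiv.trans β.symm)) A) = e (α A) := fun A => by
    simp only [Equiv.trans_apply, Equiv.apply_symm_apply]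
    rfl
  refine ⟨α.trans (e.toEquiv.trans β.symm), α, β, e, hα, hβ, fun A => ?_, hΦ, ?_, fun D D' i => ?_⟩
  · have hc := he (α A)
    have hD := hs.isSplit_droop hk (α A)
    rw [hα] at hc hD
    rw [ASMTSSCPP.TSSCPP.wt_eq, ← hβ, hΦ]
    exact hc.wt_eq hD
  · exact Subtype.ext ((he _).right_unique hs.corresponds_rothe)
  · exact (he D).simpleDroop_iff (he D') (hs.isSplit_droop hk D) (hs.isSplit_droop hk D')
      (hs.isSplit_of_droopLE hk D) i
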